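/- Let $\mathcal B(r)\subset\mathbb R^d$ be the closed Euclidean ball of radius $r$ around $0$. There is an absolute constant $p$ and, for all $\alpha>0$ and $\eta\ge 11$, a constant $K>0$ depending only on $\alpha$ and $\eta$, such that the following holds for all $d\ge 1$ and $0<\varepsilon\le 1/d$. Put $\beta=\min\{\frac18,\frac\alpha2\}$, $c=\frac14$ and $T=\max\{1,\lceil \frac{d\ln(d/\varepsilon)}{\alpha\varepsilon}\rceil\}$. *Setting.* $\mathcal C\subseteq\mathcal B(1)$ is nonempty, closed and convex; $\xi_1,\xi_2,\dots$ are i.i.d.; for every $\xi$ the loss $f(\cdot,\xi):\mathcal C\to\mathbb R$ is $1$-Lipschitz and $\alpha$-exp-concave (i.e. $e^{-\alpha f(\cdot,\xi)}$ is concave); $f(w)=\mathbb E[f(w,\xi)]$ is finite on $\mathcal C$. *Algorithm over the ball (parameters $B,\eta,\beta,c$).* Set $w_1=v_1=0$. In round $t$ a vector $g_t$ is received. With $$\Phi_{t+1}(x)=-\eta d\ln(1-\|x\|^2)+\tfrac{d+\eta B^2}{2}\|x\|^2+\tfrac\beta2\sum_{s\le t}\langle g_s,x-w_s\rangle^2+\Big\langle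 x,\sum_{s\le t}g_s\Big\rangle ,$$ $$A_t=\Big(\tfrac{2\eta d}{1-\|v_t\|^2}I+(d+\eta B^2)I+\beta\sum_{s\le t}g_sg_s^\top\Big)^{-1},\qquad H_t=\Big(A_t^{-1}+\tfrac{4\eta d\,w_tw_t^\top}{(1-\|w_t\|^2)^2}\Big)^{-1},\qquad \gamma_t=\tfrac{2\eta d}{1-\|v_t\|^2}-\tfrac{2\eta d}{1-\|w_t\|^2},$$ put $w_{t+1}=w_t-\sum_{k=1}^{m+1}\gamma_t^{k-1}H_t^k\nabla\Phi_{t+1}(w_t)$, and $v_{t+1}=v_t$ if $|\|w_{t+1}\|^2-\|v_t\|^2|\le c(1-\|v_t\|^2)$, $v_{t+1}=w_{t+1}$ otherwise. Here $m=\big\lceil-\log_c\frac{12(4+32/\eta^2)^2(2\eta d+B^2\eta+(B+2\beta B^2)T)^2T}{1-c}\big\rceil$. *Reduction.* In round $t=1,\dots,T$ the point $u_t\in\mathcal C$ is played, a subgradient $\zeta_t\in\partial f(\cdot,\xi_t)(u_t)$ with $\|\zeta_t\|\le 1$ is observed and $g_t$ is passed to the algorithm over the ball. Either (a) $B=1$;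 $u_t$ is the Euclidean projection of $w_t$ onto $\mathcal C$, $\nu_t$ is a subgradient at $w_t$ of $S(w)=\inf_{x\in\mathcal C}\|w-x\|$, and $g_t=\zeta_t-\mathbb I_{\{\langle\zeta_t,\nu_t\rangle<0\}}\langle\zeta_t,\nu_t\rangle\nu_t$; or (b) $\mathcal C=-\mathcal C$, $\mathcal B(1/\sqrt d)\subseteq\mathcal C\subseteq\mathcal B(1)$ and $B=1+\sqrt d$; $\nu_t$ is a subgradient at $w_t$ of $S(w)=\inf_{x\in\mathcal C}\mathrm{gauge}_{\mathcal C}(w-x)$, $\gamma'_t=\langle\nu_t,w_t\rangle$, $u_t=w_t/\gamma'_t$ if $\gamma'_t\ge 1$ and $u_t=w_t$ otherwise, and $g_t=\zeta_t-\mathbb I_{\{\langle\zeta_t,w_t\rangle<0\}}\langle\zeta_t,u_t\rangle\nu_t$. More generally, for some $\delta\in[0,1/T]$, $\nu_t$ may be a $\delta$-subgradient of $S$ at $w_t$ and $\gamma'_t$ may satisfy $|\gamma'_t-\langle\nu_t,w_t\rangle|\le\delta$, provided that $u_t\in\mathcal C$. *Claim 1.* In both cases, if each $u_t$ is a measurable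 function of $\xi_1,\dots,\xi_{t-1}$, then $\bar u_T=\frac1T\sum_{t=1}^Tu_t$ satisfies $\mathbb E[f(\bar u_T)-\inf_{u\in\mathcal C}f(u)]\le K\varepsilon$. *Claim 2.* The cost is measured by the number of arithmetic operations and comparisons on real numbers (playing a point and observing a subgradient, and passing data to and from an oracle, are charged $d$ each) plus the cost of the calls to an oracle for $\mathcal C$. For all $\alpha,\eta,d,\varepsilon$ there are programs, independent of $\mathcal C$, of the losses and of the distribution, which play $T$ rounds and output $\bar u_T$ for a run $(u_t)$ of the reduction, always at cost at most $$K\ln^p\!\big(1+\tfrac d\varepsilon\big)\,\tfrac d\varepsilon\,\big(d^2+\tau\big),$$ where in case (a) the iterates are exact, the oracle is a Euclidean projection oracle and $\tau=T_{\mathrm{proj}}(\mathcal C)\ge0$ is the cost of one call, and in case (b) the iterates are those with $\delta=1/T$, the oracle is a separation oracle and $\tau=T_{\mathrm{sep}}(\mathcal C)\ge0$ is the cost of one call. If the observed subgradients depend measurably on the point and the sample (and, in case (b), the oracle is measurable), the output satisfies $\mathbb E[f(\bar u_T)-\inf_{\mathcal C}f]\le K\varepsilon$. *Claim 3.* For $\mathcal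 C=\mathcal B(1)$ there is such a program for case (a) that makes no calls to an oracle for $\mathcal C$ and performs at most $K\ln^p(1+\frac d\varepsilon)\,\frac{d^3}{\varepsilon}$ operations. -/

import Mathlib

open MeasureTheory ProbabilityTheory

noncomputable section

namespace ExpConcave

universe u v

/-- Euclidean space of dimension `d`. -/
abbrev Vec (d : ℕ) := EuclideanSpace ℝ (Fin d)

/-! ### Convex-analytic notions -/

/-- `f` is `α`-exp-concave on `C`: the function `exp (-α f)` is concave on the convex set `C`. -/
def ExpConcaveOn {d : ℕ} (α : ℝ) (C : Set (Vec d)) (f : Vec d → ℝ) : Prop :=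
  ConcaveOn ℝ C (fun x => Real.exp (-α * f x))

/-- `v` is a `δ`-subgradient at `x` of the function `h` with domain `D`;
for `δ = 0` this is the usual notion `v ∈ ∂h(x)`. -/
def IsSubgradient {d : ℕ} (D : Set (Vec d)) (h : Vec d → ℝ) (δ : ℝ) (x v : Vec d) : Prop :=
  ∀ y ∈ D, h x + inner ℝ v (y - x) - δ ≤ h y

/-- The function `S(w) = inf_{x ∈ C} ρ(w - x)`. -/
def setDist {d : ℕ} (ρ : Vec d → ℝ) (C : Set (Vec d)) (w : Vec d) : ℝ :=
  ⨅ x : C, ρ (w - x)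

/-- A centrally symmetric set with `B(1/√d) ⊆ C ⊆ B(1)`. -/
structure IsSymmetricBody {d : ℕ} (C : Set (Vec d)) : Prop where
  neg_mem : ∀ x ∈ C, -x ∈ C
  inner_ball : Metric.closedBall 0 (1 / Real.sqrt d) ⊆ C
  outer_ball : C ⊆ Metric.closedBall 0 1

/-- Euclidean projection oracle for `C`: it either asserts `x ∈ C` (answer `none`) or returns a
point of `C` closest to `x`. -/
def IsProjOracle {d : ℕ} (C : Set (Vec d)) (o : Vec d → Option (Vec d)) : Prop :=
  ∀ x, (o x = none → x ∈ C) ∧ ∀ y, o x = some y → y ∈ C ∧ ∀ z ∈ C, ‖y - x‖ ≤ ‖z - x‖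

/-- Separation oracle for `C`: it either asserts `x ∈ C` (answer `none`) or returns a vector `s`
with `⟨s, x⟩ > ⟨s, z⟩` for all `z ∈ C`. -/
def IsSepOracle {d : ℕ} (C : Set (Vec d)) (o : Vec d → Option (Vec d)) : Prop :=
  ∀ x, (o x = none → x ∈ C) ∧ ∀ s, o x = some s → ∀ z ∈ C, inner ℝ s z < inner ℝ s x

/-! ### Online quasi-Newton steps over the unit ball

Rounds are numbered from `0`; `g s` is the subgradient received in round `s` and `w s` the
iterate of round `s`. -/

/-- The potential built from the subgradients of the first `t` rounds: log-barrier of the ball,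
quadratic regularizer, and quadratic approximations of the losses. -/
def potential {d : ℕ} (B η β : ℝ) (g w : ℕ → Vec d) (t : ℕ) (x : Vec d) : ℝ :=
  -(η * d) * Real.log (1 - ‖x‖ ^ 2) + (d + B ^ 2 * η) / 2 * ‖x‖ ^ 2
    + β / 2 * ∑ s ∈ Finset.range t, (inner ℝ (g s) (x - w s)) ^ 2
    + inner ℝ x (∑ s ∈ Finset.range t, g s)

/-- The outer product `x xᵀ`. -/
def outer {d : ℕ} (x : Vec d) : Matrix (Fin d) (Fin d) ℝ :=
  Matrix.vecMulVec x.ofLp x.ofLp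

/-- `A_t`, with landmark `v`; it involves the subgradients of rounds `0, …, t`. -/
def matA {d : ℕ} (B η β : ℝ) (g : ℕ → Vec d) (t : ℕ) (v : Vec d) :
    Matrix (Fin d) (Fin d) ℝ :=
  ((2 * η * d / (1 - ‖v‖ ^ 2)) • (1 : Matrix (Fin d) (Fin d) ℝ)
    + ((d : ℝ) + η * B ^ 2) • (1 : Matrix (Fin d) (Fin d) ℝ)
    + β • ∑ s ∈ Finset.range (t + 1), outer (g s))⁻¹

/-- `H_t`, with landmark `v` and current iterate `x`. -/
def matH {d : ℕ} (B η β : ℝ) (g : ℕ → Vec d) (t : ℕ) (v x : Vec d) :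
    Matrix (Fin d) (Fin d) ℝ :=
  ((matA B η β g t v)⁻¹ + (4 * η * d / (1 - ‖x‖ ^ 2) ^ 2) • outer x)⁻¹

/-- The order-`m` Taylor approximation `∑_{k=1}^{m+1} γ_t^{k-1} H_t^k` of the inverse Hessian. -/
def taylorH {d : ℕ} (B η β : ℝ) (m : ℕ) (g : ℕ → Vec d) (t : ℕ) (v x : Vec d) :
    Matrix (Fin d) (Fin d) ℝ :=
  ∑ k ∈ Finset.range (m + 1),
    (2 * η * d / (1 - ‖v‖ ^ 2) - 2 * η * d / (1 - ‖x‖ ^ 2)) ^ k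
      • matH B η β g t v x ^ (k + 1)

/-- The Taylor order used by the algorithm when it is run for `T` rounds. -/
def taylorOrder (d : ℕ) (B η β c : ℝ) (T : ℕ) : ℕ :=
  ⌈-Real.logb c (12 * (4 + 32 / η ^ 2) ^ 2
      * (2 * η * d + B ^ 2 * η + (B + 2 * β * B ^ 2) * T) ^ 2 * T / (1 - c))⌉₊

/-- `w` are the iterates and `v` the landmarks of the online quasi-Newton algorithm with
parameters `B, η, β, c` and Taylor order `m`, when it receives the subgradients `g` during `T`
rounds. -/
structure IsOQNS {d : ℕ} (B η β c : ℝ) (m T : ℕ) (g w v : ℕ → Vec d) : Prop where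
  init_w : w 0 = 0
  init_v : v 0 = 0
  step_w : ∀ t < T, w (t + 1) = w t -
    Matrix.toEuclideanLin (taylorH B η β m g t (v t) (w t))
      (gradient (potential B η β g w (t + 1)) (w t))
  keep_v : ∀ t < T, |‖w (t + 1)‖ ^ 2 - ‖v t‖ ^ 2| ≤ c * (1 - ‖v t‖ ^ 2) → v (t + 1) = v t
  move_v : ∀ t < T, ¬ |‖w (t + 1)‖ ^ 2 - ‖v t‖ ^ 2| ≤ c * (1 - ‖v t‖ ^ 2) →
    v (t + 1) = w (t + 1)

/-! ### Reduction from a convex set to the unit ball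

A round of the reduction relates the iterate `w` over the ball, the point `u ∈ C` that is played,
the subgradient `ζ` of the loss at `u` and the subgradient `g` passed to the algorithm over the
ball. -/

/-- A round of the reduction for `ρ = ‖·‖`: `u` is the Euclidean projection of `w` and `ν` a
subgradient at `w` of the distance to `C`. -/
def ProjRound {d : ℕ} (C : Set (Vec d)) (w u ζ g : Vec d) : Prop :=
  ∃ ν : Vec d, IsSubgradient Set.univ (setDist (fun x => ‖x‖) C) 0 w ν ∧
    u ∈ C ∧ (∀ z ∈ C, ‖u - w‖ ≤ ‖z - w‖) ∧
    g = ζ - (if inner ℝ ζ ν < 0 then inner ℝ ζ ν else 0) • ν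

/-- A round of the reduction for `ρ` the gauge of `C`, where the subgradient `ν` of `S` at `w` and
the scaling factor `γ = ⟨ν, w⟩` are evaluated with accuracy `δ`. For `δ = 0` they are exact (and
`u ∈ C` holds automatically for the sets considered). -/
def GaugeRound {d : ℕ} (C : Set (Vec d)) (δ : ℝ) (w u ζ g : Vec d) : Prop :=
  ∃ (ν : Vec d) (γ : ℝ), IsSubgradient Set.univ (setDist (gauge C) C) δ w ν ∧
    |γ - inner ℝ ν w| ≤ δ ∧
    u = (if 1 ≤ γ then γ⁻¹ • w else w) ∧ u ∈ C ∧
    g = ζ - (if inner ℝ ζ w < 0 then inner ℝ ζ u else 0) • ν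

/-- `u` are the points played in `T` rounds by the reduction with rounds `round`, whose subroutine
over the ball is the online quasi-Newton algorithm with parameters `B, η, β` and `c = 1/4`, when
the subgradients `ζ` are observed. -/
def IsRun {d : ℕ} (round : Vec d → Vec d → Vec d → Vec d → Prop) (B η β : ℝ) (T : ℕ)
    (u ζ : ℕ → Vec d) : Prop :=
  ∃ w v g : ℕ → Vec d,
    IsOQNS B η β (1 / 4) (taylorOrder d B η β (1 / 4) T) T g w v ∧
    ∀ t < T, round (w t) (u t) (ζ t) (g t)

/-- The average of the first `T` iterates. -/
def avgIterate {d : ℕ} (T : ℕ) (u : ℕ → Vec d) : Vec d :=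
  (T : ℝ)⁻¹ • ∑ t ∈ Finset.range T, u t

/-- The number of rounds `d ln(d/ε) / (α ε)`, rounded up to a positive integer. -/
def numRounds (α : ℝ) (d : ℕ) (ε : ℝ) : ℕ :=
  max 1 ⌈d * Real.log (d / ε) / (α * ε)⌉₊

/-- `β = min (1/8) (α/2)`. -/
def betaOf (α : ℝ) : ℝ := min (1 / 8) (α / 2)

/-! ### Stochastic exp-concave optimization -/

/-- The stochastic setting: `C` is a nonempty closed convex subset of the unit ball, the samples
`ξ 0, ξ 1, …` are i.i.d., and all losses `f · z` are `α`-exp-concave and `1`-Lipschitz on `C`, with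
a finite expectation. -/
structure IsStochExpConcave {d : ℕ} {Ω : Type u} {Ξ : Type v} [MeasurableSpace Ω]
    [MeasurableSpace Ξ] (μ : Measure Ω) (α : ℝ) (C : Set (Vec d)) (f : Vec d → Ξ → ℝ)
    (ξ : ℕ → Ω → Ξ) : Prop where
  isClosed : IsClosed C
  convex : Convex ℝ C
  nonempty : C.Nonempty
  subset_ball : C ⊆ Metric.closedBall 0 1
  measurable_sample : ∀ t, Measurable (ξ t)
  indep : iIndepFun ξ μ
  identDistrib : ∀ t, IdentDistrib (ξ t) (ξ 0) μ μ
  measurable_loss : ∀ w ∈ C, Measurable (f w)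
  integrable_loss : ∀ w ∈ C, Integrable (fun ω => f w (ξ 0 ω)) μ
  expConcave : ∀ z, ExpConcaveOn α C (fun w => f w z)
  lipschitz : ∀ z, LipschitzOnWith 1 (fun w => f w z) C

/-- `ζ` is an admissible subgradient at `x` of the `1`-Lipschitz loss `h : C → ℝ`: a subgradient
of norm at most `1`. (At boundary points of `C` the subdifferential of `h` also contains vectors
of arbitrarily large norm, which differ by normal vectors of `C`.) -/
def IsLossSubgradient {d : ℕ} (C : Set (Vec d)) (h : Vec d → ℝ) (x ζ : Vec d) : Prop :=
  IsSubgradient C h 0 x ζ ∧ ‖ζ‖ ≤ 1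

/-- The sigma-algebra generated by the samples of the rounds before `t`. -/
@[reducible]
def past {Ω : Type u} {Ξ : Type v} [MeasurableSpace Ξ] (ξ : ℕ → Ω → Ξ) (t : ℕ) :
    MeasurableSpace Ω :=
  ⨆ (s : ℕ) (_ : s < t), MeasurableSpace.comap (ξ s) inferInstance

/-- The population risk `f(w) = E[f(w, ξ)]`. -/
def risk {d : ℕ} {Ω : Type u} {Ξ : Type v} [MeasurableSpace Ω] (μ : Measure Ω)
    (f : Vec d → Ξ → ℝ) (ξ : ℕ → Ω → Ξ) (w : Vec d) : ℝ :=
  ∫ ω, f w (ξ 0 ω) ∂μ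

/-- The random point `x` of `C` satisfies `E[f(x) - inf_C f] ≤ r` for the population risk `f`. -/
def ExcessRiskLE {d : ℕ} {Ω : Type u} {Ξ : Type v} [MeasurableSpace Ω] (μ : Measure Ω)
    (C : Set (Vec d)) (f : Vec d → Ξ → ℝ) (ξ : ℕ → Ω → Ξ) (x : Ω → Vec d) (r : ℝ) : Prop :=
  (∀ ω, x ω ∈ C) ∧ Integrable (fun ω => risk μ f ξ (x ω)) μ ∧
    ∫ ω, (risk μ f ξ (x ω) - sInf (risk μ f ξ '' C)) ∂μ ≤ r

/-- `u` are the iterates of the reduction on the random losses `f(·, ξ t)`: for every outcome a run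
with subgradients `ζ t ∈ ∂f(u t, ξ t)`, where the point played in round `t` is determined
(measurably) by the samples of the earlier rounds. -/
structure IsStochRun {d : ℕ} {Ω : Type u} {Ξ : Type v} [MeasurableSpace Ξ]
    (round : Vec d → Vec d → Vec d → Vec d → Prop) (B η β : ℝ) (T : ℕ)
    (C : Set (Vec d)) (f : Vec d → Ξ → ℝ) (ξ : ℕ → Ω → Ξ) (u ζ : ℕ → Ω → Vec d) : Prop where
  run : ∀ ω, IsRun round B η β T (fun t => u t ω) (fun t => ζ t ω)
  subgradient : ∀ t < T, ∀ ω, IsLossSubgradient C (fun x => f x (ξ t ω)) (u t ω) (ζ t ω)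
  adapted : ∀ t < T, Measurable[past ξ t] (u t)

/-! ### Machine model

Programs over real registers in the style of algebraic computation trees: arithmetic operations
on, and comparisons of, the contents of fixed registers, calls to an oracle for the feasible set,
and rounds in which a point is played and a subgradient of the loss of that round is observed.
Branching only depends on comparisons, and a program refers to the feasible set and to the losses
only through its calls; loops whose length is known in advance are unrolled. Every instruction is
charged, with its actual cost along the executed branch. -/

/-- The arithmetic operations. -/
inductive ArithOp
  | plus
  | minus
  | times
  | divide

/-- The value of an arithmetic operation. -/
def ArithOp.eval : ArithOp → ℝ → ℝ → ℝ
  | .plus, x, y => x + y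
  | .minus, x, y => x - y
  | .times, x, y => x * y
  | .divide, x, y => x / y

/-- Programs. -/
inductive Program
  /-- do nothing -/
  | skip
  /-- store the constant `q` in register `r` -/
  | const (r : ℕ) (q : ℝ)
  /-- apply an operation to registers `a`, `b` and store the result in register `r` -/
  | arith (op : ArithOp) (r a b : ℕ)
  /-- branch on whether register `a` is at most register `b` -/
  | ite (a b : ℕ) (yes no : Program)
  /-- sequential composition -/
  | seq (first second : Program)
  /-- play the point in registers `a, …, a+d-1`; store the subgradient in `b, …, b+d-1` -/
  | play (a b : ℕ)
  /-- call the set oracle at the point in registers `a, …, a+d-1`; register `b` receives `1` if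
  the oracle asserts membership, otherwise it receives `0` and `b+1, …, b+d` the vector returned -/
  | call (a b : ℕ)

/-- Configuration of a computation: register contents, the points played so far, and counters of
the rounds, the oracle calls and the elementary operations. -/
structure State (d : ℕ) where
  reg : ℕ → ℝ
  played : ℕ → Vec d
  rounds : ℕ
  calls : ℕ
  ops : ℕ

/-- The initial configuration. -/
def State.init (d : ℕ) : State d := ⟨fun _ => 0, fun _ => 0, 0, 0, 0⟩

/-- The vector in the `d` registers from `a` on. -/
def readVec (d : ℕ) (reg : ℕ → ℝ) (a : ℕ) : Vec d :=
  WithLp.toLp 2 (fun i : Fin d => reg (a + i))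

/-- Store a vector in the `d` registers from `b` on. -/
def writeVec {d : ℕ} (reg : ℕ → ℝ) (b : ℕ) (x : Vec d) : ℕ → ℝ := fun r =>
  if h : b ≤ r ∧ r < b + d then x ⟨r - b, by omega⟩ else reg r

/-- Execution of a program. `grad t x` is the subgradient observed when `x` is played in round
`t`, and `o` is the oracle for the feasible set. -/
def Program.exec {d : ℕ} (grad : ℕ → Vec d → Vec d) (o : Vec d → Option (Vec d)) :
    Program → State d → State d
  | .skip, σ => σ
  | .const r q, σ => { σ with reg := Function.update σ.reg r q, ops := σ.ops + 1 }
  | .arith op r a b, σ =>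
      { σ with reg := Function.update σ.reg r (op.eval (σ.reg a) (σ.reg b)), ops := σ.ops + 1 }
  | .ite a b yes no, σ =>
      if σ.reg a ≤ σ.reg b then yes.exec grad o { σ with ops := σ.ops + 1 }
      else no.exec grad o { σ with ops := σ.ops + 1 }
  | .seq first second, σ => second.exec grad o (first.exec grad o σ)
  | .play a b, σ =>
      { σ with
        reg := writeVec σ.reg b (grad σ.rounds (readVec d σ.reg a))
        played := Function.update σ.played σ.rounds (readVec d σ.reg a)
        rounds := σ.rounds + 1
        ops := σ.ops + d }
  | .call a b, σ =>
      { σ with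
        reg := match o (readVec d σ.reg a) with
          | none => Function.update σ.reg b 1
          | some x => writeVec (Function.update σ.reg b 0) (b + 1) x
        calls := σ.calls + 1
        ops := σ.ops + d }

/-- The final configuration of a program. -/
def Program.final {d : ℕ} (P : Program) (grad : ℕ → Vec d → Vec d)
    (o : Vec d → Option (Vec d)) : State d :=
  P.exec grad o (State.init d)

/-- The output of a program: the vector in the first `d` registers. -/
def Program.output {d : ℕ} (P : Program) (grad : ℕ → Vec d → Vec d)
    (o : Vec d → Option (Vec d)) : Vec d :=
  readVec d (P.final grad o).reg 0

/-- The cost of a computation if one call to the set oracle costs `τ`. -/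
def Program.cost {d : ℕ} (P : Program) (grad : ℕ → Vec d → Vec d)
    (o : Vec d → Option (Vec d)) (τ : ℝ) : ℝ :=
  (P.final grad o).ops + τ * (P.final grad o).calls

/-- The computation plays exactly `T` rounds, the points played are those of a run of the reduction
(with the subgradients observed) and the output is their average. -/
def Program.Implements {d : ℕ} (P : Program) (round : Vec d → Vec d → Vec d → Vec d → Prop)
    (B η β : ℝ) (T : ℕ) (grad : ℕ → Vec d → Vec d) (o : Vec d → Option (Vec d)) : Prop :=
  (P.final grad o).rounds = T ∧
    IsRun round B η β T (P.final grad o).played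
      (fun t => grad t ((P.final grad o).played t)) ∧
    P.output grad o = avgIterate T (P.final grad o).played

end ExpConcave

end

open MeasureTheory ProbabilityTheory ExpConcave

universe u v

open MeasureTheory ProbabilityTheory

noncomputable section

open scoped Matrix

namespace ExpConcave

/-! ### Exp-concave losses and the reduction to the ball -/

/-! Regret. Exp-concavity improves the linear regret bound by a negative quadratic term
(`ExpConcaveOn.sub_le`), and both reductions keep that term while moving the game from `C` to the
ball (`IsSurrogate.loss_sub_le`). Over the ball the comparison is follow-the-regularised-leader for
the potential, but the leader is only tracked, by one approximate Newton step per round. A new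
subgradient raises the Newton decrement by at most its dual norm `√dualSq`, which is at most `1/√η`;
one step then multiplies the decrement by at most `6/25` (`oqns_step`). With `η ≥ 11` this balance
is self-sustaining (`IsOQNS.iterInv`): the iterates stay inside the ball, and the squared decrements
sum to a constant times `∑ dualSq`, which the determinant argument `sum_dualSq_le` bounds by `d log
(1 + T) / β`. Telescoping the potential gives `IsOQNS.regret_le`. Its comparator must lie inside the
open ball, so the true comparator is shrunk by `1 - 1/T`, where the barrier costs at most `log T`
(`IsRun.regret_le`). Independence of the point of a round from its sample, together with convexity
of the risk, turns regret into excess risk, and the choice of `T` makes regret over `T` of order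
`ε`.

Approximate inverse. The identity coefficient of the Hessian changes in every round. Frozen at the
landmark, it leaves a matrix changing only by rank-one terms; the true Hessian is that matrix minus
`γ I`, and its inverse is a Neumann series in `γ H`. The landmark test keeps `γ H` below `1/3` in
the relevant norm, so five terms already suffice for the decrement analysis.

Landmarks. A landmark change requires `log (1 - ‖w‖²)` to have drifted by at least `1/5`, while a
step of local length `s` moves this logarithm by at most `2s`. Cauchy–Schwarz and the bound on the
squared decrements leave `O(√(T log T / β))` changes (`IsOQNS.card_landmarkMoves_le`).

Cost. Ordinary rounds need only matrix-vector products and Sherman–Morrison updates, a logarithmic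
number of `d²` operations; a landmark change needs `d³`. Since `ε ≤ 1/d` means `d² ≤ d/ε`, the
roughly `√T` expensive rounds total no more than `(d/ε) d²` up to logarithms (`ops_bound_le`). The
program is verified against the iterates read off from its own execution (`final_main`): correctness
needs the iterate in the ball, the analysis needs correctness up to that round, and one induction
carries both. Projections are obtained with one query per round, the gauge by bisection with
separators; a separating vector at a good lower bound of the gauge, suitably scaled, is the required
approximate subgradient (`Bracket.gaugeData`). -/

theorem add_sq_div_four_le_neg_log_one_sub {z : ℝ} (h1 : -1 ≤ z) (h2 : z < 1) :
    z + z ^ 2 / 4 ≤ -Real.log (1 - z) := by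
  rcases le_total 0 z with hz | hz
  · have hs := Real.hasSum_pow_div_log_of_abs_lt_one (x := z) (by
    rw [abs_lt]; constructor <;> linarith)
    have := sum_le_hasSum (Finset.range 2) (fun i _ => by positivity) hs
    simp [Finset.sum_range_succ] at this
    nlinarith [sq_nonneg z]
  · have hx : 0 ≤ -z - z ^ 2 / 4 := by nlinarith
    have h3 := Real.quadratic_le_exp_of_nonneg hx
    -- Second-order lower bound for the exponential: on `[-1, 0]` the factor `(1 + z/4)²` is at
    -- least `1/2`, so half the square of the exponent pays for `-z²/4`.
    have h4 : 1 - z ≤ Real.exp (-z - z ^ 2 / 4) := by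
      refine le_trans ?_ h3
      have : (-z - z ^ 2 / 4) ^ 2 = z ^ 2 * (1 + z / 4) ^ 2 := by ring
      nlinarith [mul_nonneg (sq_nonneg z) (show 0 ≤ (1 + z / 4) ^ 2 - 1 / 2 by nlinarith)]
    have h5 := (Real.log_le_iff_le_exp (by linarith : 0 < 1 - z)).2 h4
    linarith

/-- Subtract `1`, divide by `s` and let `s` decrease to `0`: the left side becomes constant and the
right side tends to a derivative. Only this explicit exponential is differentiated, so the loss
itself may be nonsmooth. -/
theorem exp_neg_mul_le_of_tendsto {α a b : ℝ}
    (h : ∀ s ∈ Set.Ioo (0 : ℝ) 1, 1 - s + s * Real.exp (-α * b) ≤ Real.exp (-α * (s * a))) :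
    Real.exp (-α * b) ≤ 1 - α * a := by
  have hd : HasDerivAt (fun s : ℝ => Real.exp (-α * (s * a))) (-α * a) 0 := by
    have h0 : HasDerivAt (fun s : ℝ => -α * (s * a)) (-α * (1 * a)) 0 :=
      ((hasDerivAt_id (0 : ℝ)).mul_const a).const_mul (-α)
    have := h0.exp
    simpa using this
  have ht := hd.tendsto_slope_zero_right
  have hc : Real.exp (-α * b) - 1 ≤ -α * a := by
    refine ge_of_tendsto ht ?_
    filter_upwards [Ioo_mem_nhdsGT (zero_lt_one' ℝ)] with s hs
    have := h s hs
    have hs0 := hs.1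
    simp only [zero_add, smul_eq_mul, zero_mul, mul_zero, Real.exp_zero]
    rw [inv_mul_eq_div, le_div_iff₀ hs0]
    nlinarith
  linarith

/-- Quadratic lower bound on an exp-concave loss. -/
theorem ExpConcaveOn.sub_le {d : ℕ} {α β : ℝ} (hα : 0 < α) (hβ : 0 < β) (h8 : β ≤ 1 / 8)
    (hβα : β ≤ α / 2) {C : Set (Vec d)} {f : Vec d → ℝ} (hf : ExpConcaveOn α C f)
    {x y ζ : Vec d} (hx : x ∈ C) (hy : y ∈ C) (hζ : IsSubgradient C f 0 x ζ)
    (h2 : |(inner ℝ ζ (x - y) : ℝ)| ≤ 2) :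
    f x - f y ≤ inner ℝ ζ (x - y) - β / 2 * (inner ℝ ζ (x - y) : ℝ) ^ 2 := by
  set a : ℝ := inner ℝ ζ (y - x) with ha
  have hax : (inner ℝ ζ (x - y) : ℝ) = -a := by rw [ha, ← inner_neg_right, neg_sub]
  rw [hax] at h2 ⊢
  set b := f y - f x with hb
  have key : Real.exp (-α * b) ≤ 1 - α * a := by
    apply exp_neg_mul_le_of_tendsto
    intro s hs
    have hc := hf.2 hx hy (show 0 ≤ 1 - s by linarith [hs.2]) hs.1.le (sub_add_cancel 1 s)
    have hmem : (1 - s) • x + s • y ∈ C := hf.1 hx hy (by linarith [hs.2]) hs.1.le (by ring)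
    -- On the segment the subgradient inequality bounds the loss below by an affine function;
    -- inserted in the concavity of `exp (-α f)`, it gives the hypothesis of the limit lemma.
    have hsub := hζ _ hmem
    have he : (1 - s) • x + s • y - x = s • (y - x) := by module
    rw [he, inner_smul_right, ← ha] at hsub
    simp only [smul_eq_mul] at hc
    have h1 : Real.exp (-α * f ((1 - s) • x + s • y)) ≤ Real.exp (-α * f x) * Real.exp (-α * (s *
      a)) := by
      rw [← Real.exp_add]; apply Real.exp_le_exp.2; nlinarith
    have h3 : Real.exp (-α * f y) = Real.exp (-α * f x) * Real.exp (-α * b) := by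
      rw [← Real.exp_add]; congr 1; rw [hb]; ring
    rw [h3] at hc
    have hpos := Real.exp_pos (-α * f x)
    refine le_of_mul_le_mul_left ?_ hpos
    linarith
  have hθ : 2 * β / α ≤ 1 := by rw [div_le_one hα]; linarith
  have hθ0 : 0 ≤ 2 * β / α := by positivity
  -- Convexity of `exp` between `-α b` and `0` lowers the exponent from `α` to `2β`. Then `|2βa| ≤
  -- 1/2`, since `β ≤ 1/8` and `|a| ≤ 2`, and the logarithmic inequality applies.
  have key2 : Real.exp (-(2 * β) * b) ≤ 1 - 2 * β * a := by
    have hcv := convexOn_exp.2 (Set.mem_univ (-α * b)) (Set.mem_univ 0) hθ0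
      (by linarith : 0 ≤ 1 - 2 * β / α) (by ring)
    simp only [smul_eq_mul, mul_zero, add_zero, Real.exp_zero, mul_one] at hcv
    have e1 : 2 * β / α * (-α * b) = -(2 * β) * b := by field_simp
    rw [e1] at hcv
    have e2 : 2 * β / α * (1 - α * a) + (1 - 2 * β / α) = 1 - 2 * β * a := by field_simp; ring
    nlinarith [mul_le_mul_of_nonneg_left key hθ0]
  obtain ⟨h2a, h2b⟩ := abs_le.1 h2
  have hz1 : -1 ≤ 2 * β * a := by nlinarith
  have hz2 : 2 * β * a < 1 := by nlinarith
  have hlog := add_sq_div_four_le_neg_log_one_sub hz1 hz2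
  have hl2 := (Real.le_log_iff_exp_le (by linarith : 0 < 1 - 2 * β * a)).2 key2
  have : 2 * β * (a + β / 2 * a ^ 2) ≤ 2 * β * b := by nlinarith
  have := le_of_mul_le_mul_left this (by positivity)
  rw [hb] at this
  linarith [this, neg_sq a]

theorem setDist_nonneg {d : ℕ} {ρ : Vec d → ℝ} (hρ : ∀ x, 0 ≤ ρ x) (C : Set (Vec d)) (w : Vec d) :
    0 ≤ setDist ρ C w := Real.iInf_nonneg fun _ => hρ _

theorem setDist_le {d : ℕ} {ρ : Vec d → ℝ} (hρ : ∀ x, 0 ≤ ρ x) {C : Set (Vec d)} {x : Vec d}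
    (hx : x ∈ C) (w : Vec d) : setDist ρ C w ≤ ρ (w - x) :=
  ciInf_le (f := fun x : C => ρ (w - x)) ⟨0, by rintro _ ⟨y, rfl⟩; exact hρ _⟩ ⟨x, hx⟩

theorem setDist_eq_zero {d : ℕ} {ρ : Vec d → ℝ} (hρ : ∀ x, 0 ≤ ρ x) (h0 : ρ 0 = 0)
    {C : Set (Vec d)} {x : Vec d} (hx : x ∈ C) : setDist ρ C x = 0 :=
  le_antisymm (by simpa [h0] using setDist_le hρ hx x) (setDist_nonneg hρ C x)

/-- Comparison of slopes at infinity, where the additive constant disappears. This is why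
`δ`-subgradients of `S` obey the same bounds as exact ones. -/
theorem le_of_forall_mul_le {a b c : ℝ} (h : ∀ k : ℝ, 0 < k → k * a ≤ c + k * b) : a ≤ b := by
  by_contra hab
  push Not at hab
  have hk : 0 < (|c| + 1) / (a - b) := div_pos (by positivity) (by linarith)
  have := h _ hk
  have e : (|c| + 1) / (a - b) * (a - b) = |c| + 1 := div_mul_cancel₀ _ (by linarith)
  nlinarith [le_abs_self c]

/-- An upper bound on the growth of `S` bounds its approximate subgradients. -/
theorem IsSubgradient.inner_le {d : ℕ} {ρ : Vec d → ℝ} (hρ : ∀ x, 0 ≤ ρ x)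
    (hadd : ∀ x y, ρ (x + y) ≤ ρ x + ρ y) (hsmul : ∀ (k : ℝ) x, 0 ≤ k → ρ (k • x) = k * ρ x)
    {C : Set (Vec d)} {x₀ : Vec d} (hx₀ : x₀ ∈ C) {δ : ℝ} {w ν : Vec d}
    (h : IsSubgradient Set.univ (setDist ρ C) δ w ν) (y : Vec d) : inner ℝ ν y ≤ ρ y := by
  apply le_of_forall_mul_le (c := δ + ρ (w - x₀))
  intro k hk
  have h1 := h (w + k • y) (Set.mem_univ _)
  have h2 := setDist_le hρ hx₀ (w + k • y)
  have h3 := hadd (w - x₀) (k • y)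
  rw [hsmul k y hk.le] at h3
  have h4 : w + k • y - x₀ = w - x₀ + k • y := by abel
  rw [h4] at h2
  rw [add_sub_cancel_left, inner_smul_right] at h1
  linarith [setDist_nonneg hρ C w]

theorem norm_le_of_inner_le {d : ℕ} {ν : Vec d} {L : ℝ} (hL : 0 ≤ L)
    (h : ∀ y, inner ℝ ν y ≤ L * ‖y‖) : ‖ν‖ ≤ L := by
  have := h ν
  rw [real_inner_self_eq_norm_sq] at this
  rcases (norm_nonneg ν).eq_or_lt with h0 | h0
  · rwa [← h0]
  · nlinarith

/-- The properties of a round of a reduction that the regret analysis uses. -/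
structure IsSurrogate {d : ℕ} (C : Set (Vec d)) (B δ : ℝ)
    (round : Vec d → Vec d → Vec d → Vec d → Prop) : Prop where
  mem : ∀ w u ζ g, round w u ζ g → u ∈ C
  norm_le : ∀ w u ζ g, round w u ζ g → ‖ζ‖ ≤ 1 → ‖g‖ ≤ B
  inner_le : ∀ w u ζ g, round w u ζ g → ‖ζ‖ ≤ 1 → ‖w‖ < 1 → ∀ y ∈ C,
    inner ℝ ζ (u - y) ≤ inner ℝ g (w - y) + δ
  abs_inner_le : ∀ w u ζ g, round w u ζ g → ‖ζ‖ ≤ 1 → ‖w‖ < 1 → ∀ y ∈ C,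
    |(inner ℝ g (w - y) : ℝ)| ≤ 4

theorem abs_inner_le_of_norm_le {d : ℕ} {x y : Vec d} {a b : ℝ} (hx : ‖x‖ ≤ a) (hy : ‖y‖ ≤ b) :
    |(inner ℝ x y : ℝ)| ≤ a * b :=
  (abs_real_inner_le_norm x y).trans
    (mul_le_mul hx hy (norm_nonneg _) ((norm_nonneg _).trans hx))

theorem norm_sub_le_two {d : ℕ} {x y : Vec d} (hx : ‖x‖ ≤ 1) (hy : ‖y‖ ≤ 1) : ‖x - y‖ ≤ 2 :=
  (norm_sub_le x y).trans (by linarith)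

/-- The distance is `1`-Lipschitz, so `‖ν‖ ≤ 1` and removing the component of `ζ` along `ν` does not
increase the norm. The residual `w - u` is a multiple of `ν`, hence moving from `u` to `w` changes
the linear loss exactly by `‖w - u‖ ⟨ζ, ν⟩`; the correction is made when this would make the
surrogate smaller than the loss. -/
theorem isSurrogate_projRound {d : ℕ} {C : Set (Vec d)} (hC : C ⊆ Metric.closedBall 0 1) :
    IsSurrogate C 1 0 (ProjRound C) := by
  have hCn : ∀ y ∈ C, ‖y‖ ≤ 1 := fun y hy => by simpa using hC hy
  have hν : ∀ (w u ν : Vec d), IsSubgradient Set.univ (setDist (fun x => ‖x‖) C) 0 w ν → u ∈ C →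
      ‖ν‖ ≤ 1 := fun w u ν h hu => norm_le_of_inner_le zero_le_one fun y => by
    rw [one_mul]
    exact h.inner_le (ρ := fun x => ‖x‖) norm_nonneg norm_add_le
      (fun k x hk => by rw [norm_smul, Real.norm_of_nonneg hk]) hu y
  have hg : ∀ w u ζ g, ProjRound C w u ζ g → ‖ζ‖ ≤ 1 → ‖g‖ ≤ 1 := by
    rintro w u ζ g ⟨ν, h, hu, -, rfl⟩ hζ
    have h1 := hν w u ν h hu
    split_ifs with hneg
    · have : ‖ζ - (inner ℝ ζ ν : ℝ) • ν‖ ^ 2 ≤ 1 := by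
        rw [norm_sub_sq_real, inner_smul_right, norm_smul, mul_pow, Real.norm_eq_abs, sq_abs]
        have : ‖ν‖ ^ 2 ≤ 1 := pow_le_one₀ (norm_nonneg _) h1
        have : ‖ζ‖ ^ 2 ≤ 1 := pow_le_one₀ (norm_nonneg _) hζ
        nlinarith [sq_nonneg (inner ℝ ζ ν : ℝ)]
      nlinarith [norm_nonneg (ζ - (inner ℝ ζ ν : ℝ) • ν)]
    · simpa using hζ
  refine ⟨?_, hg, ?_, ?_⟩
  · rintro w u ζ g ⟨ν, -, hu, -⟩
    exact hu
  · rintro w u ζ g ⟨ν, h, hu, hproj, rfl⟩ hζ - y hy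
    have h1 := hν w u ν h hu
    have hS : setDist (fun x => ‖x‖) C w = ‖w - u‖ := by
      apply le_antisymm (setDist_le (ρ := fun x => ‖x‖) norm_nonneg hu w)
      have : Nonempty C := ⟨⟨u, hu⟩⟩
      refine le_ciInf fun x => ?_
      have := hproj x x.2
      rwa [norm_sub_rev u w, norm_sub_rev (x : Vec d) w] at this
    have hS0 : ∀ z ∈ C, setDist (fun x => ‖x‖) C z = 0 := fun z hz =>
      setDist_eq_zero (ρ := fun x => ‖x‖) norm_nonneg norm_zero hz
    have hz : ∀ z ∈ C, ‖w - u‖ ≤ inner ℝ ν (w - z) := by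
      intro z hz
      have := h z (Set.mem_univ _)
      rw [hS0 z hz, hS, ← neg_sub w z, inner_neg_right] at this
      linarith
    -- Equality case of Cauchy–Schwarz: `hz` at `u` bounds `⟨ν, w - u⟩` below by `‖w - u‖`, while
    -- `‖ν‖ ≤ 1`.
    have hwu : w - u = ‖w - u‖ • ν := by
      have h3 := hz u hu
      have : ‖(w - u) - ‖w - u‖ • ν‖ ^ 2 ≤ 0 := by
        rw [norm_sub_sq_real, inner_smul_right, norm_smul, mul_pow, norm_norm, real_inner_comm]
        have : ‖ν‖ ^ 2 ≤ 1 := pow_le_one₀ (norm_nonneg _) h1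
        nlinarith [norm_nonneg (w - u), sq_nonneg ‖w - u‖]
      have h0 : ‖(w - u) - ‖w - u‖ • ν‖ = 0 := by
        nlinarith [norm_nonneg ((w - u) - ‖w - u‖ • ν)]
      exact sub_eq_zero.1 (norm_eq_zero.1 h0)
    have hζw : (inner ℝ ζ (w - u) : ℝ) = ‖w - u‖ * inner ℝ ζ ν := by
      conv_lhs => rw [hwu]
      rw [inner_smul_right]
    have hsplit : (inner ℝ ζ (w - y) : ℝ) = inner ℝ ζ (w - u) + inner ℝ ζ (u - y) := by
      rw [← inner_add_right, sub_add_sub_cancel]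
    have h4 := hz y hy
    rw [inner_sub_left, inner_smul_left, hsplit, hζw]
    simp only [conj_trivial]
    split_ifs with hneg
    · nlinarith
    · push Not at hneg
      nlinarith [norm_nonneg (w - u)]
  · intro w u ζ g h hζ hw y hy
    have := abs_inner_le_of_norm_le (hg w u ζ g h hζ) (norm_sub_le_two hw.le (hCn y hy))
    linarith

/-! ### The reduction with the gauge of a symmetric body -/

section Gauge

variable {d : ℕ} {C : Set (Vec d)}

theorem gauge_le_sqrt_mul_norm (hd : 1 ≤ d) (hC : IsSymmetricBody C) (x : Vec d) :
    gauge C x ≤ Real.sqrt d * ‖x‖ := by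
  have hr : 0 < 1 / Real.sqrt d := by positivity
  have h1 := gauge_mono (absorbent_nhds_zero (Metric.ball_mem_nhds (0 : Vec d) hr))
    (Metric.ball_subset_closedBall.trans hC.inner_ball) x
  rw [gauge_ball hr.le] at h1
  refine h1.trans (le_of_eq ?_)
  rw [div_div_eq_mul_div, div_one, mul_comm]

theorem absorbent_of_isSymmetricBody (hd : 1 ≤ d) (hC : IsSymmetricBody C) : Absorbent ℝ C :=
  (absorbent_nhds_zero (Metric.closedBall_mem_nhds (0 : Vec d)
    (show 0 < 1 / Real.sqrt d by positivity))).mono hC.inner_ball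

theorem zero_mem_of_isSymmetricBody (hC : IsSymmetricBody C) : (0 : Vec d) ∈ C :=
  hC.inner_ball (Metric.mem_closedBall_self (by positivity))

/-- The vector `ν` is dominated by the gauge, so by symmetry `|⟨ν, y⟩| ≤ 1` on `C`, although its
norm may be as large as `√d`. Thus `g` can be long while the products `⟨g, w - y⟩` stay bounded by
`4`; this is what keeps `β` independent of the dimension. When the point is rescaled, `γ ⟨ζ, u⟩ =
⟨ζ, w⟩`, and the inaccuracy of `γ` enters with the factor `|⟨ζ, u⟩| ≤ 1`, at a cost of `δ`. -/
theorem isSurrogate_gaugeRound (hd : 1 ≤ d) (hconv : Convex ℝ C) (hC : IsSymmetricBody C)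
    {δ : ℝ} (hδ : 0 ≤ δ) (hδ1 : δ ≤ 1) :
    IsSurrogate C (1 + Real.sqrt d) δ (GaugeRound C δ) := by
  have hCn : ∀ y ∈ C, ‖y‖ ≤ 1 := fun y hy => by simpa using hC.outer_ball hy
  have h0 : (0 : Vec d) ∈ C := zero_mem_of_isSymmetricBody hC
  have hνg : ∀ (w ν : Vec d), IsSubgradient Set.univ (setDist (gauge C) C) δ w ν →
      ∀ y, inner ℝ ν y ≤ gauge C y := fun w ν h y =>
    h.inner_le gauge_nonneg (gauge_add_le hconv (absorbent_of_isSymmetricBody hd hC))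
      (fun k x hk => by rw [gauge_smul_of_nonneg hk, smul_eq_mul]) h0 y
  have hνC : ∀ (w ν : Vec d), IsSubgradient Set.univ (setDist (gauge C) C) δ w ν →
      ∀ y ∈ C, |(inner ℝ ν y : ℝ)| ≤ 1 := by
    intro w ν h y hy
    rw [abs_le]
    constructor
    · have := (hνg w ν h (-y)).trans (gauge_le_one_of_mem (hC.neg_mem y hy))
      rw [inner_neg_right] at this
      linarith
    · exact (hνg w ν h y).trans (gauge_le_one_of_mem hy)
  have hν : ∀ (w ν : Vec d), IsSubgradient Set.univ (setDist (gauge C) C) δ w ν →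
      ‖ν‖ ≤ Real.sqrt d := fun w ν h =>
    norm_le_of_inner_le (Real.sqrt_nonneg _) fun y =>
      (hνg w ν h y).trans (gauge_le_sqrt_mul_norm hd hC y)
  have key : ∀ w u ζ g, GaugeRound C δ w u ζ g → ‖ζ‖ ≤ 1 → ‖w‖ < 1 → ∀ y ∈ C,
      inner ℝ ζ (u - y) ≤ inner ℝ g (w - y) + δ ∧ |(inner ℝ g (w - y) : ℝ)| ≤ 4 := by
    rintro w u ζ g ⟨ν, γ, h, hγ, hu, huC, rfl⟩ hζ hw y hy
    have hζy := abs_le.1 (abs_inner_le_of_norm_le hζ (hCn y hy))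
    have hζu := abs_le.1 (abs_inner_le_of_norm_le hζ (hCn u huC))
    have hζw := abs_le.1 (abs_inner_le_of_norm_le hζ hw.le)
    have hνy := abs_le.1 (hνC w ν h y hy)
    have hγ' := abs_le.1 hγ
    simp only [inner_sub_left, inner_sub_right, inner_smul_left, conj_trivial]
    split_ifs with hneg
    · split_ifs at hu with h1
      · have hζu' : (inner ℝ ζ u : ℝ) = γ⁻¹ * inner ℝ ζ w := by rw [hu, inner_smul_right]
        have hγζ : γ * (inner ℝ ζ u : ℝ) = inner ℝ ζ w := by
          rw [hζu', ← mul_assoc, mul_inv_cancel₀ (by linarith), one_mul]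
        have hneg' : (inner ℝ ζ u : ℝ) < 0 := by
          rw [hζu']; exact mul_neg_of_pos_of_neg (by positivity) hneg
        rw [← hγζ, abs_le]
        refine ⟨?_, ?_, ?_⟩ <;> nlinarith
      · have hwC : w ∈ C := hu ▸ huC
        -- Here `w` itself is played. Since `S y = 0` and `S w ≥ 0`, the approximate subgradient
        -- inequality leaves `⟨ν, w - y⟩ ≥ -δ`.
        have hsub := h y (Set.mem_univ _)
        rw [setDist_eq_zero gauge_nonneg gauge_zero hy, inner_sub_right] at hsub
        have := setDist_nonneg (gauge_nonneg (s := C)) C w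
        have hνw := abs_le.1 (hνC w ν h w hwC)
        rw [hu, abs_le]
        refine ⟨?_, ?_, ?_⟩ <;> nlinarith
    · push Not at hneg
      have hle : (inner ℝ ζ u : ℝ) ≤ inner ℝ ζ w := by
        split_ifs at hu with h1
        · rw [hu, inner_smul_right]
          exact mul_le_of_le_one_left hneg (inv_le_one_of_one_le₀ h1)
        · rw [hu]
      simp only [zero_mul, sub_zero]
      rw [abs_le]
      refine ⟨?_, ?_, ?_⟩ <;> linarith
  refine ⟨?_, ?_, fun w u ζ g h h1 h2 y hy => (key w u ζ g h h1 h2 y hy).1,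
    fun w u ζ g h h1 h2 y hy => (key w u ζ g h h1 h2 y hy).2⟩
  · rintro w u ζ g ⟨ν, γ, -, -, -, huC, -⟩
    exact huC
  · rintro w u ζ g ⟨ν, γ, h, -, -, huC, rfl⟩ hζ
    refine (norm_sub_le _ _).trans (add_le_add hζ ?_)
    rw [norm_smul]
    have h1 : ‖(if inner ℝ ζ w < 0 then inner ℝ ζ u else 0 : ℝ)‖ ≤ 1 := by
      split_ifs
      · simpa using abs_inner_le_of_norm_le hζ (hCn u huC)
      · simp
    calc _ ≤ 1 * Real.sqrt d := mul_le_mul h1 (hν w ν h) (norm_nonneg _) zero_le_one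
      _ = _ := one_mul _

end Gauge

/-- The regret of one round is bounded by the surrogate regret. -/
theorem IsSurrogate.loss_sub_le {d : ℕ} {C : Set (Vec d)} {B δ : ℝ}
    {round : Vec d → Vec d → Vec d → Vec d → Prop} (hr : IsSurrogate C B δ round)
    (hC : C ⊆ Metric.closedBall 0 1) (hδ : 0 ≤ δ) (hδ1 : δ ≤ 1) {α β : ℝ} (hα : 0 < α) (hβ : 0 < β)
    (h8 : β ≤ 1 / 8) (hβα : β ≤ α / 2) {f : Vec d → ℝ} (hf : ExpConcaveOn α C f)
    {w u ζ g y : Vec d} (h : round w u ζ g) (hw : ‖w‖ < 1) (hζ : IsLossSubgradient C f u ζ)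
    (hy : y ∈ C) :
    f u - f y ≤ inner ℝ g (w - y) - β / 2 * (inner ℝ g (w - y) : ℝ) ^ 2 + 2 * δ := by
  have hCn : ∀ y ∈ C, ‖y‖ ≤ 1 := fun y hy => by simpa using hC hy
  have hu := hr.mem _ _ _ _ h
  have h2 := abs_inner_le_of_norm_le hζ.2 (norm_sub_le_two (hCn u hu) (hCn y hy))
  rw [one_mul] at h2
  refine (hf.sub_le hα hβ h8 hβα hu hy hζ.1 h2).trans ?_
  have h3 := hr.inner_le _ _ _ _ h hζ.2 hw y hy
  have h4 := abs_le.1 (hr.abs_inner_le _ _ _ _ h hζ.2 hw y hy)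
  have h5 := abs_le.1 h2
  set a : ℝ := inner ℝ ζ (u - y)
  set x : ℝ := inner ℝ g (w - y)
  -- The function `t - β t²/2` increases up to `1/β ≥ 8`, and the arguments are at most `2` and `4 +
  -- δ ≤ 5`; so the surrogate bound on `a` survives subtraction of the quadratic term.
  have e1 : a - β / 2 * a ^ 2 ≤ (x + δ) - β / 2 * (x + δ) ^ 2 := by
    have : 0 ≤ (x + δ - a) * (1 - β / 2 * (x + δ + a)) := by
      apply mul_nonneg (by linarith)
      nlinarith
    nlinarith
  have e2 : -(β / 2 * (2 * x * δ)) ≤ δ / 2 := by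
    have : -(β * x) ≤ 1 / 2 := by nlinarith
    nlinarith
  nlinarith [mul_nonneg hβ.le (sq_nonneg δ)]

/-! ### Truncated Neumann series for an inverse Hessian -/

section Newton

variable {V : Type*} [NormedAddCommGroup V] [InnerProductSpace ℝ V]
  {P H : V →ₗ[ℝ] V} {τ γ : ℝ}

/-- The operator `γ H` contracts the norm of `H⁻¹ - γ` if `|γ|` is small. -/
theorem inner_smul_inverse_le (hPH : ∀ x, P (H x) = x)
    (hsym : ∀ x y, (inner ℝ (P x) y : ℝ) = inner ℝ x (P y))
    (hτ : ∀ x, τ * ‖x‖ ^ 2 ≤ inner ℝ (P x) x) (hγ : 3 * |γ| ≤ τ) (z : V) :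
    inner ℝ (P (γ • H z)) (γ • H z) - γ * ‖γ • H z‖ ^ 2
      ≤ 1 / 9 * (inner ℝ (P z) z - γ * ‖z‖ ^ 2) := by
  set y := H z with hy
  have hz : z = P y := (hPH z).symm
  set h := |γ| with hh
  -- Write `P = Q + 3h` with `Q` positive semidefinite and `u = Q y`. In terms of `u` and `y` the
  -- inequality becomes a combination of `⟨Q y, y⟩ ≥ 0` and `⟨Q u, u⟩ ≥ 0`, with no need to
  -- diagonalise. In an eigenbasis the factor `1/9` is the square of `|γ|/p ≤ 1/3`.
  set u := P y - (3 * h) • y with hu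
  have hPy : P y = u + (3 * h) • y := by rw [hu]; abel
  have hpos : ∀ x, 0 ≤ inner ℝ (P x) x - 3 * h * ‖x‖ ^ 2 := fun x => by
    nlinarith [hτ x, mul_le_mul_of_nonneg_right hγ (sq_nonneg ‖x‖)]
  have a1 := hpos y
  have a3 := hpos u
  have hPuy : (inner ℝ (P u) y : ℝ) = inner ℝ u u + 3 * h * inner ℝ u y := by
    rw [hsym, hPy, inner_add_right, inner_smul_right]
  have hPPy : P (P y) = P u + (3 * h) • P y := by
    conv_lhs => rw [hPy]
    rw [map_add, map_smul]
  have hn : ‖P y‖ ^ 2 = ‖u‖ ^ 2 + 6 * h * inner ℝ u y + 9 * h ^ 2 * ‖y‖ ^ 2 := by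
    rw [hPy, norm_add_sq_real, inner_smul_right, norm_smul, mul_pow, Real.norm_eq_abs, sq_abs]; ring
  have hi : (inner ℝ (P y) y : ℝ) = inner ℝ u y + 3 * h * ‖y‖ ^ 2 := by
    rw [hPy, inner_add_left, inner_smul_left, real_inner_self_eq_norm_sq]; simp
  have hii : (inner ℝ (P (P y)) (P y) : ℝ) = inner ℝ (P u) u + 3 * h * inner ℝ (P u) y
      + 3 * h * ‖P y‖ ^ 2 := by
    rw [hPPy, inner_add_left, inner_smul_left, real_inner_self_eq_norm_sq]
    conv_lhs => rw [show (inner ℝ (P u) (P y) : ℝ) = inner ℝ (P u) (u + (3 * h) • y) from by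
      rw [← hPy]]
    rw [inner_add_right, inner_smul_right]; simp
  have hγh : γ ≤ h := le_abs_self γ
  have hh0 : 0 ≤ h := abs_nonneg γ
  have hγ2 : γ ^ 2 = h ^ 2 := (sq_abs γ).symm
  rw [map_smul, inner_smul_left, inner_smul_right, norm_smul, mul_pow, Real.norm_eq_abs, sq_abs, hz,
    hii, hn, hi, hPuy, real_inner_self_eq_norm_sq]
  simp only [conj_trivial]
  rw [hi] at a1
  have a1' : 0 ≤ (inner ℝ u y : ℝ) := by linarith
  have b : 0 ≤ (3 * h - γ) * (‖u‖ ^ 2 + 6 * h * inner ℝ u y) := by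
    apply mul_nonneg (by linarith); positivity
  have c : 0 ≤ h * ‖u‖ ^ 2 := by positivity
  rw [show γ * (γ * (inner ℝ u y + 3 * h * ‖y‖ ^ 2)) = γ ^ 2 * (inner ℝ u y + 3 * h * ‖y‖ ^ 2) by
    ring,
    hγ2]
  nlinarith

theorem inner_smul_inverse_pow_le (hPH : ∀ x, P (H x) = x)
    (hsym : ∀ x y, (inner ℝ (P x) y : ℝ) = inner ℝ x (P y))
    (hτ : ∀ x, τ * ‖x‖ ^ 2 ≤ inner ℝ (P x) x) (hγ : 3 * |γ| ≤ τ) (k : ℕ) (z : V) :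
    inner ℝ (P (((γ • H) ^ k) z)) (((γ • H) ^ k) z) - γ * ‖((γ • H) ^ k) z‖ ^ 2
      ≤ (1 / 3 ^ k) ^ 2 * (inner ℝ (P z) z - γ * ‖z‖ ^ 2) := by
  induction k with
  | zero => simp
  | succ k ih =>
    have := inner_smul_inverse_le hPH hsym hτ hγ (((γ • H) ^ k) z)
    rw [pow_succ', Module.End.mul_apply, LinearMap.smul_apply]
    refine this.trans ?_
    have : (1 / 3 ^ (k + 1) : ℝ) ^ 2 = 1 / 9 * (1 / 3 ^ k) ^ 2 := by
      rw [pow_succ]; ring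
    rw [this, mul_assoc]
    linarith

/-- Telescoping: `P` applied to one term of the sum is `γ` times the preceding term, so only the
identity and the last power remain. -/
theorem neumann_residual (hPH : ∀ x, P (H x) = x) (m : ℕ) (x : V) :
    x - (P ((∑ k ∈ Finset.range m, γ ^ k • H ^ (k + 1)) x)
      - γ • (∑ k ∈ Finset.range m, γ ^ k • H ^ (k + 1)) x) = ((γ • H) ^ m) x := by
  induction m with
  | zero => simp
  | succ m ih =>
    rw [Finset.sum_range_succ, LinearMap.add_apply, map_add, smul_add]
    have h1 : P ((γ ^ m • H ^ (m + 1)) x) = ((γ • H) ^ m) x := by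
      rw [LinearMap.smul_apply, map_smul, pow_succ', Module.End.mul_apply, hPH, smul_pow,
        LinearMap.smul_apply]
    have h2 : γ • (γ ^ m • H ^ (m + 1)) x = ((γ • H) ^ (m + 1)) x := by
      rw [smul_pow, LinearMap.smul_apply, LinearMap.smul_apply, smul_smul, ← pow_succ']
    rw [h1, h2, ← ih]
    abel

/-- A step along the truncated Neumann series leaves a small residual. -/
theorem neumann_step_residual (hPH : ∀ x, P (H x) = x)
    (hsym : ∀ x y, (inner ℝ (P x) y : ℝ) = inner ℝ x (P y))
    (hτ : ∀ x, τ * ‖x‖ ^ 2 ≤ inner ℝ (P x) x) (hγ : 3 * |γ| ≤ τ) (m : ℕ) {p : V} {l : ℝ}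
    (hl : 0 ≤ l) (hp : ∀ z, |(inner ℝ p z : ℝ)| ≤ l * √(inner ℝ (P z) z - γ * ‖z‖ ^ 2)) (z : V) :
    |(inner ℝ (p + (P (-(∑ k ∈ Finset.range m, γ ^ k • H ^ (k + 1)) p)
      - γ • -(∑ k ∈ Finset.range m, γ ^ k • H ^ (k + 1)) p)) z : ℝ)|
      ≤ l * (1 / 3 ^ m) * √(inner ℝ (P z) z - γ * ‖z‖ ^ 2) := by
  -- Symmetry moves `(γ H)^m` from the gradient to the test vector, where the contraction in the
  -- Hessian norm can be used.
  have hHsym : ∀ x y, (inner ℝ (H x) y : ℝ) = inner ℝ x (H y) := fun x y => by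
    rw [← hPH y, ← hsym, hPH, hPH]
  have hsm : ∀ k x y, (inner ℝ (((γ • H) ^ k) x) y : ℝ) = inner ℝ x (((γ • H) ^ k) y) := by
    intro k
    induction k with
    | zero => simp
    | succ k ih =>
      intro x y
      rw [pow_succ', Module.End.mul_apply, LinearMap.smul_apply, inner_smul_left, hHsym, ih,
        ← inner_smul_right, conj_trivial, ← LinearMap.map_smul, ← LinearMap.smul_apply,
        ← Module.End.mul_apply, ← pow_succ, pow_succ', Module.End.mul_apply]
  have e : p + (P (-(∑ k ∈ Finset.range m, γ ^ k • H ^ (k + 1)) p)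
      - γ • -(∑ k ∈ Finset.range m, γ ^ k • H ^ (k + 1)) p) = ((γ • H) ^ m) p := by
    rw [← neumann_residual hPH m p, map_neg, smul_neg]; abel
  rw [e, hsm]
  refine (hp _).trans ?_
  rw [mul_assoc]
  refine mul_le_mul_of_nonneg_left ?_ hl
  refine (Real.sqrt_le_sqrt (inner_smul_inverse_pow_le hPH hsym hτ hγ m z)).trans ?_
  rw [Real.sqrt_mul (sq_nonneg _), Real.sqrt_sq (by positivity)]

end Newton

/-! ### The logarithmic barrier of the ball -/

section Barrier

variable {d : ℕ}

/-- The Hessian of the barrier `-log (1 - ‖x‖²)` as a quadratic form. -/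
def barForm (x z : Vec d) : ℝ :=
  2 * ‖z‖ ^ 2 / (1 - ‖x‖ ^ 2) + 4 * (inner ℝ x z : ℝ) ^ 2 / (1 - ‖x‖ ^ 2) ^ 2

theorem one_sub_norm_sq_pos {x : Vec d} (hx : ‖x‖ < 1) : 0 < 1 - ‖x‖ ^ 2 := by
  nlinarith [norm_nonneg x]

theorem barForm_nonneg {x : Vec d} (hx : ‖x‖ < 1) (z : Vec d) : 0 ≤ barForm x z := by
  have := one_sub_norm_sq_pos hx
  unfold barForm; positivity

theorem barForm_eq {x : Vec d} (hx : ‖x‖ < 1) (z : Vec d) :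
    barForm x z = 2 * ‖z‖ ^ 2 / (1 - ‖x‖ ^ 2) + (2 * inner ℝ x z / (1 - ‖x‖ ^ 2)) ^ 2 := by
  have := one_sub_norm_sq_pos hx
  unfold barForm
  field_simp
  ring

/-- The scalar core of self-concordance of the ball barrier. Here `X` and `Y` stand for `2‖Δ‖²/(1 -
‖x‖²)` and `2⟨x, Δ⟩/(1 - ‖x‖²)`, so that `X + Y²` is the squared local length of the step and `q`
the relative decrease of `1 - ‖x‖²`. -/
theorem barrier_scalar_bound {X Y s q : ℝ} (hX : 0 ≤ X) (hXY : X + Y ^ 2 ≤ s ^ 2) (hs0 : 0 ≤ s)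
    (hs : s ≤ 1 / 8) (hq : q = Y + X / 2) :
    |q| ≤ s + s ^ 2 / 2 ∧ |q| ≤ 17 / 128 ∧
      (X / 2 + q ^ 2 / (1 - q)) ^ 2 + X * (q / (1 - q)) ^ 2 ≤ (131 / 100 * s ^ 2) ^ 2 := by
  have hY : |Y| ≤ s := abs_le_of_sq_le_sq (by nlinarith) hs0
  obtain ⟨hY1, hY2⟩ := abs_le.1 hY
  have hXs : X ≤ s ^ 2 := by nlinarith
  have hq1 : |q| ≤ s + s ^ 2 / 2 := by
    rw [abs_le, hq]; constructor <;> nlinarith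
  have hq2 : |q| ≤ 17 / 128 := hq1.trans (by nlinarith)
  refine ⟨hq1, hq2, ?_⟩
  obtain ⟨hqa, hqb⟩ := abs_le.1 hq2
  have hk : 0 < 1 - q := by linarith
  -- `K = 1 / (1 - 17/128)`, with `17/128` the value of `s + s²/2` at `s = 1/8`; the product of `K`
  -- and `289/256 = (1 + 1/16)²` is below `131/100`.
  set K : ℝ := 128 / 111 with hK
  have h1 : q ^ 2 / (1 - q) ≤ K * q ^ 2 := by
    rw [div_le_iff₀ hk]
    have : 1 ≤ K * (1 - q) := by rw [hK]; linarith
    nlinarith [sq_nonneg q]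
  have h1' : 0 ≤ q ^ 2 / (1 - q) := by positivity
  have h2 : (q / (1 - q)) ^ 2 ≤ K ^ 2 * q ^ 2 := by
    rw [div_pow, div_le_iff₀ (by positivity)]
    have : 1 ≤ K ^ 2 * (1 - q) ^ 2 := by
      rw [← mul_pow]; apply one_le_pow₀; rw [hK]; linarith
    nlinarith [sq_nonneg q]
  have h3 : X + q ^ 2 ≤ s ^ 2 * (1 + s / 2) ^ 2 := by
    have : q ^ 2 ≤ Y ^ 2 + X * (s + s ^ 2 / 4) := by
      rw [hq]; nlinarith [mul_le_mul_of_nonneg_left hY2 hX, mul_le_mul_of_nonneg_left hXs hX]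
    nlinarith [mul_nonneg hs0 (sq_nonneg Y), mul_nonneg (sq_nonneg s) (sq_nonneg Y)]
  have h4 : X + q ^ 2 ≤ 289 / 256 * s ^ 2 := by
    have : (1 + s / 2) ^ 2 ≤ 289 / 256 := by nlinarith
    nlinarith [sq_nonneg s]
  have h5 : (X / 2 + q ^ 2 / (1 - q)) ^ 2 ≤ K ^ 2 * (X / 2 + q ^ 2) ^ 2 := by
    rw [← mul_pow]
    apply pow_le_pow_left₀ (by positivity)
    rw [hK] at h1 ⊢; linarith
  have h6 : X * (q / (1 - q)) ^ 2 ≤ K ^ 2 * (X * q ^ 2) := by nlinarith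
  have h7 : (X / 2 + q ^ 2) ^ 2 + X * q ^ 2 ≤ (X + q ^ 2) ^ 2 := by
    nlinarith [sq_nonneg X, mul_nonneg hX (sq_nonneg q)]
  have h8 : (X + q ^ 2) ^ 2 ≤ (289 / 256 * s ^ 2) ^ 2 := pow_le_pow_left₀ (by positivity) h4 2
  calc _ ≤ K ^ 2 * (289 / 256 * s ^ 2) ^ 2 := by
        have : 0 < K ^ 2 := by positivity
        nlinarith
    _ = (K * (289 / 256)) ^ 2 * (s ^ 2) ^ 2 := by ring
    _ ≤ (131 / 100) ^ 2 * (s ^ 2) ^ 2 := by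
        apply mul_le_mul_of_nonneg_right _ (by positivity)
        rw [hK]; norm_num
    _ = _ := by ring

/-- The relative decrease of `1 - ‖x‖²` along the step `Δ`. -/
def relDecr (x Δ : Vec d) : ℝ := (2 * inner ℝ x Δ + ‖Δ‖ ^ 2) / (1 - ‖x‖ ^ 2)

theorem one_sub_norm_add_sq {x : Vec d} (hx : ‖x‖ < 1) (Δ : Vec d) :
    1 - ‖x + Δ‖ ^ 2 = (1 - ‖x‖ ^ 2) * (1 - relDecr x Δ) := by
  have := one_sub_norm_sq_pos hx
  unfold relDecr
  rw [norm_add_sq_real]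
  field_simp
  ring

variable {x Δ : Vec d} {s : ℝ}

theorem relDecr_bound (hx : ‖x‖ < 1) (hs0 : 0 ≤ s) (hs : s ≤ 1 / 8) (h : barForm x Δ ≤ s ^ 2) :
    |relDecr x Δ| ≤ s + s ^ 2 / 2 ∧ |relDecr x Δ| ≤ 17 / 128 ∧
      (‖Δ‖ ^ 2 / (1 - ‖x‖ ^ 2) + relDecr x Δ ^ 2 / (1 - relDecr x Δ)) ^ 2
        + 2 * ‖Δ‖ ^ 2 / (1 - ‖x‖ ^ 2) * (relDecr x Δ / (1 - relDecr x Δ)) ^ 2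
      ≤ (131 / 100 * s ^ 2) ^ 2 := by
  have hr := one_sub_norm_sq_pos hx
  rw [barForm_eq hx] at h
  have := barrier_scalar_bound (q := relDecr x Δ) (X := 2 * ‖Δ‖ ^ 2 / (1 - ‖x‖ ^ 2)) (by positivity)
    h hs0 hs
    (by unfold relDecr; field_simp)
  rwa [show 2 * ‖Δ‖ ^ 2 / (1 - ‖x‖ ^ 2) / 2 = ‖Δ‖ ^ 2 / (1 - ‖x‖ ^ 2) by ring] at this

/-- A Dikin ellipsoid lies in the domain: the relative decrease of `1 - ‖x‖²` is at most `17/128`,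
hence less than `1`. -/
theorem norm_add_lt_one (hx : ‖x‖ < 1) (hs0 : 0 ≤ s) (hs : s ≤ 1 / 8) (h : barForm x Δ ≤ s ^ 2) :
    ‖x + Δ‖ < 1 := by
  have h1 := one_sub_norm_add_sq hx Δ
  have h2 := (abs_le.1 (relDecr_bound hx hs0 hs h).2.1).2
  have : 0 < (1 - ‖x‖ ^ 2) * (1 - relDecr x Δ) :=
    mul_pos (one_sub_norm_sq_pos hx) (by linarith)
  nlinarith [norm_nonneg (x + Δ)]

theorem sq_inner_div_le (hx : ‖x‖ < 1) (Δ z : Vec d) :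
    (2 * inner ℝ Δ z / (1 - ‖x‖ ^ 2)) ^ 2 ≤
      (2 * ‖Δ‖ ^ 2 / (1 - ‖x‖ ^ 2)) * (2 * ‖z‖ ^ 2 / (1 - ‖x‖ ^ 2)) := by
  have hr := one_sub_norm_sq_pos hx
  rw [div_pow, div_mul_div_comm, ← sq]
  apply div_le_div_of_nonneg_right _ (by positivity)
  have := abs_le.1 (abs_real_inner_le_norm Δ z)
  nlinarith [mul_nonneg (norm_nonneg Δ) (norm_nonneg z)]

/-- The third-order remainder of the barrier, in the local dual norm. -/
theorem abs_inner_barrier_remainder_le (hx : ‖x‖ < 1) (hs0 : 0 ≤ s) (hs : s ≤ 1 / 8)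
    (h : barForm x Δ ≤ s ^ 2) (z : Vec d) :
    |(inner ℝ ((2 / (1 - ‖x + Δ‖ ^ 2)) • (x + Δ) - (2 / (1 - ‖x‖ ^ 2)) • x
        - (2 / (1 - ‖x‖ ^ 2)) • Δ - (4 * inner ℝ x Δ / (1 - ‖x‖ ^ 2) ^ 2) • x) z : ℝ)|
      ≤ 131 / 100 * s ^ 2 * √(barForm x z) := by
  obtain ⟨-, hq, hb⟩ := relDecr_bound hx hs0 hs h
  have hr := one_sub_norm_sq_pos hx
  have hqp : 0 < 1 - relDecr x Δ := by linarith [(abs_le.1 hq).2]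
  have hw := sq_inner_div_le hx Δ z
  have hqdef : 2 * inner ℝ x Δ / (1 - ‖x‖ ^ 2) = relDecr x Δ - ‖Δ‖ ^ 2 / (1 - ‖x‖ ^ 2) := by
    unfold relDecr; field_simp; ring
  rw [one_sub_norm_add_sq hx]
  set q := relDecr x Δ
  set r := 1 - ‖x‖ ^ 2
  set D := ‖Δ‖ ^ 2 / r with hD
  have hD2 : 2 * ‖Δ‖ ^ 2 / r = 2 * D := by rw [hD]; ring
  rw [hD2] at hb hw
  have e : (inner ℝ ((2 / (r * (1 - q))) • (x + Δ) - (2 / r) • x - (2 / r) • Δ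
      - (4 * inner ℝ x Δ / r ^ 2) • x) z : ℝ)
      = 2 * inner ℝ x z / r * (D + q ^ 2 / (1 - q)) + 2 * inner ℝ Δ z / r * (q / (1 - q)) := by
    simp only [inner_sub_left, inner_smul_left, inner_add_left, conj_trivial]
    have : 4 * inner ℝ x Δ / r ^ 2 = 2 / r * (q - D) := by rw [← hqdef]; field_simp; ring
    rw [this]
    field_simp
    ring
  rw [e, barForm_eq hx]
  rw [← Real.sqrt_sq (show 0 ≤ 131 / 100 * s ^ 2 by positivity), ← Real.sqrt_mul (sq_nonneg _)]
  apply Real.abs_le_sqrt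
  set A := D + q ^ 2 / (1 - q)
  set A' := q / (1 - q)
  set Z := 2 * ‖z‖ ^ 2 / r with hZ
  have hZ0 : 0 ≤ Z := by positivity
  have hD0 : 0 ≤ D := by positivity
  set y := 2 * inner ℝ x z / r
  set W := 2 * inner ℝ Δ z / r
  -- Since `W² ≤ 2 D Z`, this is Cauchy–Schwarz for `(A, √(2D) A')` and `(y, √Z)`. The case `D = 0`
  -- is separate because the cross term is bounded after multiplication by `2D`.
  have hle : (y * A + W * A') ^ 2 ≤ (A ^ 2 + 2 * D * A' ^ 2) * (Z + y ^ 2) := by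
    have h1 : 2 * (y * A') * (W * A) ≤ (2 * D) * (y * A') ^ 2 + Z * A ^ 2 := by
      rcases hD0.eq_or_lt with h0 | h0
      · rw [← h0] at hw
        have hW : W = 0 := by nlinarith
        rw [hW, ← h0]; nlinarith [mul_nonneg hZ0 (sq_nonneg A)]
      · have : 0 ≤ (2 * D * (y * A') - W * A) ^ 2 := sq_nonneg _
        have h3 : W ^ 2 * A ^ 2 ≤ 2 * D * Z * A ^ 2 := mul_le_mul_of_nonneg_right hw (sq_nonneg A)
        have : 0 ≤ 2 * D * ((2 * D) * (y * A') ^ 2 + Z * A ^ 2 - 2 * (y * A') * (W * A)) := by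
          nlinarith
        have := nonneg_of_mul_nonneg_right this (by positivity)
        linarith
    nlinarith [mul_le_mul_of_nonneg_right hw (sq_nonneg A')]
  refine hle.trans ?_
  exact mul_le_mul_of_nonneg_right hb (by positivity)

/-- The local norms at nearby points are comparable. -/
theorem barForm_le_of_step (hx : ‖x‖ < 1) (hs0 : 0 ≤ s) (hs : s ≤ 1 / 8)
    (h : barForm x Δ ≤ s ^ 2) (z : Vec d) : barForm x z ≤ 22 / 15 * barForm (x + Δ) z := by
  have hx' := norm_add_lt_one hx hs0 hs h
  obtain ⟨-, hq, -⟩ := relDecr_bound hx hs0 hs h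
  have hr := one_sub_norm_sq_pos hx
  obtain ⟨hq1, hq2⟩ := abs_le.1 hq
  have hqp : 0 < 1 - relDecr x Δ := by linarith
  have hw := sq_inner_div_le hx Δ z
  rw [barForm_eq hx] at h
  have hD2 : 2 * ‖Δ‖ ^ 2 / (1 - ‖x‖ ^ 2) ≤ 1 / 64 := by
    nlinarith [sq_nonneg (2 * inner ℝ x Δ / (1 - ‖x‖ ^ 2) : ℝ)]
  rw [barForm_eq hx, barForm_eq hx', one_sub_norm_add_sq hx, inner_add_left]
  set q := relDecr x Δ
  set r := 1 - ‖x‖ ^ 2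
  set Z := 2 * ‖z‖ ^ 2 / r with hZ
  have hZ0 : 0 ≤ Z := by positivity
  have e1 : 2 * ‖z‖ ^ 2 / (r * (1 - q)) = Z / (1 - q) := by rw [hZ]; field_simp
  set y := 2 * inner ℝ x z / r with hy
  set W := 2 * inner ℝ Δ z / r with hW
  have e2 : 2 * (inner ℝ x z + inner ℝ Δ z) / (r * (1 - q)) = (y + W) / (1 - q) := by
    rw [hy, hW]; field_simp
  rw [e1, e2, div_pow (y + W)]
  have hW2 : W ^ 2 ≤ 1 / 64 * Z := hw.trans (mul_le_mul_of_nonneg_right hD2 hZ0)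
  have h1 : 7 / 8 * (Z + y ^ 2) ≤ Z + (y + W) ^ 2 := by nlinarith [sq_nonneg (y + 8 * W)]
  have h2 : (1 - q) ^ 2 ≤ (145 / 128) ^ 2 := pow_le_pow_left₀ hqp.le (by linarith) 2
  have h3 : (Z + (y + W) ^ 2) / (145 / 128) ^ 2 ≤ Z / (1 - q) + (y + W) ^ 2 / (1 - q) ^ 2 := by
    rw [add_div]
    apply add_le_add
    · apply div_le_div_of_nonneg_left hZ0 hqp; nlinarith
    · apply div_le_div_of_nonneg_left (sq_nonneg _) (by positivity) h2
  have h4 : Z + y ^ 2 ≤ 22 / 15 * ((Z + (y + W) ^ 2) / (145 / 128) ^ 2) := by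
    have : 22 / 15 * ((Z + (y + W) ^ 2) / (145 / 128) ^ 2)
      = (22 / 15 * (128 / 145) ^ 2) * (Z + (y + W) ^ 2) := by ring
    rw [this]
    have : (8 / 7 : ℝ) ≤ 22 / 15 * (128 / 145) ^ 2 := by norm_num
    nlinarith [sq_nonneg (y + W)]
  linarith

/-- Used to count landmark changes: the logarithm of the distance-like quantity `1 - ‖x‖²` changes
slowly when measured by the local length of the step. -/
theorem abs_log_sub_log_le (hx : ‖x‖ < 1) (hs0 : 0 ≤ s) (hs : s ≤ 1 / 8)
    (h : barForm x Δ ≤ s ^ 2) :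
    |Real.log (1 - ‖x + Δ‖ ^ 2) - Real.log (1 - ‖x‖ ^ 2)| ≤ 2 * s := by
  obtain ⟨hq1, hq2, -⟩ := relDecr_bound hx hs0 hs h
  have hr := one_sub_norm_sq_pos hx
  obtain ⟨hqa, hqb⟩ := abs_le.1 hq2
  obtain ⟨hqc, hqd⟩ := abs_le.1 hq1
  have hqp : 0 < 1 - relDecr x Δ := by linarith
  rw [one_sub_norm_add_sq hx, Real.log_mul hr.ne' hqp.ne', add_sub_cancel_left, abs_le]
  constructor
  · have := Real.one_sub_inv_le_log_of_pos hqp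
    refine le_trans ?_ this
    have h1 : (1 - relDecr x Δ)⁻¹ ≤ 1 + 128 / 111 * (s + s ^ 2 / 2) := by
      rw [inv_le_iff_one_le_mul₀ hqp]
      nlinarith
    nlinarith
  · have := Real.log_le_sub_one_of_pos hqp
    nlinarith

/-- The barrier grows at least linearly in the local norm. -/
theorem barrier_sub_ge {y : Vec d} (hx : ‖x‖ < 1) (hy : ‖y‖ < 1) :
    1 / 2 * √(barForm x (y - x)) - 2 ≤
      -Real.log (1 - ‖y‖ ^ 2) + Real.log (1 - ‖x‖ ^ 2)
        - 2 * inner ℝ x (y - x) / (1 - ‖x‖ ^ 2) := by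
  have hr := one_sub_norm_sq_pos hx
  have hr' := one_sub_norm_sq_pos hy
  set z := y - x with hz
  have hyz : y = x + z := by rw [hz]; abel
  have e := one_sub_norm_add_sq hx z
  rw [← hyz] at e
  have hqp : 0 < 1 - relDecr x z := by
    by_contra hcon
    push Not at hcon
    nlinarith
  rw [e, Real.log_mul hr.ne' hqp.ne', barForm_eq hx]
  have hqdef : relDecr x z = 2 * inner ℝ x z / (1 - ‖x‖ ^ 2) + (2 * ‖z‖ ^ 2 / (1 - ‖x‖ ^ 2)) / 2 :=
    by
    unfold relDecr; field_simp
  set q := relDecr x z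
  set r := 1 - ‖x‖ ^ 2
  set X := 2 * ‖z‖ ^ 2 / r with hX
  have hX0 : 0 ≤ X := by positivity
  set Y := 2 * inner ℝ x z / r
  have hsq : √(X + Y ^ 2) ≤ √X + |Y| := by
    rw [Real.sqrt_le_left (by positivity)]
    nlinarith [Real.sq_sqrt hX0, sq_abs Y, mul_nonneg (Real.sqrt_nonneg X) (abs_nonneg Y)]
  -- Tangent line of the logarithm at `1/κ`. The choices `κ = 3/2` for `Y ≥ 0` and `κ = 1/2` for `Y
  -- ≤ 0` leave `(κ - 1) Y = |Y|/2` after the first-order term is removed, which is the linear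
  -- growth.
  have hlog : ∀ κ : ℝ, 0 < κ → Real.log (1 - q) ≤ κ * (1 - q) - 1 - Real.log κ := fun κ hκ => by
    have := Real.log_le_sub_one_of_pos (mul_pos hκ hqp)
    rw [Real.log_mul hκ.ne' hqp.ne'] at this
    linarith
  have hXs := Real.sq_sqrt hX0
  rcases le_total 0 Y with hY | hY
  · have h1 := hlog (3 / 2) (by norm_num)
    have h2 : 0 ≤ Real.log (3 / 2) := Real.log_nonneg (by norm_num)
    rw [abs_of_nonneg hY] at hsq
    nlinarith [sq_nonneg (√X - 1 / 3)]
  · have h1 := hlog (1 / 2) (by norm_num)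
    have h2 : -(7 / 10) ≤ Real.log (1 / 2) := by
      rw [one_div, Real.log_inv]; linarith [Real.log_two_lt_d9]
    rw [abs_of_nonpos hY] at hsq
    nlinarith [sq_nonneg (√X - 1)]

end Barrier

/-! ### The potential and its derivatives -/

section Potential

variable {d : ℕ} {B η β : ℝ} {g w : ℕ → Vec d}

/-- The constant part of the Hessian of the potential, as a quadratic form. -/
def quadForm (B η β : ℝ) (g : ℕ → Vec d) (t : ℕ) (z : Vec d) : ℝ :=
  (d + B ^ 2 * η) * ‖z‖ ^ 2 + β * ∑ s ∈ Finset.range t, (inner ℝ (g s) z : ℝ) ^ 2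

/-- The Hessian of the potential at `x`, as a quadratic form. -/
def hessForm (B η β : ℝ) (g : ℕ → Vec d) (t : ℕ) (x z : Vec d) : ℝ :=
  η * d * barForm x z + quadForm B η β g t z

/-- The gradient of the potential. -/
def potGrad (B η β : ℝ) (g w : ℕ → Vec d) (t : ℕ) (x : Vec d) : Vec d :=
  (2 * η * d / (1 - ‖x‖ ^ 2)) • x + (d + B ^ 2 * η) • x
    + β • ∑ s ∈ Finset.range t, (inner ℝ (g s) (x - w s) : ℝ) • g s + ∑ s ∈ Finset.range t, g s

theorem hasGradientAt_potential {x : Vec d} (hx : ‖x‖ < 1) (t : ℕ) :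
    HasGradientAt (potential B η β g w t) (potGrad B η β g w t x) x := by
  have hr := one_sub_norm_sq_pos hx
  have h1 : HasFDerivAt (fun y : Vec d => ‖y‖ ^ 2) (2 • innerSL ℝ x) x :=
    (hasStrictFDerivAt_norm_sq x).hasFDerivAt
  have h2 := (((h1.const_sub 1).log hr.ne').const_mul (-(η * d)))
  have h3 := h1.const_mul ((d + B ^ 2 * η) / 2)
  have h4 : ∀ s ∈ Finset.range t, HasFDerivAt (fun y : Vec d => (inner ℝ (g s) (y - w s) : ℝ) ^ 2)
      ((2 * (inner ℝ (g s) (x - w s) : ℝ)) • innerSL ℝ (g s)) x := by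
    intro s _
    have : HasFDerivAt (fun y : Vec d => (inner ℝ (g s) (y - w s) : ℝ)) (innerSL ℝ (g s)) x := by
      have := ((innerSL ℝ (g s)).hasFDerivAt (x := x)).sub_const (inner ℝ (g s) (w s))
      refine this.congr_of_eventuallyEq (Filter.Eventually.of_forall fun y => ?_)
      simp only [inner_sub_right, innerSL_apply_apply]
    simpa using this.pow 2
  have h5 := (HasFDerivAt.fun_sum h4).const_mul (β / 2)
  have h6 : HasFDerivAt (fun y : Vec d => (inner ℝ y (∑ s ∈ Finset.range t, g s) : ℝ))
      (innerSL ℝ (∑ s ∈ Finset.range t, g s)) x := by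
    refine HasFDerivAt.congr_of_eventuallyEq ?_
      (Filter.Eventually.of_forall fun y => real_inner_comm _ _)
    exact (innerSL ℝ (∑ s ∈ Finset.range t, g s)).hasFDerivAt
  have h7 := ((h2.add h3).add h5).add h6
  rw [hasGradientAt_iff_hasFDerivAt]
  refine h7.congr_fderiv ?_
  refine ContinuousLinearMap.ext fun z => ?_
  simp only [potGrad, InnerProductSpace.toDual_apply_apply, inner_add_left, inner_smul_left,
    sum_inner, add_apply, smul_apply,
    neg_apply, sum_apply, innerSL_apply_apply, smul_eq_mul,
    nsmul_eq_mul, conj_trivial, Nat.cast_ofNat]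
  have e : ∑ s ∈ Finset.range t, 2 * (inner ℝ (g s) (x - w s) : ℝ) * inner ℝ (g s) z
      = 2 * ∑ s ∈ Finset.range t, (inner ℝ (g s) (x - w s) : ℝ) * inner ℝ (g s) z := by
    rw [Finset.mul_sum]; exact Finset.sum_congr rfl fun _ _ => by ring
  rw [e]
  ring

theorem potential_succ (t : ℕ) (x : Vec d) :
    potential B η β g w (t + 1) x = potential B η β g w t x
      + β / 2 * (inner ℝ (g t) (x - w t) : ℝ) ^ 2 + inner ℝ (g t) x := by
  unfold potential
  rw [Finset.sum_range_succ, Finset.sum_range_succ, inner_add_right, real_inner_comm (g t) x]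
  ring

/-- The new quadratic term is centred at `w t`, so at that point it contributes nothing to the
gradient and only the linear term remains. -/
theorem potGrad_succ (t : ℕ) :
    potGrad B η β g w (t + 1) (w t) = potGrad B η β g w t (w t) + g t := by
  unfold potGrad
  rw [Finset.sum_range_succ, Finset.sum_range_succ, sub_self, inner_zero_right, zero_smul, add_zero]
  abel

theorem hessForm_succ (t : ℕ) (x z : Vec d) :
    hessForm B η β g (t + 1) x z = hessForm B η β g t x z + β * (inner ℝ (g t) z : ℝ) ^ 2 := by
  unfold hessForm quadForm
  rw [Finset.sum_range_succ]
  ring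

theorem quadForm_nonneg (hη : 0 ≤ η) (hβ : 0 ≤ β) (t : ℕ) (z : Vec d) :
    0 ≤ quadForm B η β g t z := by
  unfold quadForm
  have := Finset.sum_nonneg (s := Finset.range t) (f := fun s => (inner ℝ (g s) z : ℝ) ^ 2)
    fun _ _ => sq_nonneg _
  positivity

theorem hessForm_nonneg (hη : 0 ≤ η) (hβ : 0 ≤ β) {x : Vec d} (hx : ‖x‖ < 1) (t : ℕ) (z : Vec d) :
    0 ≤ hessForm B η β g t x z :=
  add_nonneg (mul_nonneg (by positivity) (barForm_nonneg hx z)) (quadForm_nonneg hη hβ t z)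

/-- Second-order expansion of the potential, with the Bregman divergence of the barrier. -/
theorem potential_eq (t : ℕ) (x y : Vec d) :
    potential B η β g w t y = potential B η β g w t x + inner ℝ (potGrad B η β g w t x) (y - x)
      + η * d * (-Real.log (1 - ‖y‖ ^ 2) + Real.log (1 - ‖x‖ ^ 2)
        - 2 * inner ℝ x (y - x) / (1 - ‖x‖ ^ 2)) + 1 / 2 * quadForm B η β g t (y - x) := by
  set z := y - x with hz
  have hy : y = x + z := by rw [hz]; abel
  have hs : ∑ s ∈ Finset.range t, (inner ℝ (g s) (y - w s) : ℝ) ^ 2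
      = ∑ s ∈ Finset.range t, (inner ℝ (g s) (x - w s) : ℝ) ^ 2
        + 2 * ∑ s ∈ Finset.range t, (inner ℝ (g s) (x - w s) : ℝ) * inner ℝ (g s) z
        + ∑ s ∈ Finset.range t, (inner ℝ (g s) z : ℝ) ^ 2 := by
    rw [Finset.mul_sum, ← Finset.sum_add_distrib, ← Finset.sum_add_distrib]
    refine Finset.sum_congr rfl fun s _ => ?_
    rw [show y - w s = (x - w s) + z by rw [hy]; abel, inner_add_right]
    ring
  have hn : ‖y‖ ^ 2 = ‖x‖ ^ 2 + 2 * inner ℝ x z + ‖z‖ ^ 2 := by rw [hy, norm_add_sq_real]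
  have hi : (inner ℝ y (∑ s ∈ Finset.range t, g s) : ℝ) = inner ℝ x (∑ s ∈ Finset.range t, g s)
      + inner ℝ (∑ s ∈ Finset.range t, g s) z := by
    rw [hy, inner_add_left, real_inner_comm _ z]
  unfold potential potGrad quadForm
  rw [hs, hi]
  simp only [inner_add_left, inner_smul_left, sum_inner, conj_trivial]
  generalize Real.log (1 - ‖y‖ ^ 2) = L
  generalize Real.log (1 - ‖x‖ ^ 2) = L'
  rw [hn]
  ring

/-- Convexity of the barrier, obtained from `log u ≤ u - 1` for the ratio `u` of the two values of
`1 - ‖·‖²`. -/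
theorem barrier_sub_nonneg {x y : Vec d} (hx : ‖x‖ < 1) (hy : ‖y‖ < 1) :
    0 ≤ -Real.log (1 - ‖y‖ ^ 2) + Real.log (1 - ‖x‖ ^ 2)
        - 2 * inner ℝ x (y - x) / (1 - ‖x‖ ^ 2) := by
  have hr := one_sub_norm_sq_pos hx
  have hr' := one_sub_norm_sq_pos hy
  have h1 : ‖y‖ ^ 2 = ‖x‖ ^ 2 + 2 * inner ℝ x (y - x) + ‖y - x‖ ^ 2 := by
    rw [← norm_add_sq_real]; congr 2; abel
  have h2 := Real.log_le_sub_one_of_pos (div_pos hr' hr)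
  rw [Real.log_div hr'.ne' hr.ne'] at h2
  have h3 : (1 - ‖y‖ ^ 2) / (1 - ‖x‖ ^ 2) - 1
      = -(2 * inner ℝ x (y - x) / (1 - ‖x‖ ^ 2)) - ‖y - x‖ ^ 2 / (1 - ‖x‖ ^ 2) := by
    rw [h1]; field_simp; ring
  have h4 : 0 ≤ ‖y - x‖ ^ 2 / (1 - ‖x‖ ^ 2) := by positivity
  linarith

end Potential

/-! ### Regularized Gram matrices -/

section Gram

variable {d : ℕ}

/-- The matrix `a I + β ∑_{s<t} g_s g_sᵀ`. -/
def regMat (a β : ℝ) (g : ℕ → Vec d) (t : ℕ) : Matrix (Fin d) (Fin d) ℝ :=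
  a • (1 : Matrix (Fin d) (Fin d) ℝ) + β • ∑ s ∈ Finset.range t, outer (g s)

theorem toEuclideanLin_outer (x z : Vec d) :
    Matrix.toEuclideanLin (outer x) z = (inner ℝ x z : ℝ) • x := by
  ext i
  simp [outer, Matrix.vecMulVec_mulVec, PiLp.inner_apply, dotProduct, mul_comm]

theorem toEuclideanLin_regMat (a β : ℝ) (g : ℕ → Vec d) (t : ℕ) (z : Vec d) :
    Matrix.toEuclideanLin (regMat a β g t) z
      = a • z + β • ∑ s ∈ Finset.range t, (inner ℝ (g s) z : ℝ) • g s := by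
  simp only [regMat, map_add, map_smul, map_sum, LinearMap.add_apply, LinearMap.smul_apply,
    LinearMap.sum_apply, toEuclideanLin_outer, Matrix.toLpLin_one, LinearMap.id_apply]

theorem posSemidef_outer (x : Vec d) : (outer x).PosSemidef := by
  have := Matrix.posSemidef_vecMulVec_self_star x.ofLp
  rwa [star_trivial] at this

theorem posDef_regMat {a β : ℝ} (ha : 0 < a) (hβ : 0 ≤ β) (g : ℕ → Vec d) (t : ℕ) :
    (regMat a β g t).PosDef :=
  (Matrix.PosDef.one.smul ha).add_posSemidef
    ((Matrix.posSemidef_sum _ fun s _ => posSemidef_outer (g s)).smul hβ)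

theorem det_add_vecMulVec {n : Type*} [Fintype n] [DecidableEq n] {A : Matrix n n ℝ}
    (hA : IsUnit A.det) (u v : n → ℝ) :
    (A + Matrix.vecMulVec u v).det = A.det * (1 + v ⬝ᵥ (A⁻¹ *ᵥ u)) := by
  have h := Matrix.replicateRow_mul_replicateCol_apply (ι := Unit) v (A⁻¹ *ᵥ u) () ()
  rw [Matrix.vecMulVec_eq Unit, Matrix.det_add_replicateCol_mul_replicateRow hA,
    Matrix.det_unique (n := Unit), Matrix.add_apply, Matrix.one_apply_eq, Matrix.mul_assoc, ←
      Matrix.replicateCol_mulVec (ι := Unit),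
    Matrix.replicateRow_mul_replicateCol_apply]

/-- Testing the form on an orthonormal eigenbasis bounds each eigenvalue by `b`, and the determinant
is their product. -/
theorem det_le_pow_of_form_le {A : Matrix (Fin d) (Fin d) ℝ} (hA : A.PosDef) {b : ℝ}
    (h : ∀ z : Vec d, (inner ℝ (Matrix.toEuclideanLin A z) z : ℝ) ≤ b * ‖z‖ ^ 2) :
    A.det ≤ b ^ d := by
  rw [hA.isHermitian.det_eq_prod_eigenvalues]
  calc _ ≤ ∏ _i : Fin d, b := by
        refine Finset.prod_le_prod (fun i _ => (hA.eigenvalues_pos i).le) fun i _ => ?_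
        have h1 := h (hA.isHermitian.eigenvectorBasis i)
        have h2 := hA.isHermitian.mulVec_eigenvectorBasis i
        rw [Matrix.toLpLin_apply, h2] at h1
        rw [WithLp.toLp_smul, WithLp.toLp_ofLp, inner_smul_left, real_inner_self_eq_norm_sq,
          OrthonormalBasis.norm_eq_one] at h1
        simpa using h1
    _ = _ := by simp

end Gram

/-! ### Dual norms and the elliptical potential -/

section Elliptic

variable {d : ℕ} {a β : ℝ} {g : ℕ → Vec d}

theorem inner_regMat (z : Vec d) (t : ℕ) :
    (inner ℝ (Matrix.toEuclideanLin (regMat a β g t) z) z : ℝ)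
      = a * ‖z‖ ^ 2 + β * ∑ s ∈ Finset.range t, (inner ℝ (g s) z : ℝ) ^ 2 := by
  rw [toEuclideanLin_regMat, inner_add_left, inner_smul_left, inner_smul_left, sum_inner,
    real_inner_self_eq_norm_sq]
  simp only [inner_smul_left, conj_trivial]
  congr 2
  exact Finset.sum_congr rfl fun _ _ => by ring

theorem inner_toEuclideanLin_symm {A : Matrix (Fin d) (Fin d) ℝ} (hA : A.PosDef) (x y : Vec d) :
    (inner ℝ (Matrix.toEuclideanLin A x) y : ℝ) = inner ℝ x (Matrix.toEuclideanLin A y) :=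
  (Matrix.isSymmetric_toEuclideanLin_iff.2 hA.isHermitian) x y

theorem toEuclideanLin_inv_apply {A : Matrix (Fin d) (Fin d) ℝ} (hA : A.PosDef) (x : Vec d) :
    Matrix.toEuclideanLin A (Matrix.toEuclideanLin A⁻¹ x) = x := by
  rw [← LinearMap.comp_apply, ← Matrix.toLpLin_mul_same, Matrix.mul_nonsing_inv _
    hA.det_pos.ne'.isUnit,
    Matrix.toLpLin_one, LinearMap.id_apply]

/-- The squared norm of `g_t` in the dual of the norm given by the regularized Gram matrix. -/
def dualSq (a β : ℝ) (g : ℕ → Vec d) (t : ℕ) : ℝ :=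
  inner ℝ (g t) (Matrix.toEuclideanLin (regMat a β g (t + 1))⁻¹ (g t))

theorem sq_le_of_quadratic_nonneg {p q r : ℝ} (h : ∀ s : ℝ, 0 ≤ p + 2 * s * q + s ^ 2 * r) :
    q ^ 2 ≤ p * r := by
  have := discrim_le_zero (a := r) (b := 2 * q) (c := p) fun s => by nlinarith [h s]
  unfold discrim at this
  nlinarith

theorem dualSq_nonneg (ha : 0 < a) (hβ : 0 ≤ β) (t : ℕ) : 0 ≤ dualSq a β g t := by
  have hA := posDef_regMat ha hβ g (t + 1)
  unfold dualSq
  set y := Matrix.toEuclideanLin (regMat a β g (t + 1))⁻¹ (g t) with hy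
  have h1 : Matrix.toEuclideanLin (regMat a β g (t + 1)) y = g t := toEuclideanLin_inv_apply hA _
  rw [← h1, inner_regMat]
  have := Finset.sum_nonneg (s := Finset.range (t + 1)) (f := fun s => (inner ℝ (g s) y : ℝ) ^ 2)
    fun _ _ => sq_nonneg _
  positivity

/-- Cauchy–Schwarz in the norm of the regularized Gram matrix `A`: the form is nonnegative at `y + s
z` for every `s`, where `A y = g t`, and its discriminant gives the bound. -/
theorem abs_inner_le_dualSq (ha : 0 < a) (hβ : 0 ≤ β) (t : ℕ) (z : Vec d) :
    |(inner ℝ (g t) z : ℝ)| ≤ √(dualSq a β g t) *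
      √(a * ‖z‖ ^ 2 + β * ∑ s ∈ Finset.range (t + 1), (inner ℝ (g s) z : ℝ) ^ 2) := by
  have hA := posDef_regMat ha hβ g (t + 1)
  have h0 := dualSq_nonneg (g := g) ha hβ t
  rw [← Real.sqrt_mul h0]
  apply Real.abs_le_sqrt
  unfold dualSq
  set y := Matrix.toEuclideanLin (regMat a β g (t + 1))⁻¹ (g t) with hy
  have h1 : Matrix.toEuclideanLin (regMat a β g (t + 1)) y = g t := toEuclideanLin_inv_apply hA _
  rw [← inner_regMat]
  apply sq_le_of_quadratic_nonneg
  intro s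
  have hn : ∀ x, 0 ≤ (inner ℝ (Matrix.toEuclideanLin (regMat a β g (t + 1)) x) x : ℝ) := fun x => by
    rw [inner_regMat]
    have := Finset.sum_nonneg (s := Finset.range (t + 1)) (f := fun s => (inner ℝ (g s) x : ℝ) ^ 2)
      fun _ _ => sq_nonneg _
    positivity
  have := hn (y + s • z)
  rw [map_add, map_smul, inner_add_left, inner_add_right, inner_add_right, h1, inner_smul_left,
    inner_smul_right, inner_smul_left, inner_smul_right, inner_toEuclideanLin_symm hA z y, h1,
    real_inner_comm (g t) z] at this
  simp only [conj_trivial] at this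
  nlinarith

/-- With `A y = g` and `G = ⟨g, y⟩`, the quadratic regularizer gives `η B² ‖y‖² ≤ G`, while
Cauchy–Schwarz gives `G ≤ B ‖y‖`. Together they give `η G² ≤ G`. -/
theorem dualSq_le (hβ : 0 ≤ β) {B η : ℝ} (hB : 0 < B) (hη : 0 < η) (haB : η * B ^ 2 ≤ a)
    {t : ℕ} (hg : ‖g t‖ ≤ B) : dualSq a β g t ≤ 1 / η := by
  have ha : 0 < a := lt_of_lt_of_le (by positivity) haB
  have hA := posDef_regMat ha hβ g (t + 1)
  unfold dualSq
  set y := Matrix.toEuclideanLin (regMat a β g (t + 1))⁻¹ (g t) with hy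
  have h1 : Matrix.toEuclideanLin (regMat a β g (t + 1)) y = g t := toEuclideanLin_inv_apply hA _
  have h2 : (inner ℝ (g t) y : ℝ) ≤ B * ‖y‖ :=
    (real_inner_le_norm _ _).trans (mul_le_mul_of_nonneg_right hg (norm_nonneg _))
  have h3 : η * B ^ 2 * ‖y‖ ^ 2 ≤ inner ℝ (g t) y := by
    rw [← h1, inner_regMat]
    have := Finset.sum_nonneg (s := Finset.range (t + 1)) (f := fun s => (inner ℝ (g s) y : ℝ) ^ 2)
      fun _ _ => sq_nonneg _
    nlinarith [mul_le_mul_of_nonneg_right haB (sq_nonneg ‖y‖), mul_nonneg hβ this]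
  have h4 : 0 ≤ B * ‖y‖ := by positivity
  set G : ℝ := inner ℝ (g t) y
  have h5 : 0 ≤ G := le_trans (by positivity) h3
  rw [le_div_iff₀ hη]
  by_contra hcon
  push Not at hcon
  have : G ^ 2 ≤ (B * ‖y‖) ^ 2 := pow_le_pow_left₀ h5 h2 2
  have : η * G ^ 2 ≤ G := by nlinarith
  have hG : 0 < G := by
    rcases h5.eq_or_lt with h | h
    · rw [← h] at hcon; linarith
    · exact h
  nlinarith

/-- Removing the newest rank-one term multiplies the determinant by `1 - β · dualSq`, by the matrix
determinant lemma; then `log (1 - x) ≤ -x`. -/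
theorem mul_dualSq_le_log (ha : 0 < a) (hβ : 0 ≤ β) (t : ℕ) :
    β * dualSq a β g t ≤ Real.log (regMat a β g (t + 1)).det - Real.log (regMat a β g t).det := by
  have hA := posDef_regMat ha hβ g (t + 1)
  have hA' := posDef_regMat ha hβ g t
  have e : regMat a β g t = regMat a β g (t + 1)
      + Matrix.vecMulVec ((-β) • (g t).ofLp) (g t).ofLp := by
    unfold regMat outer
    rw [Finset.sum_range_succ, smul_add, Matrix.smul_vecMulVec, neg_smul]
    abel
  have h1 : (regMat a β g t).det = (regMat a β g (t + 1)).det * (1 - β * dualSq a β g t) := by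
    rw [e, det_add_vecMulVec hA.det_pos.ne'.isUnit]
    congr 1
    rw [Matrix.mulVec_smul, dotProduct_smul, dualSq]
    simp only [Matrix.toLpLin_apply, PiLp.inner_apply, dotProduct, smul_eq_mul, RCLike.inner_apply,
      conj_trivial]
    rw [neg_mul, ← sub_eq_add_neg]
    congr 2
    exact Finset.sum_congr rfl fun _ _ => by ring
  have hp := hA'.det_pos
  have hp2 : 0 < 1 - β * dualSq a β g t := by
    rw [h1] at hp
    exact (pos_iff_pos_of_mul_pos hp).1 hA.det_pos
  rw [h1, Real.log_mul hA.det_pos.ne' hp2.ne']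
  linarith [Real.log_le_sub_one_of_pos hp2]

/-- The elliptical potential bound. -/
theorem sum_dualSq_le (hβ : 0 ≤ β) (hβ1 : β ≤ 1) {B : ℝ} (hB : 0 < B) (haB : B ^ 2 ≤ a) (T : ℕ)
    (hg : ∀ t < T, ‖g t‖ ≤ B) :
    β * ∑ t ∈ Finset.range T, dualSq a β g t ≤ d * Real.log (1 + T) := by
  have ha : 0 < a := lt_of_lt_of_le (by positivity) haB
  have h1 : β * ∑ t ∈ Finset.range T, dualSq a β g t
      ≤ Real.log (regMat a β g T).det - Real.log (regMat a β g 0).det := by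
    rw [Finset.mul_sum, ← Finset.sum_range_sub (fun t => Real.log (regMat a β g t).det)]
    exact Finset.sum_le_sum fun t _ => mul_dualSq_le_log ha hβ t
  have h0 : (regMat a β g 0).det = a ^ d := by simp [regMat]
  -- Each rank-one form is at most `B² ‖z‖² ≤ a ‖z‖²`, and `β ≤ 1`; so the eigenvalues grow from `a`
  -- to at most `a (1 + T)`.
  have h2 : (regMat a β g T).det ≤ (a * (1 + T)) ^ d := by
    apply det_le_pow_of_form_le (posDef_regMat ha hβ g T)
    intro z
    rw [inner_regMat]
    have : ∑ s ∈ Finset.range T, (inner ℝ (g s) z : ℝ) ^ 2 ≤ ∑ s ∈ Finset.range T, a * ‖z‖ ^ 2 := by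
      refine Finset.sum_le_sum fun s hs => ?_
      have h3 := abs_inner_le_of_norm_le (hg s (Finset.mem_range.1 hs)) (le_refl ‖z‖)
      calc _ = |(inner ℝ (g s) z : ℝ)| ^ 2 := (sq_abs _).symm
        _ ≤ (B * ‖z‖) ^ 2 := pow_le_pow_left₀ (abs_nonneg _) h3 2
        _ ≤ _ := by rw [mul_pow]; exact mul_le_mul_of_nonneg_right haB (sq_nonneg _)
    rw [Finset.sum_const, Finset.card_range, nsmul_eq_mul] at this
    have h4 : 0 ≤ (T : ℝ) * (a * ‖z‖ ^ 2) := by positivity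
    nlinarith
  have h3 : Real.log (regMat a β g T).det ≤ d * Real.log (a * (1 + T)) := by
    rw [← Real.log_pow]
    exact Real.log_le_log (posDef_regMat ha hβ g T).det_pos h2
  rw [Real.log_mul ha.ne' (by positivity)] at h3
  rw [h0, Real.log_pow] at h1
  linarith

end Elliptic

/-! ### One approximate Newton step -/

section Step

variable {d : ℕ} {B η β : ℝ} {g w : ℕ → Vec d}

/-- The inverse of `H_t`. -/
def hessMat (B η β : ℝ) (g : ℕ → Vec d) (t : ℕ) (v x : Vec d) : Matrix (Fin d) (Fin d) ℝ :=
  regMat (2 * η * d / (1 - ‖v‖ ^ 2) + (d + η * B ^ 2)) β g (t + 1)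
    + (4 * η * d / (1 - ‖x‖ ^ 2) ^ 2) • outer x

theorem matA_eq (t : ℕ) (v : Vec d) :
    matA B η β g t v = (regMat (2 * η * d / (1 - ‖v‖ ^ 2) + (d + η * B ^ 2)) β g (t + 1))⁻¹ := by
  unfold matA regMat
  rw [add_smul (2 * η * d / (1 - ‖v‖ ^ 2))]

theorem landmark_coeff_pos (hd : 1 ≤ d) (hη : 0 < η) {v : Vec d} (hv : ‖v‖ < 1) :
    0 < 2 * η * d / (1 - ‖v‖ ^ 2) + (d + η * B ^ 2) := by
  have := one_sub_norm_sq_pos hv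
  positivity

theorem matH_eq (hd : 1 ≤ d) (hη : 0 < η) (hβ : 0 ≤ β) (t : ℕ) {v : Vec d} (hv : ‖v‖ < 1)
    (x : Vec d) : matH B η β g t v x = (hessMat B η β g t v x)⁻¹ := by
  unfold matH hessMat
  rw [matA_eq, Matrix.nonsing_inv_nonsing_inv _
    (posDef_regMat (landmark_coeff_pos hd hη hv) hβ g (t + 1)).det_pos.ne'.isUnit]

theorem posDef_hessMat (hd : 1 ≤ d) (hη : 0 < η) (hβ : 0 ≤ β) (t : ℕ) {v x : Vec d} (hv : ‖v‖ < 1) :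
    (hessMat B η β g t v x).PosDef :=
  (posDef_regMat (landmark_coeff_pos hd hη hv) hβ g (t + 1)).add_posSemidef
    ((posSemidef_outer x).smul (by positivity))

theorem toEuclideanLin_hessMat (t : ℕ) (v x z : Vec d) :
    Matrix.toEuclideanLin (hessMat B η β g t v x) z
      = (2 * η * d / (1 - ‖v‖ ^ 2) + (d + η * B ^ 2)) • z
        + β • ∑ s ∈ Finset.range (t + 1), (inner ℝ (g s) z : ℝ) • g s
        + (4 * η * d / (1 - ‖x‖ ^ 2) ^ 2 * inner ℝ x z) • x := by
  rw [hessMat, map_add, LinearMap.add_apply, toEuclideanLin_regMat, map_smul, LinearMap.smul_apply,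
    toEuclideanLin_outer, smul_smul]

/-- Replacing the iterate by the landmark in the identity coefficient is the only approximation in
this matrix, and subtracting `γ I` undoes it: the result is the exact Hessian. -/
theorem inner_hessMat (t : ℕ) (v x z : Vec d) :
    (inner ℝ (Matrix.toEuclideanLin (hessMat B η β g t v x) z) z : ℝ)
      - (2 * η * d / (1 - ‖v‖ ^ 2) - 2 * η * d / (1 - ‖x‖ ^ 2)) * ‖z‖ ^ 2
      = hessForm B η β g (t + 1) x z := by
  rw [toEuclideanLin_hessMat]
  simp only [inner_add_left, inner_smul_left, sum_inner, real_inner_self_eq_norm_sq, conj_trivial,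
    hessForm, barForm, quadForm]
  have e : ∑ s ∈ Finset.range (t + 1), (inner ℝ (g s) z : ℝ) * inner ℝ (g s) z
      = ∑ s ∈ Finset.range (t + 1), (inner ℝ (g s) z : ℝ) ^ 2 :=
    Finset.sum_congr rfl fun _ _ => by ring
  rw [e]
  ring

theorem toEuclideanLin_taylorH (m t : ℕ) (v x : Vec d) :
    Matrix.toEuclideanLin (taylorH B η β m g t v x)
      = ∑ k ∈ Finset.range (m + 1), (2 * η * d / (1 - ‖v‖ ^ 2) - 2 * η * d / (1 - ‖x‖ ^ 2)) ^ k
        • (Matrix.toEuclideanLin (matH B η β g t v x)) ^ (k + 1) := by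
  simp only [taylorH, map_sum, map_smul, Matrix.toLpLin_pow]

/-- The landmark test implies `1 - ‖x‖² ≥ (3/4)(1 - ‖v‖²)`, hence a relative change of the barrier
coefficient of at most `1/3`. This is exactly the condition under which the Neumann series
contracts. -/
theorem abs_landmark_coeff_sub_le (hη : 0 < η) {v x : Vec d} (hv : ‖v‖ < 1) (hx : ‖x‖ < 1)
    (hxv : |‖x‖ ^ 2 - ‖v‖ ^ 2| ≤ 1 / 4 * (1 - ‖v‖ ^ 2)) :
    3 * |2 * η * d / (1 - ‖v‖ ^ 2) - 2 * η * d / (1 - ‖x‖ ^ 2)|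
      ≤ 2 * η * d / (1 - ‖v‖ ^ 2) + (d + η * B ^ 2) := by
  have h1 := one_sub_norm_sq_pos hv
  have h2 := one_sub_norm_sq_pos hx
  obtain ⟨h3, h4⟩ := abs_le.1 hxv
  have e : 2 * η * d / (1 - ‖v‖ ^ 2) - 2 * η * d / (1 - ‖x‖ ^ 2)
      = 2 * η * d / (1 - ‖v‖ ^ 2) * ((‖v‖ ^ 2 - ‖x‖ ^ 2) / (1 - ‖x‖ ^ 2)) := by
    field_simp; ring
  have h5 : |(‖v‖ ^ 2 - ‖x‖ ^ 2) / (1 - ‖x‖ ^ 2)| ≤ 1 / 3 := by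
    rw [abs_div, abs_of_pos h2, div_le_iff₀ h2, abs_le]
    constructor <;> linarith
  have h6 : 0 ≤ 2 * η * d / (1 - ‖v‖ ^ 2) := by positivity
  have h7 : 0 ≤ d + η * B ^ 2 := by positivity
  rw [e, abs_mul, abs_of_nonneg h6]
  nlinarith

/-- The potential gradient after a step. -/
theorem potGrad_add (t : ℕ) (v x Δ : Vec d) :
    potGrad B η β g w (t + 1) (x + Δ) = (potGrad B η β g w (t + 1) x
      + (Matrix.toEuclideanLin (hessMat B η β g t v x) Δ
        - (2 * η * d / (1 - ‖v‖ ^ 2) - 2 * η * d / (1 - ‖x‖ ^ 2)) • Δ))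
      + (η * d) • ((2 / (1 - ‖x + Δ‖ ^ 2)) • (x + Δ) - (2 / (1 - ‖x‖ ^ 2)) • x
        - (2 / (1 - ‖x‖ ^ 2)) • Δ - (4 * inner ℝ x Δ / (1 - ‖x‖ ^ 2) ^ 2) • x) := by
  rw [toEuclideanLin_hessMat]
  unfold potGrad
  have e : ∑ s ∈ Finset.range (t + 1), (inner ℝ (g s) (x + Δ - w s) : ℝ) • g s
      = ∑ s ∈ Finset.range (t + 1), (inner ℝ (g s) (x - w s) : ℝ) • g s
        + ∑ s ∈ Finset.range (t + 1), (inner ℝ (g s) Δ : ℝ) • g s := by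
    rw [← Finset.sum_add_distrib]
    refine Finset.sum_congr rfl fun s _ => ?_
    rw [← add_smul, ← inner_add_right]
    congr 2
    abel
  rw [e]
  module

/-- Quadratic convergence with slack. After the step the gradient consists of the truncation error,
at most `l/243`, and the third-order remainder of the barrier, at most `33 l/200`, both in the dual
norm at the old point. Passing to the norm at the new point costs `97/80`, and the product is below
`6/25`. -/
theorem oqns_step {m t : ℕ} {x v : Vec d} {l : ℝ} (hd : 1 ≤ d) (hη : 11 ≤ η) (hβ : 0 ≤ β)
    (hm : 4 ≤ m) (hx : ‖x‖ < 1) (hv : ‖v‖ < 1)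
    (hxv : |‖x‖ ^ 2 - ‖v‖ ^ 2| ≤ 1 / 4 * (1 - ‖v‖ ^ 2)) (hl0 : 0 ≤ l) (hl : l ≤ 2 / 5)
    (hp : ∀ z, |(inner ℝ (potGrad B η β g w (t + 1) x) z : ℝ)|
      ≤ l * √(hessForm B η β g (t + 1) x z)) {Δ : Vec d}
    (hΔ : Δ = -Matrix.toEuclideanLin (taylorH B η β m g t v x) (potGrad B η β g w (t + 1) x)) :
    barForm x Δ ≤ (201 / 200 * l / √(η * d)) ^ 2 ∧ 201 / 200 * l / √(η * d) ≤ 1 / 8 ∧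
    (∀ z, |(inner ℝ (potGrad B η β g w (t + 1) (x + Δ)) z : ℝ)|
      ≤ 6 / 25 * l * √(hessForm B η β g (t + 1) (x + Δ) z)) ∧
    -(inner ℝ (potGrad B η β g w (t + 1) x) Δ : ℝ) ≤ 2 * l ^ 2 := by
  have hη0 : 0 < η := by linarith
  have hA := posDef_hessMat (B := B) (g := g) (x := x) hd hη0 hβ t hv
  set p := potGrad B η β g w (t + 1) x with hpdef
  set P := Matrix.toEuclideanLin (hessMat B η β g t v x) with hP
  set γ := 2 * η * d / (1 - ‖v‖ ^ 2) - 2 * η * d / (1 - ‖x‖ ^ 2) with hγ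
  have hform : ∀ z, (inner ℝ (P z) z : ℝ) - γ * ‖z‖ ^ 2 = hessForm B η β g (t + 1) x z :=
    inner_hessMat t v x
  have hτ : ∀ z, (2 * η * d / (1 - ‖v‖ ^ 2) + (d + η * B ^ 2)) * ‖z‖ ^ 2 ≤ inner ℝ (P z) z := by
    intro z
    rw [hP, toEuclideanLin_hessMat]
    simp only [inner_add_left, inner_smul_left, sum_inner, real_inner_self_eq_norm_sq, conj_trivial]
    have h1 := Finset.sum_nonneg (s := Finset.range (t + 1))
      (f := fun s => (inner ℝ (g s) z : ℝ) * inner ℝ (g s) z) fun _ _ => mul_self_nonneg _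
    have h2 : 0 ≤ 4 * η * d / (1 - ‖x‖ ^ 2) ^ 2 * (inner ℝ x z * inner ℝ x z : ℝ) :=
      mul_nonneg (by positivity) (mul_self_nonneg _)
    nlinarith [mul_nonneg hβ h1]
  have hres := neumann_step_residual (P := P) (H := Matrix.toEuclideanLin (matH B η β g t v x))
    (γ := γ) (fun z => by rw [matH_eq hd hη0 hβ t hv]; exact toEuclideanLin_inv_apply hA z)
    (inner_toEuclideanLin_symm hA) hτ (abs_landmark_coeff_sub_le hη0 hv hx hxv) (m + 1) hl0
    (p := p) (fun z => by rw [hform]; exact hp z)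
  rw [← toEuclideanLin_taylorH, ← hΔ] at hres
  simp only [hform] at hres
  -- With `m ≥ 4` there are at least five terms; longer series are not needed by this estimate.
  have hρ : (1 / 3 ^ (m + 1) : ℝ) ≤ 1 / 243 := by
    apply one_div_le_one_div_of_le (by norm_num)
    calc (243 : ℝ) = 3 ^ 5 := by norm_num
      _ ≤ 3 ^ (m + 1) := pow_le_pow_right₀ (by norm_num) (by omega)
  set N := fun z => √(hessForm B η β g (t + 1) x z) with hN
  have hN0 : ∀ z, 0 ≤ N z := fun z => Real.sqrt_nonneg _
  have hN2 : ∀ z, N z ^ 2 = hessForm B η β g (t + 1) x z := fun z =>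
    Real.sq_sqrt (hessForm_nonneg hη0.le hβ hx _ z)
  set R := p + (P Δ - γ • Δ) with hR
  have hres' : ∀ z, |(inner ℝ R z : ℝ)| ≤ l * (1 / 243) * N z := fun z =>
    (hres z).trans (mul_le_mul_of_nonneg_right (mul_le_mul_of_nonneg_left hρ hl0) (hN0 z))
  have hNΔ : N Δ ≤ 201 / 200 * l := by
    have h1 : N Δ ^ 2 = inner ℝ R Δ - inner ℝ p Δ := by
      rw [hN2, ← hform, hR, inner_add_left, inner_sub_left, inner_smul_left,
        real_inner_self_eq_norm_sq]; simp
    have h2 := (abs_le.1 (hres' Δ)).2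
    have h3 := (abs_le.1 (hp Δ)).1
    change -(l * N Δ) ≤ _ at h3
    rcases (hN0 Δ).eq_or_lt with h | h
    · rw [← h]; positivity
    · have : N Δ * N Δ ≤ (201 / 200 * l) * N Δ := by nlinarith [mul_nonneg hl0 h.le]
      exact le_of_mul_le_mul_right this h
  have hηd : 11 ≤ η * d := by
    have : (1 : ℝ) ≤ d := by exact_mod_cast hd
    nlinarith
  set σ := √(η * d) with hσ
  have hσ2 : σ ^ 2 = η * d := Real.sq_sqrt (by positivity)
  -- This is where `η ≥ 11` enters: `(33/10)² ≤ 11`. The barrier is scaled by `σ²`, so a decrement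
  -- `l ≤ 2/5` is a step of local barrier length at most `1/8`.
  have hσ1 : 33 / 10 ≤ σ := Real.le_sqrt_of_sq_le (by norm_num; linarith)
  have hσ0 : 0 < σ := by linarith
  have hbar : ∀ z, σ * √(barForm x z) ≤ N z := by
    intro z
    rw [hσ, ← Real.sqrt_mul (by positivity)]
    apply Real.sqrt_le_sqrt
    have := quadForm_nonneg (B := B) (g := g) hη0.le hβ (t + 1) z
    unfold hessForm
    linarith
  set s := 201 / 200 * l / σ with hs
  have hs0 : 0 ≤ s := by positivity
  have hs8 : s ≤ 1 / 8 := by rw [hs, div_le_iff₀ hσ0]; linarith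
  have hbΔ : barForm x Δ ≤ s ^ 2 := by
    have h1 : √(barForm x Δ) ≤ s := by
      rw [hs, le_div_iff₀ hσ0]; linarith [hbar Δ]
    rw [← Real.sq_sqrt (barForm_nonneg hx Δ)]
    exact pow_le_pow_left₀ (Real.sqrt_nonneg _) h1 2
  refine ⟨hbΔ, hs8, ?_, ?_⟩
  · intro z
    have hx' := norm_add_lt_one hx hs0 hs8 hbΔ
    rw [potGrad_add t v x Δ, inner_add_left, inner_smul_left]
    have h1 := hres' z
    have h2 := abs_inner_barrier_remainder_le hx hs0 hs8 hbΔ z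
    set E := (inner ℝ ((2 / (1 - ‖x + Δ‖ ^ 2)) • (x + Δ) - (2 / (1 - ‖x‖ ^ 2)) • x
        - (2 / (1 - ‖x‖ ^ 2)) • Δ - (4 * inner ℝ x Δ / (1 - ‖x‖ ^ 2) ^ 2) • x) z : ℝ)
    have h3 : |η * d * E| ≤ l * (33 / 200) * N z := by
      rw [abs_mul, abs_of_pos (by linarith), ← hσ2]
      calc σ ^ 2 * |E| ≤ σ ^ 2 * (131 / 100 * s ^ 2 * √(barForm x z)) :=
            mul_le_mul_of_nonneg_left h2 (by positivity)
        _ = 131 / 100 * (201 / 200) ^ 2 * l ^ 2 / σ * (σ * √(barForm x z)) := by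
            rw [hs]; field_simp
        _ ≤ 131 / 100 * (201 / 200) ^ 2 * l ^ 2 / σ * N z :=
            mul_le_mul_of_nonneg_left (hbar z) (by positivity)
        _ ≤ _ := by
            apply mul_le_mul_of_nonneg_right _ (hN0 z)
            rw [div_le_iff₀ hσ0]
            nlinarith
    -- Only the barrier part of the Hessian moves, by the factor `22/15`, and `(97/80)² ≥ 22/15`.
    have h4 : N z ≤ 97 / 80 * √(hessForm B η β g (t + 1) (x + Δ) z) := by
      rw [hN, ← Real.sqrt_sq (show (0 : ℝ) ≤ 97 / 80 by norm_num), ← Real.sqrt_mul (by positivity)]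
      apply Real.sqrt_le_sqrt
      have h5 := barForm_le_of_step hx hs0 hs8 hbΔ z
      have h6 := quadForm_nonneg (B := B) (g := g) hη0.le hβ (t + 1) z
      have h7 := barForm_nonneg hx' z
      unfold hessForm
      have h8 : η * d * barForm x z ≤ η * d * (22 / 15 * barForm (x + Δ) z) :=
        mul_le_mul_of_nonneg_left h5 (by positivity)
      nlinarith [mul_nonneg (show 0 ≤ η * d by positivity) h7]
    simp only [conj_trivial]
    have h9 := mul_le_mul_of_nonneg_left h4 hl0
    have h10 := mul_nonneg hl0 (Real.sqrt_nonneg (hessForm B η β g (t + 1) (x + Δ) z))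
    have h11 := abs_add_le (inner ℝ R z) (η * d * E)
    linarith
  · have h3 := (abs_le.1 (hp Δ)).1
    change -(l * N Δ) ≤ _ at h3
    nlinarith [mul_le_mul_of_nonneg_left hNΔ hl0]

end Step

/-! ### Analysis of the online quasi-Newton iterates -/

section Run

variable {d : ℕ} {B η β : ℝ} {g w v : ℕ → Vec d} {m T : ℕ}

/-- Bounds on the Newton decrements of the iterates before they receive a subgradient. -/
def decr (a β : ℝ) (g : ℕ → Vec d) : ℕ → ℝ
  | 0 => 0
  | t + 1 => 6 / 25 * (decr a β g t + √(dualSq a β g t))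

/-- Bounds on the Newton decrements of the iterates when they receive a subgradient. -/
def decr' (a β : ℝ) (g : ℕ → Vec d) (t : ℕ) : ℝ := decr a β g t + √(dualSq a β g t)

theorem decr_nonneg (a β : ℝ) (g : ℕ → Vec d) (t : ℕ) : 0 ≤ decr a β g t := by
  induction t with
  | zero => exact le_rfl
  | succ t ih => unfold decr; positivity

/-- The invariants of the iterates. -/
structure IterInv (B η β : ℝ) (g w v : ℕ → Vec d) (t : ℕ) : Prop where
  norm_w : ‖w t‖ < 1
  norm_v : ‖v t‖ < 1
  near : |‖w t‖ ^ 2 - ‖v t‖ ^ 2| ≤ 1 / 4 * (1 - ‖v t‖ ^ 2)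
  decr_le : decr (d + B ^ 2 * η) β g t ≤ 12 / 125
  grad : ∀ z, |(inner ℝ (potGrad B η β g w t (w t)) z : ℝ)|
    ≤ decr (d + B ^ 2 * η) β g t * √(hessForm B η β g t (w t) z)

/-- The dual norm of the new subgradient is at most `1/√11 ≤ 302/1000`, and `12/125 + 302/1000 <
2/5`. -/
theorem IterInv.decr'_le (h : IterInv B η β g w v t) (hη : 11 ≤ η) (hB : 0 < B) (hβ : 0 ≤ β)
    (hg : ‖g t‖ ≤ B) : decr' (d + B ^ 2 * η) β g t ≤ 2 / 5 := by
  have h1 := dualSq_le (a := d + B ^ 2 * η) hβ hB (by linarith : 0 < η)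
    (by have : (0 : ℝ) ≤ d := by positivity
        linarith) hg
  have h2 : √(dualSq (d + B ^ 2 * η) β g t) ≤ 302 / 1000 := by
    rw [Real.sqrt_le_left (by norm_num)]
    refine h1.trans ?_
    rw [div_le_iff₀ (by linarith)]
    linarith
  unfold decr'
  linarith [h.decr_le]

/-- Receiving a subgradient perturbs the gradient by `g t` and enlarges the Hessian; the old
decrement and the dual norm of `g t` simply add. -/
theorem IterInv.grad' (h : IterInv B η β g w v t) (hd : 1 ≤ d) (hη : 11 ≤ η) (hβ : 0 ≤ β) (z : Vec
    d) :
    |(inner ℝ (potGrad B η β g w (t + 1) (w t)) z : ℝ)|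
      ≤ decr' (d + B ^ 2 * η) β g t * √(hessForm B η β g (t + 1) (w t) z) := by
  have hη0 : 0 ≤ η := by linarith
  have ha : 0 < d + B ^ 2 * η := by
    have : (1 : ℝ) ≤ d := by exact_mod_cast hd
    positivity
  rw [potGrad_succ, inner_add_left]
  refine (abs_add_le _ _).trans ?_
  unfold decr'
  rw [add_mul]
  apply add_le_add
  · refine (h.grad z).trans (mul_le_mul_of_nonneg_left (Real.sqrt_le_sqrt ?_) (decr_nonneg _ _ _ _))
    rw [hessForm_succ]
    nlinarith [mul_nonneg hβ (sq_nonneg (inner ℝ (g t) z : ℝ))]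
  · refine (abs_inner_le_dualSq ha hβ t z).trans (mul_le_mul_of_nonneg_left (Real.sqrt_le_sqrt ?_)
      (Real.sqrt_nonneg _))
    have := mul_nonneg (show 0 ≤ η * d by positivity) (barForm_nonneg h.norm_w z)
    change quadForm B η β g (t + 1) z ≤ hessForm B η β g (t + 1) (w t) z
    unfold hessForm
    linarith

/-- The facts about round `t` that follow from the invariants. -/
structure IterStep (B η β : ℝ) (g w : ℕ → Vec d) (t : ℕ) : Prop where
  bar : barForm (w t) (w (t + 1) - w t)
    ≤ (201 / 200 * decr' (d + B ^ 2 * η) β g t / √(η * d)) ^ 2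
  small : 201 / 200 * decr' (d + B ^ 2 * η) β g t / √(η * d) ≤ 1 / 8
  grad : ∀ z, |(inner ℝ (potGrad B η β g w (t + 1) (w (t + 1))) z : ℝ)|
    ≤ decr (d + B ^ 2 * η) β g (t + 1) * √(hessForm B η β g (t + 1) (w (t + 1)) z)
  descent : -(inner ℝ (potGrad B η β g w (t + 1) (w t)) (w (t + 1) - w t) : ℝ)
    ≤ 2 * decr' (d + B ^ 2 * η) β g t ^ 2

theorem decr'_nonneg (a β : ℝ) (g : ℕ → Vec d) (t : ℕ) : 0 ≤ decr' a β g t :=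
  add_nonneg (decr_nonneg _ _ _ _) (Real.sqrt_nonneg _)

theorem IsOQNS.iterStep (h : IsOQNS B η β (1 / 4) m T g w v) (hd : 1 ≤ d) (hη : 11 ≤ η)
    (hB : 0 < B) (hβ : 0 ≤ β) (hm : 4 ≤ m) {t : ℕ} (ht : t < T) (hg : ‖g t‖ ≤ B)
    (hI : IterInv B η β g w v t) : IterStep B η β g w t := by
  have hs := h.step_w t ht
  rw [(hasGradientAt_potential hI.norm_w (t + 1)).gradient] at hs
  obtain ⟨h1, h2, h3, h4⟩ := oqns_step (B := B) (η := η) (β := β) (g := g) (w := w) (m := m) (t :=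
    t)
    (x := w t) (v := v t)
    (l := decr' (d + B ^ 2 * η) β g t) hd hη hβ hm hI.norm_w hI.norm_v hI.near
    (decr'_nonneg _ _ _ _) (hI.decr'_le hη hB hβ hg) (hI.grad' hd hη hβ)
    (Δ := w (t + 1) - w t) (by rw [hs]; abel)
  refine ⟨h1, h2, fun z => ?_, h4⟩
  have := h3 z
  rw [add_sub_cancel] at this
  exact this

/-- The constants close the induction: a decrement at most `2/5` on receipt becomes at most
`(6/25)(2/5) = 12/125` after the step. The landmark rule restores proximity, either by passing the
test or by moving the landmark to the iterate. -/
theorem IsOQNS.iterInv (h : IsOQNS B η β (1 / 4) m T g w v) (hd : 1 ≤ d) (hη : 11 ≤ η)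
    (hB : 0 < B) (hβ : 0 ≤ β) (hm : 4 ≤ m) (hg : ∀ t < T, ‖g t‖ ≤ B) :
    ∀ t ≤ T, IterInv B η β g w v t := by
  intro t
  induction t with
  | zero =>
    intro _
    refine ⟨by simp [h.init_w], by simp [h.init_v], by simp [h.init_w, h.init_v], ?_, fun z => ?_⟩
    · norm_num [decr]
    · simp [decr, potGrad, h.init_w]
  | succ t ih =>
    intro ht
    have hI := ih (by omega)
    have hS := h.iterStep hd hη hB hβ hm (by omega) (hg t (by omega)) hI
    have hs0 : 0 ≤ 201 / 200 * decr' (d + B ^ 2 * η) β g t / √(η * d) := by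
      have := decr'_nonneg (d + B ^ 2 * η) β g t
      positivity
    have hw := norm_add_lt_one hI.norm_w hs0 hS.small hS.bar
    rw [add_sub_cancel] at hw
    have hdl := hI.decr'_le hη hB hβ (hg t (by omega))
    have hdec : decr (d + B ^ 2 * η) β g (t + 1) ≤ 12 / 125 := by
      change 6 / 25 * decr' (d + B ^ 2 * η) β g t ≤ _
      linarith
    by_cases hc : |‖w (t + 1)‖ ^ 2 - ‖v t‖ ^ 2| ≤ 1 / 4 * (1 - ‖v t‖ ^ 2)
    · have hv := h.keep_v t (by omega) hc
      exact ⟨hw, hv ▸ hI.norm_v, by rw [hv]; exact hc, hdec, hS.grad⟩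
    · have hv := h.move_v t (by omega) hc
      refine ⟨hw, hv ▸ hw, ?_, hdec, hS.grad⟩
      have := one_sub_norm_sq_pos hw
      rw [hv, sub_self, abs_zero]
      positivity

/-- The geometric recursion is absorbed: the squared decrements before receipt sum to at most
`36/625` of those on receipt, and `2 / (1 - 72/625) < 3`. -/
theorem sum_sq_decr'_le {a : ℝ} (ha : 0 < a) (hβ : 0 ≤ β) (T : ℕ) :
    ∑ t ∈ Finset.range T, decr' a β g t ^ 2 ≤ 3 * ∑ t ∈ Finset.range T, dualSq a β g t := by
  have h1 : ∀ t, decr' a β g t ^ 2 ≤ 2 * decr a β g t ^ 2 + 2 * dualSq a β g t := fun t => by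
    have := Real.sq_sqrt (dualSq_nonneg (g := g) ha hβ t)
    unfold decr'
    nlinarith [sq_nonneg (decr a β g t - √(dualSq a β g t))]
  have h2 : ∀ T : ℕ, ∑ t ∈ Finset.range T, decr a β g t ^ 2
      ≤ 36 / 625 * ∑ t ∈ Finset.range T, decr' a β g t ^ 2 := by
    intro T
    rcases T with _ | T
    · simp
    · rw [Finset.sum_range_succ', Finset.sum_range_succ]
      have : ∑ k ∈ Finset.range T, decr a β g (k + 1) ^ 2
          = 36 / 625 * ∑ t ∈ Finset.range T, decr' a β g t ^ 2 := by
        rw [Finset.mul_sum]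
        refine Finset.sum_congr rfl fun k _ => ?_
        change (6 / 25 * decr' a β g k) ^ 2 = _
        ring
      rw [this, show decr a β g 0 = 0 from rfl]
      nlinarith [sq_nonneg (decr' a β g T)]
  have h3 := Finset.sum_le_sum fun t (_ : t ∈ Finset.range T) => h1 t
  rw [Finset.sum_add_distrib, ← Finset.mul_sum, ← Finset.mul_sum] at h3
  have h4 := h2 T
  have h5 := Finset.sum_nonneg fun t (_ : t ∈ Finset.range T) => dualSq_nonneg (g := g) ha hβ t
  have h6 := Finset.sum_nonneg fun t (_ : t ∈ Finset.range T) => sq_nonneg (decr' a β g t)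
  linarith

theorem IsOQNS.sum_sq_le (hd : 1 ≤ d) (hη : 11 ≤ η) (hB : 0 < B) (hβ : 0 < β) (hβ1 : β ≤ 1)
    (hg : ∀ t < T, ‖g t‖ ≤ B) :
    ∑ t ∈ Finset.range T, decr' (d + B ^ 2 * η) β g t ^ 2 ≤ 3 * (d * Real.log (1 + T) / β) := by
  have hd' : (1 : ℝ) ≤ d := by exact_mod_cast hd
  have hη0 : 0 ≤ η := by linarith
  refine (sum_sq_decr'_le (by positivity) hβ.le T).trans ?_
  have := sum_dualSq_le (a := d + B ^ 2 * η) (g := g) hβ.le hβ1 hB (by nlinarith [sq_nonneg B]) T hg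
  have : ∑ t ∈ Finset.range T, dualSq (d + B ^ 2 * η) β g t ≤ d * Real.log (1 + T) / β := by
    rw [le_div_iff₀ hβ]; linarith
  linarith

/-- The iterate nearly minimizes the potential even against far-away points. The barrier grows with
slope `1/2` in the local norm, more than the decrement can take back, and the quadratic part is
handled by completing a square. -/
theorem potential_sub_le (hd : 1 ≤ d) (hη : 11 ≤ η) (hβ : 0 ≤ β) {t : ℕ}
    (hI : IterInv B η β g w v t) {y : Vec d} (hy : ‖y‖ < 1) :
    potential B η β g w t (w t) - potential B η β g w t y ≤ 2 * (η * d) + 1 := by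
  have hd' : (1 : ℝ) ≤ d := by exact_mod_cast hd
  have hηd : 11 ≤ η * d := by nlinarith
  have h1 := barrier_sub_ge hI.norm_w hy
  have h2 := (abs_le.1 (hI.grad (y - w t))).1
  rw [potential_eq t (w t) y]
  set D := -Real.log (1 - ‖y‖ ^ 2) + Real.log (1 - ‖w t‖ ^ 2)
        - 2 * inner ℝ (w t) (y - w t) / (1 - ‖w t‖ ^ 2)
  have hb0 := barForm_nonneg hI.norm_w (y - w t)
  have hq0 := quadForm_nonneg (B := B) (g := g) (by linarith : 0 ≤ η) hβ t (y - w t)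
  have h3 : √(hessForm B η β g t (w t) (y - w t))
      ≤ η * d * √(barForm (w t) (y - w t)) + √(quadForm B η β g t (y - w t)) := by
    rw [Real.sqrt_le_left (by positivity)]
    unfold hessForm
    have e1 := Real.sq_sqrt hb0
    have e2 := Real.sq_sqrt hq0
    have e3 : η * d * barForm (w t) (y - w t) ≤ (η * d) ^ 2 * barForm (w t) (y - w t) := by
      apply mul_le_mul_of_nonneg_right _ hb0; nlinarith
    have e4 : 0 ≤ η * d * √(barForm (w t) (y - w t)) * √(quadForm B η β g t (y - w t)) := by
      positivity
    nlinarith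
  have hm0 := decr_nonneg (d + B ^ 2 * η) β g t
  have hm := hI.decr_le
  set μ := decr (d + B ^ 2 * η) β g t
  set N := √(hessForm B η β g t (w t) (y - w t))
  set b := √(barForm (w t) (y - w t))
  have hb : 0 ≤ η * d * b := by positivity
  have h4 : μ * N ≤ 1 / 2 * (η * d * b) + 1 / 2 * √(quadForm B η β g t (y - w t)) := by
    have : 0 ≤ √(quadForm B η β g t (y - w t)) := Real.sqrt_nonneg _
    calc μ * N ≤ 1 / 2 * N := mul_le_mul_of_nonneg_right (by linarith) (Real.sqrt_nonneg _)
      _ ≤ _ := by linarith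
  have h5 : η * d * (1 / 2 * b - 2) ≤ η * d * D := mul_le_mul_of_nonneg_left h1 (by positivity)
  nlinarith [Real.sq_sqrt hq0, sq_nonneg (√(quadForm B η β g t (y - w t)) - 1 / 2)]

/-- Evaluate the new potential at the old and new iterates. Convexity and the descent estimate bound
the decrease by twice the squared decrement. Telescoping leaves the initial potential at `y` and the
final gap between iterate and comparator. -/
theorem IsOQNS.regret_le (h : IsOQNS B η β (1 / 4) m T g w v) (hd : 1 ≤ d) (hη : 11 ≤ η)
    (hB : 0 < B) (hβ : 0 < β) (hβ1 : β ≤ 1) (hm : 4 ≤ m) (hg : ∀ t < T, ‖g t‖ ≤ B)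
    {y : Vec d} (hy : ‖y‖ < 1) :
    ∑ t ∈ Finset.range T, ((inner ℝ (g t) (w t - y) : ℝ) - β / 2 * (inner ℝ (g t) (w t - y) : ℝ) ^
      2)
      ≤ -(η * d) * Real.log (1 - ‖y‖ ^ 2) + (d + B ^ 2 * η) / 2 + 2 * (η * d) + 1
        + 6 * (d * Real.log (1 + T) / β) := by
  have hI := h.iterInv hd hη hB hβ.le hm hg
  have h1 : ∀ t < T, potential B η β g w (t + 1) (w t) - potential B η β g w (t + 1) (w (t + 1))
      ≤ 2 * decr' (d + B ^ 2 * η) β g t ^ 2 := by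
    intro t ht
    have hS := h.iterStep hd hη hB hβ.le hm ht (hg t ht) (hI t ht.le)
    have e := potential_eq (B := B) (η := η) (β := β) (g := g) (w := w) (t + 1) (w t) (w (t + 1))
    have e1 := barrier_sub_nonneg (hI t ht.le).norm_w (hI (t + 1) ht).norm_w
    have e2 := quadForm_nonneg (B := B) (g := g) (by linarith : 0 ≤ η) hβ.le (t + 1) (w (t + 1) - w
      t)
    have e3 := mul_nonneg (show 0 ≤ η * d by positivity) e1
    linarith [hS.descent]
  have h2 : ∀ n ≤ T, ∑ t ∈ Finset.range n, ((inner ℝ (g t) (w t - y) : ℝ)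
      - β / 2 * (inner ℝ (g t) (w t - y) : ℝ) ^ 2) ≤ potential B η β g w n (w n)
        - potential B η β g w n y + potential B η β g w 0 y
        + 2 * ∑ t ∈ Finset.range n, decr' (d + B ^ 2 * η) β g t ^ 2 := by
    intro n
    induction n with
    | zero => intro _; simp [potential, h.init_w]
    | succ n ih =>
      intro hn
      have := ih (by omega)
      rw [Finset.sum_range_succ, Finset.sum_range_succ]
      have e1 := h1 n (by omega)
      rw [potential_succ n (w n), sub_self, inner_zero_right] at e1
      rw [potential_succ n y]
      have e2 : (inner ℝ (g n) (y - w n) : ℝ) = -inner ℝ (g n) (w n - y) := by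
        rw [← inner_neg_right, neg_sub]
      have e3 : (inner ℝ (g n) (w n) : ℝ) = inner ℝ (g n) (w n - y) + inner ℝ (g n) y := by
        rw [← inner_add_right, sub_add_cancel]
      rw [e2, neg_sq]
      linarith
  have h3 := h2 T le_rfl
  have h4 := potential_sub_le hd hη hβ.le (hI T le_rfl) hy
  have h5 := IsOQNS.sum_sq_le (T := T) hd hη hB hβ hβ1 hg
  have h6 : potential B η β g w 0 y ≤ -(η * d) * Real.log (1 - ‖y‖ ^ 2) + (d + B ^ 2 * η) / 2 := by
    simp only [potential, Finset.range_zero, Finset.sum_empty, inner_zero_right, mul_zero, add_zero]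
    have : ‖y‖ ^ 2 ≤ 1 := pow_le_one₀ (norm_nonneg _) hy.le
    have hη0 : 0 ≤ η := by linarith
    have : (d + B ^ 2 * η) / 2 * ‖y‖ ^ 2 ≤ (d + B ^ 2 * η) / 2 :=
      mul_le_of_le_one_right (by positivity) this
    linarith
  linarith

/-! ### Landmark changes -/

/-- The rounds before `T` in which the landmark changes. -/
def landmarkMoves (c : ℝ) (w v : ℕ → Vec d) (T : ℕ) : Finset ℕ := by
  classical
  exact (Finset.range T).filter fun t => ¬ |‖w (t + 1)‖ ^ 2 - ‖v t‖ ^ 2| ≤ c * (1 - ‖v t‖ ^ 2)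

theorem landmarkMoves_succ (c : ℝ) (w v : ℕ → Vec d) (T : ℕ) :
    (landmarkMoves c w v (T + 1)).card = (landmarkMoves c w v T).card
      + (open Classical in if |‖w (T + 1)‖ ^ 2 - ‖v T‖ ^ 2| ≤ c * (1 - ‖v T‖ ^ 2) then 0 else 1) :=
        by
  classical
  unfold landmarkMoves
  rw [Finset.range_add_one, Finset.filter_insert]
  split_ifs <;> simp_all

/-- A failed test changes `1 - ‖·‖²` by a factor above `5/4` or below `3/4`; both logarithms are at
least `1/5` in absolute value. -/
theorem log_landmark_ge {x y : ℝ} (hx : 0 < x) (hy : 0 < y) (h : 1 / 4 * y < |x - y|) :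
    1 / 5 ≤ |Real.log x - Real.log y| := by
  rw [← Real.log_div hx.ne' hy.ne']
  rcases lt_abs.1 h with h | h
  · have h1 : 5 / 4 ≤ x / y := by rw [le_div_iff₀ hy]; linarith
    have h2 := Real.one_sub_inv_le_log_of_pos (div_pos hx hy)
    have h3 : (x / y)⁻¹ ≤ (5 / 4)⁻¹ := inv_anti₀ (by norm_num) h1
    refine le_trans ?_ (le_abs_self _)
    rw [show (5 / 4 : ℝ)⁻¹ = 4 / 5 by norm_num] at h3
    linarith
  · have h1 : x / y ≤ 3 / 4 := by rw [div_le_iff₀ hy]; linarith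
    have h2 := Real.log_le_sub_one_of_pos (div_pos hx hy)
    refine le_trans ?_ (neg_le_abs _)
    linarith

/-- An amortized count: drift of `log (1 - ‖w‖²)` away from the landmark accumulates by local step
lengths, and each move consumes `1/5` of it. Cauchy–Schwarz then uses the bound on the sum of
squared lengths. -/
theorem IsOQNS.card_landmarkMoves_le (h : IsOQNS B η β (1 / 4) m T g w v) (hd : 1 ≤ d) (hη : 11 ≤ η)
    (hB : 0 < B) (hβ : 0 < β) (hβ1 : β ≤ 1) (hm : 4 ≤ m) (hg : ∀ t < T, ‖g t‖ ≤ B) :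
    ((landmarkMoves (1 / 4) w v T).card : ℝ) ^ 2 ≤ 30 * (T * Real.log (1 + T) / β) := by
  have hI := h.iterInv hd hη hB hβ.le hm hg
  have hd' : (1 : ℝ) ≤ d := by exact_mod_cast hd
  have hηd : 11 * d ≤ η * d := by nlinarith
  set S := fun t => 201 / 200 * decr' (d + B ^ 2 * η) β g t / √(η * d) with hS
  have hS0 : ∀ t, 0 ≤ S t := fun t => by
    have := decr'_nonneg (d + B ^ 2 * η) β g t
    positivity
  have h1 : ∀ t < T, |Real.log (1 - ‖w (t + 1)‖ ^ 2) - Real.log (1 - ‖w t‖ ^ 2)| ≤ 2 * S t := by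
    intro t ht
    have hst := h.iterStep hd hη hB hβ.le hm ht (hg t ht) (hI t ht.le)
    have := abs_log_sub_log_le (hI t ht.le).norm_w (hS0 t) hst.small hst.bar
    rwa [add_sub_cancel] at this
  -- The current discrepancy plus `1/5` per past move is the amortization potential; a move resets
  -- the discrepancy to zero.
  have h2 : ∀ n ≤ T, |Real.log (1 - ‖w n‖ ^ 2) - Real.log (1 - ‖v n‖ ^ 2)|
      + 1 / 5 * (landmarkMoves (1 / 4) w v n).card ≤ ∑ t ∈ Finset.range n, 2 * S t := by
    intro n
    induction n with
    | zero => intro _; simp [h.init_w, h.init_v, landmarkMoves]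
    | succ n ih =>
      intro hn
      have hi := ih (by omega)
      rw [Finset.sum_range_succ, landmarkMoves_succ]
      have e1 := h1 n (by omega)
      have e2 := abs_sub_le (Real.log (1 - ‖w (n + 1)‖ ^ 2)) (Real.log (1 - ‖w n‖ ^ 2))
        (Real.log (1 - ‖v n‖ ^ 2))
      split_ifs with hc
      · rw [h.keep_v n (by omega) hc, add_zero]
        linarith
      · rw [h.move_v n (by omega) hc, sub_self, abs_zero]
        push Not at hc
        have := log_landmark_ge (one_sub_norm_sq_pos (hI (n + 1) hn).norm_w)
          (one_sub_norm_sq_pos (hI n (by omega)).norm_v)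
          (by rw [show 1 - ‖w (n + 1)‖ ^ 2 - (1 - ‖v n‖ ^ 2) = -(‖w (n + 1)‖ ^ 2 - ‖v n‖ ^ 2) by ring,
                abs_neg]; exact hc)
        push_cast
        linarith
  have h3 := h2 T le_rfl
  set J : ℝ := ((landmarkMoves (1 / 4) w v T).card : ℝ)
  have hJ0 : 0 ≤ J := by positivity
  have h4 : J ≤ 10 * ∑ t ∈ Finset.range T, S t := by
    have := abs_nonneg (Real.log (1 - ‖w T‖ ^ 2) - Real.log (1 - ‖v T‖ ^ 2))
    rw [← Finset.mul_sum] at h3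
    linarith
  have h5 : (∑ t ∈ Finset.range T, S t) ^ 2 ≤ T * ∑ t ∈ Finset.range T, S t ^ 2 := by
    simpa using sq_sum_le_card_mul_sum_sq (s := Finset.range T) (f := S)
  have h6 : ∑ t ∈ Finset.range T, S t ^ 2
      = (201 / 200) ^ 2 / (η * d) * ∑ t ∈ Finset.range T, decr' (d + B ^ 2 * η) β g t ^ 2 := by
    rw [Finset.mul_sum]
    refine Finset.sum_congr rfl fun t _ => ?_
    rw [hS]
    simp only [div_pow, mul_pow]
    rw [Real.sq_sqrt (by positivity)]
    ring
  have h7 := IsOQNS.sum_sq_le (T := T) hd hη hB hβ hβ1 hg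
  have hlog : 0 ≤ Real.log (1 + T) := Real.log_nonneg (by linarith [Nat.cast_nonneg (α := ℝ) T])
  have h8 : ∑ t ∈ Finset.range T, S t ^ 2 ≤ 3 / 10 * (Real.log (1 + T) / β) := by
    rw [h6]
    have h9 : (201 / 200 : ℝ) ^ 2 / (η * d) ≤ 1 / 10 / d := by
      rw [div_div, div_le_div_iff₀ (by positivity) (by positivity)]
      nlinarith
    calc _ ≤ 1 / 10 / d * (3 * (d * Real.log (1 + T) / β)) :=
          mul_le_mul h9 h7 (Finset.sum_nonneg fun _ _ => sq_nonneg _) (by positivity)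
      _ = _ := by field_simp
  have hT : (0 : ℝ) ≤ T := by positivity
  calc J ^ 2 ≤ (10 * ∑ t ∈ Finset.range T, S t) ^ 2 := pow_le_pow_left₀ hJ0 h4 2
    _ = 100 * (∑ t ∈ Finset.range T, S t) ^ 2 := by ring
    _ ≤ 100 * (T * (3 / 10 * (Real.log (1 + T) / β))) := by
        have := mul_le_mul_of_nonneg_left h8 hT
        linarith
    _ = _ := by ring

end Run

/-! ### Pathwise regret of the reduction -/

section Regret

variable {d : ℕ} {α B η δ : ℝ} {C : Set (Vec d)} {T : ℕ}
  {round : Vec d → Vec d → Vec d → Vec d → Prop}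

theorem betaOf_pos (hα : 0 < α) : 0 < betaOf α := lt_min (by norm_num) (by linarith)

theorem betaOf_le : betaOf α ≤ 1 / 8 := min_le_left _ _

theorem betaOf_le_half : betaOf α ≤ α / 2 := min_le_right _ _

/-- The argument of the logarithm exceeds `4⁴`, so the prescribed order reaches the only threshold
required by the Newton analysis. -/
theorem four_le_taylorOrder {β : ℝ} (hd : 1 ≤ d) (hη : 11 ≤ η) (hB : 0 ≤ B) (hβ : 0 ≤ β) (hT : 1 ≤
    T) :
    4 ≤ taylorOrder d B η β (1 / 4) T := by
  have hd' : (1 : ℝ) ≤ d := by exact_mod_cast hd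
  have hT' : (1 : ℝ) ≤ T := by exact_mod_cast hT
  have hη0 : 0 < η := by linarith
  set X := 12 * (4 + 32 / η ^ 2) ^ 2
      * (2 * η * d + B ^ 2 * η + (B + 2 * β * B ^ 2) * T) ^ 2 * T / (1 - 1 / 4) with hX
  have hXge : (4 : ℝ) ^ 4 ≤ X := by
    have h1 : (4 : ℝ) ≤ 4 + 32 / η ^ 2 := le_add_of_nonneg_right (by positivity)
    have h2 : (22 : ℝ) ≤ 2 * η * d + B ^ 2 * η + (B + 2 * β * B ^ 2) * T := by
      have : 0 ≤ B ^ 2 * η + (B + 2 * β * B ^ 2) * T := by positivity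
      nlinarith
    have h3 : (4 : ℝ) ^ 2 ≤ (4 + 32 / η ^ 2) ^ 2 := pow_le_pow_left₀ (by norm_num) h1 2
    have h4 : (22 : ℝ) ^ 2 ≤ (2 * η * d + B ^ 2 * η + (B + 2 * β * B ^ 2) * T) ^ 2 :=
      pow_le_pow_left₀ (by norm_num) h2 2
    rw [hX, le_div_iff₀ (by norm_num)]
    calc (4 : ℝ) ^ 4 * (1 - 1 / 4) ≤ 12 * 4 ^ 2 * 22 ^ 2 * 1 := by norm_num
      _ ≤ _ := by gcongr
  unfold taylorOrder
  rw [← hX]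
  have h5 : (4 : ℝ) ≤ -Real.logb (1 / 4) X := by
    rw [one_div, Real.logb_inv_base, neg_neg, Real.le_logb_iff_rpow_le (by norm_num)
      (lt_of_lt_of_le (by norm_num) hXge)]
    exact_mod_cast hXge
  exact_mod_cast h5.trans (Nat.le_ceil _)

/-- Shrinking by `1 - 1/T` makes the barrier finite at the comparator, with a value only logarithmic
in `T`, even if the original point lies on the sphere. -/
theorem log_one_sub_shrink_ge {y : Vec d} (hy : ‖y‖ ≤ 1) (hT : 1 ≤ T) :
    ‖(1 - 1 / (T : ℝ)) • y‖ < 1 ∧ -Real.log (1 - ‖(1 - 1 / (T : ℝ)) • y‖ ^ 2) ≤ Real.log T := by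
  have hT' : (1 : ℝ) ≤ T := by exact_mod_cast hT
  have h0 : 0 < 1 / (T : ℝ) := by positivity
  have h1 : 1 / (T : ℝ) ≤ 1 := by rw [div_le_one (by linarith)]; exact hT'
  have h2 : ‖(1 - 1 / (T : ℝ)) • y‖ ≤ 1 - 1 / T := by
    rw [norm_smul, Real.norm_of_nonneg (by linarith)]
    exact mul_le_of_le_one_right (by linarith) hy
  refine ⟨by linarith, ?_⟩
  have h3 : 1 / (T : ℝ) ≤ 1 - ‖(1 - 1 / (T : ℝ)) • y‖ ^ 2 := by
    nlinarith [norm_nonneg ((1 - 1 / (T : ℝ)) • y)]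
  have := Real.log_le_log h0 h3
  rw [one_div, Real.log_inv] at this
  rw [one_div] at *
  linarith

/-- Pathwise regret of the reduction on exp-concave losses. -/
theorem IsRun.regret_le (hr : IsSurrogate C B δ round) (hC : C ⊆ Metric.closedBall 0 1) (hd : 1 ≤ d)
    (hα : 0 < α) (hη : 11 ≤ η) (hB : 1 ≤ B) (hBd : B ≤ 1 + √d) (hδ : 0 ≤ δ) (hδT : δ ≤ 1 / T) (hT :
      1 ≤ T)
    {u ζ : ℕ → Vec d} (hrun : IsRun round B η (betaOf α) T u ζ) {F : ℕ → Vec d → ℝ}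
    (hF : ∀ t < T, ExpConcaveOn α C (F t)) (hζ : ∀ t < T, IsLossSubgradient C (F t) (u t) (ζ t))
    {y : Vec d} (hy : y ∈ C) :
    ∑ t ∈ Finset.range T, (F t (u t) - F t y)
      ≤ d * ((η + 6 / betaOf α) * Real.log (1 + T) + 4 * η + 9) := by
  obtain ⟨w, v, g, hQ, hround⟩ := hrun
  have hβ := betaOf_pos hα
  have hβ8 := betaOf_le (α := α)
  set β := betaOf α
  have hm := four_le_taylorOrder hd hη (by linarith : 0 ≤ B) hβ.le hT
  have hg : ∀ t < T, ‖g t‖ ≤ B := fun t ht => hr.norm_le _ _ _ _ (hround t ht) (hζ t ht).2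
  have hI := hQ.iterInv hd hη (by linarith) hβ.le hm hg
  have hT' : (1 : ℝ) ≤ T := by exact_mod_cast hT
  have hd' : (1 : ℝ) ≤ d := by exact_mod_cast hd
  have hδ1 : δ ≤ 1 := hδT.trans (by rw [div_le_one (by linarith)]; exact hT')
  have hyn : ‖y‖ ≤ 1 := by simpa using hC hy
  obtain ⟨hy1, hy2⟩ := log_one_sub_shrink_ge hyn hT
  set y' := (1 - 1 / (T : ℝ)) • y with hy'
  have hreg := hQ.regret_le hd hη (by linarith) hβ (by linarith) hm hg hy1
  have hB2 : B ^ 2 ≤ 4 * d := by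
    have h1 : B ^ 2 ≤ (1 + √d) ^ 2 := pow_le_pow_left₀ (by linarith) hBd 2
    nlinarith [Real.sq_sqrt (show (0 : ℝ) ≤ d by linarith), sq_nonneg (√(d : ℝ) - 1)]
  have hstep : ∀ t ∈ Finset.range T, F t (u t) - F t y
      ≤ ((inner ℝ (g t) (w t - y') : ℝ) - β / 2 * (inner ℝ (g t) (w t - y') : ℝ) ^ 2)
        + 7 * d / T := by
    intro t ht
    have ht := Finset.mem_range.1 ht
    have h1 := hr.loss_sub_le hC hδ hδ1 hα hβ hβ8 betaOf_le_half (hF t ht) (hround t ht)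
      (hI t ht.le).norm_w (hζ t ht) hy
    have hwn := (hI t ht.le).norm_w
    have h2 := abs_le.1 (abs_inner_le_of_norm_le (hg t ht) (norm_sub_le_two hwn.le hyn))
    have h3 := abs_le.1 (abs_inner_le_of_norm_le (hg t ht) (norm_sub_le_two hwn.le hy1.le))
    have h4 := abs_le.1 (abs_inner_le_of_norm_le (hg t ht) hyn)
    have e : (inner ℝ (g t) (w t - y) : ℝ) = inner ℝ (g t) (w t - y') - 1 / T * inner ℝ (g t) y :=
      by
      rw [← inner_smul_right, ← inner_sub_right]
      congr 1
      rw [hy']; module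
    have h5 : 2 * δ ≤ 2 * d / T := by
      rw [le_div_iff₀ (by linarith)]
      rw [le_div_iff₀ (by linarith)] at hδT
      linarith
    set X : ℝ := inner ℝ (g t) (w t - y)
    set Y : ℝ := inner ℝ (g t) (w t - y')
    set Z : ℝ := inner ℝ (g t) y
    have hTi : 0 < 1 / (T : ℝ) := by positivity
    -- Price of shrinking the comparator: a displacement of order `1/T` times `B (1 + B/4)`, with `B
    -- ≤ 1 + √d`. Together with `2δ ≤ 2d/T` it gives `7d/T` per round, hence `7d` in total.
    have h6 : X - β / 2 * X ^ 2 - (Y - β / 2 * Y ^ 2) ≤ 5 * d / T := by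
      have e2 : X - β / 2 * X ^ 2 - (Y - β / 2 * Y ^ 2) = 1 / T * (-Z * (1 - β / 2 * (X + Y))) := by
        rw [e]; ring
      rw [e2, div_eq_mul_one_div (5 * (d : ℝ)), mul_comm (5 * (d : ℝ))]
      apply mul_le_mul_of_nonneg_left _ hTi.le
      have h7 : |1 - β / 2 * (X + Y)| ≤ 1 + B / 4 := by
        have : |β / 2 * (X + Y)| ≤ B / 4 := by
          rw [abs_mul, abs_of_pos (by linarith : 0 < β / 2)]
          have : |X + Y| ≤ 4 * B := by rw [abs_le]; constructor <;> linarith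
          nlinarith [abs_nonneg (X + Y)]
        calc _ ≤ |(1 : ℝ)| + |β / 2 * (X + Y)| := abs_sub _ _
          _ ≤ _ := by rw [abs_one]; linarith
      calc -Z * (1 - β / 2 * (X + Y)) ≤ |Z| * |1 - β / 2 * (X + Y)| := by
            rw [← abs_mul, neg_mul]; exact neg_le_abs _
        _ ≤ (B * 1) * (1 + B / 4) := mul_le_mul (abs_le.2 h4) h7 (abs_nonneg _) (by linarith)
        _ ≤ _ := by nlinarith
    have e3 : 7 * (d : ℝ) / T = 5 * d / T + 2 * d / T := by ring
    linarith
  refine (Finset.sum_le_sum hstep).trans ?_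
  rw [Finset.sum_add_distrib, Finset.sum_const, Finset.card_range, nsmul_eq_mul,
    mul_div_cancel₀ _ (by linarith : (T : ℝ) ≠ 0)]
  have hlog : Real.log T ≤ Real.log (1 + T) := Real.log_le_log (by linarith) (by linarith)
  have h8 : -(η * d) * Real.log (1 - ‖y'‖ ^ 2) ≤ η * d * Real.log (1 + T) := by
    have := mul_le_mul_of_nonneg_left (hy2.trans hlog) (show 0 ≤ η * d by positivity)
    linarith
  have h9 : B ^ 2 * η ≤ 4 * d * η := mul_le_mul_of_nonneg_right hB2 (by linarith)
  have e4 : (d : ℝ) * ((η + 6 / β) * Real.log (1 + T) + 4 * η + 9)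
      = η * d * Real.log (1 + T) + 6 * (d * Real.log (1 + T) / β) + 4 * η * d + 9 * d := by ring
  rw [e4]
  linarith

end Regret

/-! ### From regret to excess risk -/

section Stochastic

variable {d : ℕ} {Ω : Type*} {Ξ : Type*} [MeasurableSpace Ω] [MeasurableSpace Ξ] {μ : Measure Ω}
  {α : ℝ} {C : Set (Vec d)} {f : Vec d → Ξ → ℝ} {ξ : ℕ → Ω → Ξ}

theorem ExpConcaveOn.convexOn (hα : 0 < α) {h : Vec d → ℝ} (hf : ExpConcaveOn α C h) :
    ConvexOn ℝ C h := by
  refine ⟨hf.1, fun x hx y hy a b ha hb hab => ?_⟩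
  have h1 := hf.2 hx hy ha hb hab
  have h2 := convexOn_exp.2 (Set.mem_univ (-α * h x)) (Set.mem_univ (-α * h y)) ha hb hab
  have h3 := Real.exp_le_exp.1 (h2.trans h1)
  simp only [smul_eq_mul] at h3 ⊢
  refine le_of_mul_le_mul_left ?_ hα
  linarith

theorem past_le (hξ : ∀ t, Measurable (ξ t)) (t : ℕ) : past ξ t ≤ (inferInstance : MeasurableSpace
    Ω) :=
  iSup₂_le fun s _ => (hξ s).comap_le

theorem indep_past (hξ : ∀ t, Measurable (ξ t)) (hi : iIndepFun ξ μ) (t : ℕ) :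
    Indep (past ξ t) (MeasurableSpace.comap (ξ t) inferInstance) μ := by
  have h := indep_iSup_of_disjoint (fun s => (hξ s).comap_le) hi (S := {s | s < t}) (T := {t})
    (by simp)
  simpa [past] using h

/-! ### Population risk and online-to-batch conversion -/

namespace IsStochExpConcave

theorem integrable_at (h : IsStochExpConcave μ α C f ξ) {x : Vec d} (hx : x ∈ C) (t : ℕ) :
    Integrable (fun ω => f x (ξ t ω)) μ := by
  have := (h.identDistrib t).comp (h.measurable_loss x hx)
  exact this.integrable_iff.2 (h.integrable_loss x hx)

theorem integral_at (h : IsStochExpConcave μ α C f ξ) {x : Vec d} (hx : x ∈ C) (t : ℕ) : ∫ ω, f x (ξ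
    t ω) ∂μ = risk μ f ξ x :=
  ((h.identDistrib t).comp (h.measurable_loss x hx)).integral_eq

theorem abs_sub_le (h : IsStochExpConcave μ α C f ξ) {x y : Vec d} (hx : x ∈ C) (hy : y ∈ C) (z : Ξ)
    : |f x z - f y z| ≤ ‖x - y‖ := by
  have := (h.lipschitz z).dist_le_mul x hx y hy
  rwa [NNReal.coe_one, one_mul, Real.dist_eq, dist_eq_norm] at this

theorem norm_le (h : IsStochExpConcave μ α C f ξ) {x : Vec d} (hx : x ∈ C) : ‖x‖ ≤ 1 := by
    simpa using h.subset_ball hx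

theorem abs_risk_sub_le [IsProbabilityMeasure μ] (h : IsStochExpConcave μ α C f ξ) {x y : Vec d} (hx
    : x ∈ C) (hy : y ∈ C) :
    |risk μ f ξ x - risk μ f ξ y| ≤ ‖x - y‖ := by
  unfold risk
  rw [← integral_sub (h.integrable_loss x hx) (h.integrable_loss y hy)]
  have := norm_integral_le_of_norm_le_const (μ := μ) (C := ‖x - y‖)
    (f := fun ω => f x (ξ 0 ω) - f y (ξ 0 ω)) (Filter.Eventually.of_forall fun ω => by
      rw [Real.norm_eq_abs]; exact h.abs_sub_le hx hy _)
  simpa using this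

theorem continuousOn_risk [IsProbabilityMeasure μ] (h : IsStochExpConcave μ α C f ξ) : ContinuousOn
    (risk μ f ξ) C := by
  have : LipschitzOnWith 1 (risk μ f ξ) C := LipschitzOnWith.of_dist_le_mul fun x hx y hy => by
    rw [NNReal.coe_one, one_mul, Real.dist_eq, dist_eq_norm]; exact h.abs_risk_sub_le hx hy
  exact this.continuousOn

theorem convexOn_risk (h : IsStochExpConcave μ α C f ξ) (hα : 0 < α) : ConvexOn ℝ C (risk μ f ξ) :=
    by
  refine ⟨h.convex, fun x hx y hy a b ha hb hab => ?_⟩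
  unfold risk
  rw [smul_eq_mul, smul_eq_mul, ← integral_const_mul, ← integral_const_mul,
    ← integral_add ((h.integrable_loss x hx).const_mul a) ((h.integrable_loss y hy).const_mul b)]
  refine integral_mono (h.integrable_loss _ (h.convex hx hy ha hb hab))
    (((h.integrable_loss x hx).const_mul a).add ((h.integrable_loss y hy).const_mul b)) fun ω => ?_
  have := ((h.expConcave (ξ 0 ω)).convexOn hα).2 hx hy ha hb hab
  simpa using this

/-- A Carathéodory function, continuous in the point and measurable in the sample; the point is
restricted to `C` because the loss is unconstrained elsewhere. -/
theorem measurable_uncurry_loss (h : IsStochExpConcave μ α C f ξ) : Measurable (Function.uncurry fun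
    (x : C) z => f x z) := by
  have h1 : Measurable (Function.uncurry fun (x : C) (z : Ξ) => f x z) := by
    apply measurable_uncurry_of_continuous_of_measurable (u := fun (x : C) (z : Ξ) => f x z)
    · exact fun z => continuousOn_iff_continuous_domRestrict.1 (h.lipschitz z).continuousOn
    · exact fun x => h.measurable_loss x x.2
  exact h1

/-- The expected loss of a point determined by the past is its expected risk. -/
theorem integral_adapted [IsProbabilityMeasure μ] (h : IsStochExpConcave μ α C f ξ) {t : ℕ} {u : Ω →
    Vec d} (hu : Measurable[past ξ t] u) (huC : ∀ ω, u ω ∈ C) :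
    Integrable (fun ω => f (u ω) (ξ t ω)) μ ∧ Integrable (fun ω => risk μ f ξ (u ω)) μ ∧
      ∫ ω, f (u ω) (ξ t ω) ∂μ = ∫ ω, risk μ f ξ (u ω) ∂μ := by
  have hu0 : Measurable u := hu.mono (past_le h.measurable_sample t) le_rfl
  set u' : Ω → C := fun ω => ⟨u ω, huC ω⟩ with hu'
  have hu'm : Measurable u' := hu0.subtype_mk
  obtain ⟨y, hy⟩ := h.nonempty
  have hmeas : Measurable (fun ω => f (u ω) (ξ t ω)) :=
    h.measurable_uncurry_loss.comp (hu'm.prodMk (h.measurable_sample t))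
  have hint : Integrable (fun ω => f (u ω) (ξ t ω)) μ := by
    have h1 : Integrable (fun ω => f (u ω) (ξ t ω) - f y (ξ t ω)) μ :=
      Integrable.of_bound (hmeas.sub ((h.measurable_loss y hy).comp (h.measurable_sample
        t))).aestronglyMeasurable
        2 (Filter.Eventually.of_forall fun ω => by
          rw [Real.norm_eq_abs]
          exact (h.abs_sub_le (huC ω) hy _).trans (norm_sub_le_two (h.norm_le (huC ω)) (h.norm_le
            hy)))
    refine (h1.add (h.integrable_at hy t)).congr (Filter.Eventually.of_forall fun ω => ?_)
    simp
  have hrm : Measurable (fun ω => risk μ f ξ (u ω)) :=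
    (continuousOn_iff_continuous_domRestrict.1 h.continuousOn_risk).measurable.comp hu'm
  have hrint : Integrable (fun ω => risk μ f ξ (u ω)) μ :=
    Integrable.of_bound hrm.aestronglyMeasurable (|risk μ f ξ y| + 2)
      (Filter.Eventually.of_forall fun ω => by
        have h1 := (h.abs_risk_sub_le (huC ω) hy).trans (norm_sub_le_two (h.norm_le (huC ω))
          (h.norm_le hy))
        rw [Real.norm_eq_abs]
        have := abs_sub_abs_le_abs_sub (risk μ f ξ (u ω)) (risk μ f ξ y)
        linarith)
  refine ⟨hint, hrint, ?_⟩
  -- Independence makes the joint law a product, and Fubini replaces the fresh sample by its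
  -- expectation, point by point.
  have hind : IndepFun u' (ξ t) μ := by
    refine indep_of_indep_of_le_left (indep_past h.measurable_sample h.indep t) ?_
    have : Measurable[past ξ t] u' := by
      let := past ξ t
      exact Measurable.subtype_mk hu
    exact this.comap_le
  have hmap := hind.map_prod_eq_prod_map_map hu'm.aemeasurable (h.measurable_sample t).aemeasurable
  set F := Function.uncurry fun (x : C) (z : Ξ) => f x z
  have hFm : Measurable F := h.measurable_uncurry_loss
  have hpair : Measurable fun ω => (u' ω, ξ t ω) := hu'm.prodMk (h.measurable_sample t)
  have h1 : ∫ ω, f (u ω) (ξ t ω) ∂μ = ∫ q, F q ∂((μ.map u').prod (μ.map (ξ t))) := by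
    rw [← hmap, integral_map hpair.aemeasurable hFm.aestronglyMeasurable]
    rfl
  have hFint : Integrable F ((μ.map u').prod (μ.map (ξ t))) := by
    rw [← hmap, integrable_map_measure hFm.aestronglyMeasurable hpair.aemeasurable]
    exact hint
  have hp1 := Measure.isProbabilityMeasure_map (μ := μ) hu'm.aemeasurable
  have hp2 := Measure.isProbabilityMeasure_map (μ := μ) (h.measurable_sample t).aemeasurable
  rw [h1, integral_prod _ hFint]
  have h2 : ∀ x : C, ∫ z, F (x, z) ∂(μ.map (ξ t)) = risk μ f ξ x := by
    intro x
    rw [integral_map (f := fun z => F (x, z)) (h.measurable_sample t).aemeasurable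
      (h.measurable_loss x x.2).aestronglyMeasurable]
    exact h.integral_at x.2 t
  simp only [h2]
  rw [integral_map hu'm.aemeasurable]
  exact (continuousOn_iff_continuous_domRestrict.1
    h.continuousOn_risk).measurable.aestronglyMeasurable

/-- Online-to-batch conversion. -/
theorem excessRiskLE_of_regret [IsProbabilityMeasure μ] (h : IsStochExpConcave μ α C f ξ) (hα : 0 <
    α) {T : ℕ} (hT : 1 ≤ T) {U : ℕ → Ω → Vec d}
    (hU : ∀ t < T, Measurable[past ξ t] (U t)) (hUC : ∀ t < T, ∀ ω, U t ω ∈ C) {R : ℝ}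
    (hR : ∀ ω, ∀ y ∈ C, ∑ t ∈ Finset.range T, (f (U t ω) (ξ t ω) - f y (ξ t ω)) ≤ R) :
    ExcessRiskLE μ C f ξ (fun ω => avgIterate T fun t => U t ω) (R / T) := by
  have hT' : (0 : ℝ) < T := by exact_mod_cast hT
  have hw : ∑ t ∈ Finset.range T, (T : ℝ)⁻¹ = 1 := by
    rw [Finset.sum_const, Finset.card_range, nsmul_eq_mul, mul_inv_cancel₀ hT'.ne']
  have hmem : ∀ ω, avgIterate T (fun t => U t ω) ∈ C := fun ω => by
    unfold avgIterate
    rw [Finset.smul_sum]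
    exact h.convex.sum_mem (fun _ _ => by positivity) hw
      fun t ht => hUC t (Finset.mem_range.1 ht) ω
  have hmeas : Measurable fun ω => avgIterate T (fun t => U t ω) := by
    unfold avgIterate
    have h1 : Measurable fun ω => ∑ t ∈ Finset.range T, U t ω :=
      Finset.measurable_fun_sum _ fun t ht =>
        (hU t (Finset.mem_range.1 ht)).mono (past_le h.measurable_sample t) le_rfl
    exact h1.const_smul (T : ℝ)⁻¹
  obtain ⟨y₀, hy₀⟩ := h.nonempty
  have hrm : Measurable (fun ω => risk μ f ξ (avgIterate T fun t => U t ω)) :=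
    (continuousOn_iff_continuous_domRestrict.1 h.continuousOn_risk).measurable.comp
      (hmeas.subtype_mk (h := hmem))
  have hint : Integrable (fun ω => risk μ f ξ (avgIterate T fun t => U t ω)) μ :=
    Integrable.of_bound hrm.aestronglyMeasurable (|risk μ f ξ y₀| + 2)
      (Filter.Eventually.of_forall fun ω => by
        have h1 := (h.abs_risk_sub_le (hmem ω) hy₀).trans
          (norm_sub_le_two (h.norm_le (hmem ω)) (h.norm_le hy₀))
        rw [Real.norm_eq_abs]
        have := abs_sub_abs_le_abs_sub (risk μ f ξ (avgIterate T fun t => U t ω)) (risk μ f ξ y₀)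
        linarith)
  refine ⟨hmem, hint, ?_⟩
  rw [integral_sub hint (integrable_const _), integral_const]
  simp only [probReal_univ, one_smul]
  -- No minimizer is needed: the regret bound is applied to every fixed comparator, and the infimum
  -- follows.
  rw [sub_le_comm]
  refine le_csInf ⟨_, Set.mem_image_of_mem _ hy₀⟩ ?_
  rintro _ ⟨y, hy, rfl⟩
  have hA := fun t (ht : t ∈ Finset.range T) =>
    h.integral_adapted (hU t (Finset.mem_range.1 ht)) (hUC t (Finset.mem_range.1 ht))
  have hjen : ∫ ω, risk μ f ξ (avgIterate T fun t => U t ω) ∂μ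
      ≤ ∑ t ∈ Finset.range T, (T : ℝ)⁻¹ * ∫ ω, risk μ f ξ (U t ω) ∂μ := by
    simp only [← integral_const_mul]
    rw [← integral_finsetSum _ fun t ht => ((hA t ht).2.1.const_mul _)]
    refine integral_mono hint (integrable_finsetSum _ fun t ht => ((hA t ht).2.1.const_mul _)) ?_
    intro ω
    have := (h.convexOn_risk hα).map_sum_le (t := Finset.range T) (w := fun _ => (T : ℝ)⁻¹)
      (p := fun t => U t ω) (fun _ _ => by positivity) hw
      fun t ht => hUC t (Finset.mem_range.1 ht) ω
    simpa [avgIterate, Finset.smul_sum] using this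
  have hreg : ∑ t ∈ Finset.range T, ((∫ ω, risk μ f ξ (U t ω) ∂μ) - risk μ f ξ y) ≤ R := by
    have hs : ∀ t ∈ Finset.range T, Integrable (fun ω => f (U t ω) (ξ t ω) - f y (ξ t ω)) μ :=
      fun t ht => (hA t ht).1.sub (h.integrable_at hy t)
    have e : ∀ t ∈ Finset.range T, (∫ ω, risk μ f ξ (U t ω) ∂μ) - risk μ f ξ y
        = ∫ ω, (f (U t ω) (ξ t ω) - f y (ξ t ω)) ∂μ := fun t ht => by
      rw [integral_sub (hA t ht).1 (h.integrable_at hy t), (hA t ht).2.2, h.integral_at hy t]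
    rw [Finset.sum_congr rfl e, ← integral_finsetSum _ hs]
    calc _ ≤ ∫ _ω, R ∂μ := integral_mono
          (integrable_finsetSum _ hs)
          (integrable_const R) fun ω => hR ω y hy
      _ = R := by simp
  rw [Finset.sum_sub_distrib, Finset.sum_const, Finset.card_range, nsmul_eq_mul] at hreg
  rw [← Finset.mul_sum] at hjen
  have h3 := mul_le_mul_of_nonneg_left hreg (inv_nonneg.2 hT'.le)
  rw [mul_sub, inv_mul_cancel_left₀ hT'.ne'] at h3
  rw [div_eq_inv_mul]
  linarith

end IsStochExpConcave

/-- Excess risk of the reduction. -/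
theorem IsStochRun.excessRiskLE [IsProbabilityMeasure μ] {round : Vec d → Vec d → Vec d → Vec d →
    Prop} {B η δ : ℝ} {T : ℕ}
    (h : IsStochExpConcave μ α C f ξ) (hr : IsSurrogate C B δ round) (hd : 1 ≤ d) (hα : 0 < α)
    (hη : 11 ≤ η) (hB : 1 ≤ B) (hBd : B ≤ 1 + √d) (hδ : 0 ≤ δ) (hδT : δ ≤ 1 / T) (hT : 1 ≤ T)
    {U ζ : ℕ → Ω → Vec d} (hU : IsStochRun round B η (betaOf α) T C f ξ U ζ) :
    ExcessRiskLE μ C f ξ (fun ω => avgIterate T fun t => U t ω)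
      (d * ((η + 6 / betaOf α) * Real.log (1 + T) + 4 * η + 9) / T) := by
  refine h.excessRiskLE_of_regret hα hT hU.adapted (fun t ht ω => ?_) fun ω y hy => ?_
  · obtain ⟨w, v, g, -, hround⟩ := hU.run ω
    exact hr.mem _ _ _ _ (hround t ht)
  · exact (hU.run ω).regret_le hr h.subset_ball hd hα hη hB hBd hδ hδT hT
      (F := fun t x => f x (ξ t ω)) (fun t _ => h.expConcave _) (fun t ht => hU.subgradient t ht ω)
        hy

end Stochastic

/-! ### Structured memory for programs -/

section Memory

variable {d : ℕ}

/-- Names of vector variables: 64 vectors and the rows of three matrices. -/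
abbrev Blk (d : ℕ) := Fin 64 ⊕ (Fin 3 × Fin d)

/-- The contents of the vector variables. -/
abbrev Mem (d : ℕ) := Blk d → Fin d → ℝ

/-- Position of a vector variable. -/
def Blk.idx : Blk d → ℕ
  | .inl k => k
  | .inr (j, i) => 64 + (j * d + i)

theorem Blk.idx_injective : Function.Injective (Blk.idx (d := d)) := by
  rintro (k | ⟨j, i⟩) (k' | ⟨j', i'⟩) h
  · simp only [idx] at h; rw [Fin.ext h]
  · simp only [idx] at h; have := k.2; omega
  · simp only [idx] at h; have := k'.2; omega
  · simp only [idx] at h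
    have h1 : (j : ℕ) * d + i = j' * d + i' := by omega
    have hd : 0 < d := i.pos
    have h2 : (j : ℕ) = j' := by
      have := congrArg (· / d) h1
      simpa [Nat.mul_add_div, Nat.div_eq_of_lt, mul_comm _ d, hd] using this
    have h3 : (i : ℕ) = i' := by rw [h2] at h1; omega
    rw [Fin.ext h2, Fin.ext h3]

/-- The first register of a vector variable. -/
def Blk.addr (b : Blk d) : ℕ := b.idx * (d + 1)

/-- Auxiliary registers between the vector variables. -/
def hid (d n : ℕ) : ℕ := n * (d + 1) + d

/-- The vector variables stored in the registers. -/
def mem (reg : ℕ → ℝ) : Mem d := fun b i => reg (b.addr + i)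

/-- Uniqueness of division with remainder by `d + 1`. Blocks have width `d + 1` although vectors
have length `d`; the remainder `d` is a spare register that no vector operation can overwrite. -/
theorem cell_inj {k k' i i' : ℕ} (hi : i < d + 1) (hi' : i' < d + 1)
    (h : k * (d + 1) + i = k' * (d + 1) + i') : k = k' ∧ i = i' := by
  have h2 : k = k' := by
    have := congrArg (· / (d + 1)) h
    simpa [Nat.mul_add_div, Nat.div_eq_of_lt, mul_comm _ (d + 1), hi, hi'] using this
  subst h2
  exact ⟨rfl, by omega⟩

theorem addr_add_ne_hid (b : Blk d) (i : Fin d) (n : ℕ) : b.addr + i ≠ hid d n := fun h => by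
  have := (cell_inj (by omega) (by omega) h).2
  omega

theorem hid_injective {n n' : ℕ} (h : hid d n = hid d n') : n = n' :=
  (cell_inj (by omega) (by omega) h).1

theorem mem_update_cell (reg : ℕ → ℝ) (b : Blk d) (i : Fin d) (x : ℝ) :
    mem (Function.update reg (b.addr + i) x)
      = Function.update (mem reg) b (Function.update (mem reg b) i x) := by
  funext b' i'
  by_cases hb : b' = b
  · subst hb
    by_cases hi : i' = i
    · subst hi; simp [mem]
    · have : b'.addr + (i' : ℕ) ≠ b'.addr + i := fun h => hi (Fin.ext (by omega))
      simp [mem, Function.update_of_ne this, Function.update_of_ne hi]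
  · have : b'.addr + (i' : ℕ) ≠ b.addr + i := fun h =>
      hb (Blk.idx_injective (cell_inj (by omega) (by omega) h).1)
    simp [mem, Function.update_of_ne this, Function.update_of_ne hb]

theorem mem_update_hid (reg : ℕ → ℝ) (n : ℕ) (x : ℝ) :
    (mem (Function.update reg (hid d n) x) : Mem d) = mem reg := by
  funext b i
  simp [mem, Function.update_of_ne (addr_add_ne_hid b i n)]

theorem update_hid_cell (reg : ℕ → ℝ) (b : Blk d) (i : Fin d) (n : ℕ) (x : ℝ) :
    Function.update reg (hid d n) x (b.addr + i) = reg (b.addr + i) :=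
  Function.update_of_ne (addr_add_ne_hid b i n) _ _

theorem readVec_addr (reg : ℕ → ℝ) (b : Blk d) : readVec d reg b.addr = WithLp.toLp 2 (mem reg b) :=
  rfl

theorem mem_writeVec (reg : ℕ → ℝ) (b : Blk d) (x : Vec d) :
    mem (writeVec reg b.addr x) = Function.update (mem reg) b x.ofLp := by
  funext b' i'
  by_cases hb : b' = b
  · subst hb
    simp [mem, writeVec]
  · have h : ¬ (b.addr ≤ b'.addr + (i' : ℕ) ∧ b'.addr + (i' : ℕ) < b.addr + d) := fun h => by
      have h1 : b'.addr + (i' : ℕ) = b.addr + (b'.addr + i' - b.addr) := by omega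
      exact hb (Blk.idx_injective (cell_inj (by omega) (by omega) h1).1)
    rw [Function.update_of_ne hb]
    simp only [mem, writeVec, dif_neg h]

theorem writeVec_hid (reg : ℕ → ℝ) (b : Blk d) (x : Vec d) (n : ℕ) :
    writeVec reg b.addr x (hid d n) = reg (hid d n) := by
  unfold writeVec
  rw [dif_neg]
  rintro ⟨h1, h2⟩
  have h3 : hid d n = b.addr + (hid d n - b.addr) := by omega
  have := (cell_inj (by omega) (by omega) h3).2
  omega

end Memory

/-! ### Straight-line computations -/

/-- The program neither plays nor calls the oracle. -/
def Program.IsPure : Program → Prop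
  | .skip => True
  | .const _ _ => True
  | .arith _ _ _ _ => True
  | .ite _ _ p q => p.IsPure ∧ q.IsPure
  | .seq p q => p.IsPure ∧ q.IsPure
  | .play _ _ => False
  | .call _ _ => False

/-- Unrolled loop. -/
def Program.loop (P : ℕ → Program) : ℕ → Program
  | 0 => .skip
  | n + 1 => .seq (Program.loop P n) (P n)

section Computes

variable {d : ℕ}

theorem Program.IsPure.exec_eq {P : Program} (h : P.IsPure) (grad : ℕ → Vec d → Vec d)
    (o : Vec d → Option (Vec d)) (σ : State d) :
    (P.exec grad o σ).played = σ.played ∧ (P.exec grad o σ).rounds = σ.rounds ∧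
      (P.exec grad o σ).calls = σ.calls := by
  induction P generalizing σ with
  | skip => simp [Program.exec]
  | const => simp [Program.exec]
  | arith => simp [Program.exec]
  | ite a b p q ihp ihq =>
    simp only [Program.exec]
    split_ifs
    · exact ihp h.1 _
    · exact ihq h.2 _
  | seq p q ihp ihq =>
    simp only [Program.exec]
    obtain ⟨a1, a2, a3⟩ := ihp h.1 σ
    obtain ⟨b1, b2, b3⟩ := ihq h.2 (p.exec grad o σ)
    exact ⟨b1.trans a1, b2.trans a2, b3.trans a3⟩
  | play => exact h.elim
  | call => exact h.elim

/-- The program transforms the vector variables by `F` with at most `c` operations. -/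
structure Computes (P : Program) (F : Mem d → Mem d) (c : ℕ) : Prop where
  isPure : P.IsPure
  mem_exec : ∀ grad o (σ : State d), mem (P.exec grad o σ).reg = F (mem σ.reg)
  ops_le : ∀ grad o (σ : State d), (P.exec grad o σ).ops ≤ σ.ops + c

theorem Computes.skip : Computes .skip (fun m : Mem d => m) 0 :=
  ⟨trivial, fun _ _ _ => rfl, fun _ _ _ => le_rfl⟩

theorem Computes.seq {P Q : Program} {F G : Mem d → Mem d} {c c' : ℕ} (hP : Computes P F c)
    (hQ : Computes Q G c') : Computes (.seq P Q) (fun m => G (F m)) (c + c') :=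
  ⟨⟨hP.isPure, hQ.isPure⟩, fun grad o σ => by
    simp only [Program.exec]; rw [hQ.mem_exec, hP.mem_exec], fun grad o σ => by
    have h1 := hP.ops_le grad o σ
    have h2 := hQ.ops_le grad o (P.exec grad o σ)
    simp only [Program.exec]
    omega⟩

theorem Computes.congr {P : Program} {F G : Mem d → Mem d} {c c' : ℕ} (hP : Computes P F c)
    (h : ∀ m, F m = G m) (hc : c ≤ c') : Computes P G c' :=
  ⟨hP.isPure, fun grad o σ => by rw [hP.mem_exec, h], fun grad o σ =>
    (hP.ops_le grad o σ).trans (by omega)⟩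

/-- Write one entry of a vector variable. -/
def setEntry (m : Mem d) (b : Blk d) (i : Fin d) (x : ℝ) : Mem d :=
  Function.update m b (Function.update (m b) i x)

/-- In-place computation is sound because entry `i` of the result depends on the overwritten
variable only through its own entry `i`, as the last hypothesis requires. This permits the target to
equal an operand of an entrywise operation. -/
theorem Computes.loop_entries {P : ℕ → Program} (b : Blk d) {f : Mem d → Fin d → ℝ} {c : ℕ}
    (h : ∀ i : Fin d, Computes (P i) (fun m => setEntry m b i (f m i)) c)
    (hf : ∀ m i x, x i = m b i → f (Function.update m b x) i = f m i) :
    Computes (Program.loop P d) (fun m => Function.update m b (f m)) (d * c) := by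
  have key : ∀ n ≤ d, Computes (Program.loop P n) (fun m => Function.update m b
      fun i => if (i : ℕ) < n then f m i else m b i) (n * c) := by
    intro n
    induction n with
    | zero => intro _; exact Computes.skip.congr (fun m => by simp) (by simp)
    | succ n ih =>
      intro hn
      refine ((ih (by omega)).seq (h ⟨n, by omega⟩)).congr (fun m => ?_) (by rw [Nat.succ_mul])
      unfold setEntry
      rw [Function.update_idem, Function.update_self, hf _ _ _ (by simp)]
      congr 1
      funext i
      by_cases hi : i = ⟨n, by omega⟩
      · subst hi; simp
      · rw [Function.update_of_ne hi]
        have : (i : ℕ) ≠ n := fun h => hi (Fin.ext h)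
        congr 1
        simp only [eq_iff_iff]
        omega
  exact (key d le_rfl).congr (fun m => by simp) le_rfl

/-- A matrix variable. -/
def mat (m : Mem d) (j : Fin 3) : Matrix (Fin d) (Fin d) ℝ := fun i => m (.inr (j, i))

/-- Overwrite a matrix variable. -/
def setMat (m : Mem d) (j : Fin 3) (A : Matrix (Fin d) (Fin d) ℝ) : Mem d
  | .inl k => m (.inl k)
  | .inr (j', i) => if j' = j then A i else m (.inr (j', i))

@[simp] theorem setMat_inl (m : Mem d) (j : Fin 3) (A : Matrix (Fin d) (Fin d) ℝ) (k : Fin 64) :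
    setMat m j A (.inl k) = m (.inl k) := rfl

@[simp] theorem mat_setMat (m : Mem d) (j j' : Fin 3) (A : Matrix (Fin d) (Fin d) ℝ) :
    mat (setMat m j A) j' = if j' = j then A else mat m j' := by
  funext i
  by_cases h : j' = j <;> simp [mat, setMat, h]

@[simp] theorem mat_update_inl (m : Mem d) (k : Fin 64) (x : Fin d → ℝ) (j : Fin 3) :
    mat (Function.update m (.inl k) x) j = mat m j := by
  funext i; simp [mat]

@[simp] theorem mat_setEntry_inl (m : Mem d) (k : Fin 64) (i : Fin d) (x : ℝ) (j : Fin 3) :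
    mat (setEntry m (.inl k) i x) j = mat m j := mat_update_inl _ _ _ _

@[simp] theorem setEntry_self (m : Mem d) (b : Blk d) (i : Fin d) (x : ℝ) :
    setEntry m b i x b i = x := by simp [setEntry]

theorem setEntry_of_ne (m : Mem d) {b b' : Blk d} (h : b' ≠ b) (i : Fin d) (x : ℝ) :
    setEntry m b i x b' = m b' := Function.update_of_ne h _ _

@[simp] theorem setEntry_inl (m : Mem d) (k k' : Fin 64) (i : Fin d) (x : ℝ) :
    setEntry m (.inl k) i x (.inl k') = if k' = k then Function.update (m (.inl k)) i x else m (.inl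
      k') := by
  split_ifs with h
  · subst h; simp [setEntry]
  · exact setEntry_of_ne m (by simpa using h) i x

@[simp] theorem update_inl (m : Mem d) (k k' : Fin 64) (x : Fin d → ℝ) :
    Function.update m (.inl k) x (.inl k') = if k' = k then x else m (.inl k') := by
  split_ifs with h
  · subst h; simp
  · exact Function.update_of_ne (by simpa using h) _ _

/-- The row analogue: row `i` may depend on its own old contents, but not on the other rows being
overwritten. -/
theorem Computes.loop_rows {P : ℕ → Program} (j : Fin 3) {f : Mem d → Matrix (Fin d) (Fin d) ℝ} {c :
    ℕ}
    (h : ∀ i : Fin d, Computes (P i) (fun m => Function.update m (.inr (j, i)) (f m i)) c)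
    (hf : ∀ m i i' x, i' ≠ i → f (Function.update m (.inr (j, i')) x) i = f m i) :
    Computes (Program.loop P d) (fun m => setMat m j (f m)) (d * c) := by
  have hf' : ∀ (m : Mem d) (A : Matrix (Fin d) (Fin d) ℝ) (i : Fin d) (n : ℕ), n ≤ i →
      f (setMat m j fun i => if (i : ℕ) < n then A i else mat m j i) i = f m i := by
    intro m A i n
    induction n with
    | zero =>
      intro _
      congr 1
      funext b
      rcases b with k | ⟨j', i'⟩
      · rfl
      · simp only [setMat, not_lt_zero, if_false, mat]; split_ifs with h
        · rw [h]
        · rfl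
    | succ n ih =>
      intro hn
      rw [← ih (by omega)]
      rw [← hf (setMat m j fun i => if (i : ℕ) < n then A i else mat m j i) i ⟨n, by omega⟩
        (A ⟨n, by omega⟩) (by intro h; rw [← h] at hn; simp at hn)]
      congr 1
      funext b
      rcases b with k | ⟨j', i'⟩
      · rw [Function.update_of_ne (by simp)]; rfl
      · by_cases hb : (Sum.inr (j', i') : Blk d) = .inr (j, ⟨n, by omega⟩)
        · rw [hb]; simp [setMat]
        · rw [Function.update_of_ne hb]
          simp only [setMat]
          split_ifs with h1 h2 h3 h3 <;> try rfl
          · exact absurd (by rw [h1, show i' = ⟨n, by omega⟩ from Fin.ext (by simp; omega)]) hb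
          · omega
  have key : ∀ n ≤ d, Computes (Program.loop P n) (fun m => setMat m j
      fun i => if (i : ℕ) < n then f m i else mat m j i) (n * c) := by
    intro n
    induction n with
    | zero =>
      intro _
      refine Computes.skip.congr (fun m => ?_) (by simp)
      funext b
      rcases b with k | ⟨j', i'⟩
      · rfl
      · simp only [setMat, not_lt_zero, if_false, mat]; split_ifs with h
        · rw [h]
        · rfl
    | succ n ih =>
      intro hn
      refine ((ih (by omega)).seq (h ⟨n, by omega⟩)).congr (fun m => ?_) (by rw [Nat.succ_mul])
      rw [hf' m (f m) ⟨n, by omega⟩ n le_rfl]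
      funext b
      rcases b with k | ⟨j', i'⟩
      · rw [Function.update_of_ne (by simp)]; rfl
      · by_cases hb : (Sum.inr (j', i') : Blk d) = .inr (j, ⟨n, by omega⟩)
        · rw [hb]; simp [setMat]
        · rw [Function.update_of_ne hb]
          simp only [setMat]
          split_ifs with h1 h2 h3 h3 <;> try rfl
          · omega
          · exact absurd (by rw [h1, show i' = ⟨n, by omega⟩ from Fin.ext (by simp; omega)]) hb
  exact (key d le_rfl).congr (fun m => by simp) le_rfl

end Computes

/-! ### Vector and matrix operations -/

section Ops

variable {d : ℕ}

/-- Arithmetic on entries of vector variables. -/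
def Program.entry (op : ArithOp) (b : Blk d) (i : ℕ) (a : Blk d) (j : ℕ) (a' : Blk d) (j' : ℕ) :
    Program := .arith op (b.addr + i) (a.addr + j) (a'.addr + j')

theorem computes_entry (op : ArithOp) (b : Blk d) (i : Fin d) (a : Blk d) (j : Fin d) (a' : Blk d)
    (j' : Fin d) : Computes (Program.entry op b i a j a' j')
      (fun m => setEntry m b i (op.eval (m a j) (m a' j'))) 1 :=
  ⟨trivial, fun _ _ _ => mem_update_cell _ _ _ _, fun _ _ _ => le_rfl⟩

/-- Store a constant in an entry of a vector variable. -/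
def Program.entryConst (b : Blk d) (i : ℕ) (q : ℝ) : Program := .const (b.addr + i) q

theorem computes_entryConst (b : Blk d) (i : Fin d) (q : ℝ) :
    Computes (Program.entryConst b i q) (fun m => setEntry m b i q) 1 :=
  ⟨trivial, fun _ _ _ => mem_update_cell _ _ _ _, fun _ _ _ => le_rfl⟩

/-- `b := 0`. -/
def Program.vzero (b : Blk d) : Program := .loop (fun i => .entryConst b i 0) d

theorem computes_vzero (b : Blk d) :
    Computes (Program.vzero b) (fun m => Function.update m b 0) d :=
  (Computes.loop_entries b (f := fun _ => 0) (c := 1) (fun i => computes_entryConst b i 0)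
    fun _ _ _ _ => rfl).congr (fun _ => rfl) (by simp)

/-- `b := a`. -/
def Program.vcopy (b a : Blk d) : Program :=
  .loop (fun i => .seq (.const (hid d 0) 0) (.arith .plus (b.addr + i) (a.addr + i) (hid d 0))) d

theorem computes_vcopy (b a : Blk d) :
    Computes (Program.vcopy b a) (fun m => Function.update m b (m a)) (d * 2) := by
  refine Computes.loop_entries b (f := fun m => m a) (fun i => ⟨⟨trivial, trivial⟩, fun _ _ σ => ?_,
    fun _ _ _ => le_rfl⟩) fun m i x hx => ?_
  · simp only [Program.exec]
    rw [mem_update_cell, mem_update_hid, update_hid_cell, Function.update_self]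
    simp [setEntry, ArithOp.eval, mem]
  · by_cases h : a = b
    · subst h; simpa using hx
    · rw [Function.update_of_ne h]

/-- `b := s a` for the entry `j` of the variable `s`. -/
def Program.vscale (b s : Blk d) (j : ℕ) (a : Blk d) : Program :=
  .loop (fun i => .entry .times b i s j a i) d

theorem computes_vscale {b s : Blk d} (h : s ≠ b) (j : Fin d) (a : Blk d) :
    Computes (Program.vscale b s j a) (fun m => Function.update m b (m s j • m a)) d := by
  refine (Computes.loop_entries b (f := fun m => m s j • m a)
    (fun i => computes_entry .times b i s j a i) fun m i x hx => ?_).congr (fun _ => rfl) (by simp)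
  by_cases h' : a = b
  · subst h'; simp [Function.update_of_ne h, hx]
  · simp [Function.update_of_ne h, Function.update_of_ne h']

/-- `b := a + s x` for the entry `j` of the variable `s`. -/
def Program.axpy (b a s : Blk d) (j : ℕ) (x : Blk d) : Program :=
  .loop (fun i => .seq (.arith .times (hid d 0) (s.addr + j) (x.addr + i))
    (.arith .plus (b.addr + i) (a.addr + i) (hid d 0))) d

theorem computes_axpy {b s : Blk d} (h : s ≠ b) (a : Blk d) (j : Fin d) (x : Blk d) :
    Computes (Program.axpy b a s j x) (fun m => Function.update m b (m a + m s j • m x)) (d * 2) :=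
      by
  refine Computes.loop_entries b (f := fun m => m a + m s j • m x)
    (fun i => ⟨⟨trivial, trivial⟩, fun _ _ σ => ?_, fun _ _ _ => le_rfl⟩) fun m i y hy => ?_
  · simp only [Program.exec]
    rw [mem_update_cell, mem_update_hid, update_hid_cell, Function.update_self]
    simp [setEntry, ArithOp.eval, mem]
  · have h1 : ∀ c, (Function.update m b y c) i = m c i := fun c => by
      by_cases h' : c = b
      · subst h'; simp [hy]
      · rw [Function.update_of_ne h']
    simp [Function.update_of_ne h, h1]

/-- `b_i := ⟨a, x⟩`. -/
def Program.dot (b : Blk d) (i : ℕ) (a x : Blk d) : Program :=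
  .seq (.const (hid d 1) 0) (.seq
    (.loop (fun j => .seq (.arith .times (hid d 0) (a.addr + j) (x.addr + j))
      (.arith .plus (hid d 1) (hid d 1) (hid d 0))) d)
    (.seq (.const (hid d 0) 0) (.arith .plus (b.addr + i) (hid d 1) (hid d 0))))

theorem hid_one_ne_zero (d : ℕ) : hid d 1 ≠ hid d 0 := fun h => by simpa using hid_injective h

theorem dot_loop (a x : Blk d) (grad : ℕ → Vec d → Vec d) (o : Vec d → Option (Vec d)) (σ : State d)
    (n : ℕ)
    (hn : n ≤ d) :
    let σ' := (Program.loop (fun j => .seq (.arith .times (hid d 0) (a.addr + j) (x.addr + j))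
      (.arith .plus (hid d 1) (hid d 1) (hid d 0))) n).exec grad o σ
    (mem σ'.reg : Mem d) = mem σ.reg ∧ σ'.reg (hid d 1) = σ.reg (hid d 1)
      + ∑ j : Fin d, (if (j : ℕ) < n then (mem σ.reg a j) * (mem σ.reg x j) else 0) ∧
      σ'.ops = σ.ops + 2 * n := by
  induction n with
  | zero => simp [Program.loop, Program.exec]
  | succ n ih =>
    obtain ⟨h1, h2, h3⟩ := ih (by omega)
    simp only [Program.loop, Program.exec] at h1 h2 h3 ⊢
    refine ⟨?_, ?_, by omega⟩
    · rw [mem_update_hid, mem_update_hid, h1]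
    · have e1 : ∀ b : Blk d, ((Program.loop (fun j => .seq (.arith .times (hid d 0) (a.addr + j)
      (x.addr + j))
        (.arith .plus (hid d 1) (hid d 1) (hid d 0))) n).exec grad o σ).reg (b.addr + n)
          = mem σ.reg b ⟨n, by omega⟩ := fun b => by rw [← h1]; rfl
      rw [Function.update_self, Function.update_self, Function.update_of_ne (hid_one_ne_zero d), h2,
        e1, e1]
      simp only [ArithOp.eval]
      rw [add_assoc]
      congr 1
      have e2 : ∀ j : Fin d, (if (j : ℕ) < n + 1 then (mem σ.reg a j) * (mem σ.reg x j) else 0)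
          = (if (j : ℕ) < n then (mem σ.reg a j) * (mem σ.reg x j) else 0)
            + (if j = ⟨n, by omega⟩ then (mem σ.reg a j) * (mem σ.reg x j) else 0) := fun j => by
        by_cases hj : j = ⟨n, by omega⟩
        · subst hj; simp
        · have : (j : ℕ) ≠ n := fun h => hj (Fin.ext h)
          rw [if_neg hj, add_zero]
          congr 1
          simp only [eq_iff_iff]
          omega
      simp_rw [e2, Finset.sum_add_distrib]
      simp

theorem Program.IsPure.loop {P : ℕ → Program} {n : ℕ} (h : ∀ i < n, (P i).IsPure) :
    (Program.loop P n).IsPure := by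
  induction n with
  | zero => trivial
  | succ n ih => exact ⟨ih fun i hi => h i (by omega), h n (by omega)⟩

theorem computes_dot (b : Blk d) (i : Fin d) (a x : Blk d) :
    Computes (Program.dot b i a x) (fun m => setEntry m b i (m a ⬝ᵥ m x)) (2 * d + 3) := by
  refine ⟨⟨trivial, Program.IsPure.loop fun _ _ => ⟨trivial, trivial⟩, trivial, trivial⟩,
    fun grad o σ => ?_, fun grad o σ => ?_⟩
  · unfold Program.dot
    rw [Program.exec, Program.exec, Program.exec, Program.exec]
    obtain ⟨h1, h2, -⟩ := dot_loop a x grad o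
      { σ with reg := Function.update σ.reg (hid d 1) 0, ops := σ.ops + 1 } d le_rfl
    simp only [Program.exec]
    rw [mem_update_cell, mem_update_hid, h1, mem_update_hid, Function.update_self,
      Function.update_of_ne (hid_one_ne_zero d), h2]
    simp [setEntry, ArithOp.eval, dotProduct, mem_update_hid]
  · unfold Program.dot
    rw [Program.exec, Program.exec, Program.exec, Program.exec]
    obtain ⟨-, -, h3⟩ := dot_loop a x grad o
      { σ with reg := Function.update σ.reg (hid d 1) 0, ops := σ.ops + 1 } d le_rfl
    simp only [Program.exec] at h3 ⊢
    omega

/-- `y := A x` for the matrix variable `j`. -/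
def Program.matvec (d : ℕ) (y : Fin 64) (j : Fin 3) (x : Fin 64) : Program :=
  .loop (fun i => if h : i < d then .dot (.inl y : Blk d) i (.inr (j, ⟨i, h⟩)) (.inl x) else .skip)
    d

theorem computes_matvec {y x : Fin 64} (h : x ≠ y) (j : Fin 3) :
    Computes (Program.matvec d y j x)
      (fun m : Mem d => Function.update m (.inl y) (mat m j *ᵥ m (.inl x))) (d * (2 * d + 3)) := by
  refine Computes.loop_entries (.inl y) (f := fun m => mat m j *ᵥ m (.inl x)) (fun i => ?_)
    fun m i z hz => ?_
  · rw [dif_pos i.2]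
    exact computes_dot _ _ _ _
  · simp [h, Matrix.mulVec]

/-- `y := xᵀ A` for the matrix variable `j`. -/
def Program.vecmat (d : ℕ) (y : Fin 64) (j : Fin 3) (x : Fin 64) : Program :=
  .seq (.vzero (.inl y : Blk d)) (.loop (fun i => if h : i < d then
    .axpy (.inl y : Blk d) (.inl y) (.inl x) i (.inr (j, ⟨i, h⟩)) else .skip) d)

/-- Matrices are stored by rows, so `xᵀA` is accumulated as a linear combination of rows, without
access to columns. -/
theorem computes_vecmat {y x : Fin 64} (h : x ≠ y) (j : Fin 3) :
    Computes (Program.vecmat d y j x)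
      (fun m : Mem d => Function.update m (.inl y) (m (.inl x) ᵥ* mat m j)) (d + d * (d * 2)) := by
  have key : ∀ n ≤ d, Computes (.loop (fun i => if h : i < d then
      .axpy (.inl y : Blk d) (.inl y) (.inl x) i (.inr (j, ⟨i, h⟩)) else .skip) n)
      (fun m : Mem d => Function.update m (.inl y) (m (.inl y) + ∑ i : Fin d,
        if (i : ℕ) < n then m (.inl x) i • mat m j i else 0)) (n * (d * 2)) := by
    intro n
    induction n with
    | zero => intro _; exact Computes.skip.congr (fun m => by simp) (by simp)
    | succ n ih =>
      intro hn
      have hax := computes_axpy (b := (.inl y : Blk d)) (s := .inl x) (by simpa using h) (.inl y)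
        ⟨n, by omega⟩ (.inr (j, ⟨n, by omega⟩))
      refine ((ih (by omega)).seq (F := fun m : Mem d => Function.update m (.inl y) (m (.inl y) + ∑
        i : Fin d,
        if (i : ℕ) < n then m (.inl x) i • mat m j i else 0)) (c' := d * 2) (Q := if h : n < d then
      .axpy (.inl y : Blk d) (.inl y) (.inl x) n (.inr (j, ⟨n, h⟩)) else .skip)
        (by rw [dif_pos (by omega : n < d)]; exact hax)).congr (fun m => ?_) (by rw [Nat.succ_mul])
      rw [Function.update_idem]
      congr 1
      have e2 : ∀ i : Fin d, (if (i : ℕ) < n + 1 then m (.inl x) i • mat m j i else 0)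
          = (if (i : ℕ) < n then m (.inl x) i • mat m j i else 0)
            + (if i = ⟨n, by omega⟩ then m (.inl x) i • mat m j i else 0) := fun i => by
        by_cases hi : i = ⟨n, by omega⟩
        · subst hi; simp
        · have : (i : ℕ) ≠ n := fun h => hi (Fin.ext h)
          rw [if_neg hi, add_zero]
          congr 1
          simp only [eq_iff_iff]
          omega
      simp_rw [e2, Finset.sum_add_distrib]
      simp [h, mat, add_assoc]
  refine ((computes_vzero (.inl y)).seq (key d le_rfl)).congr (fun m => ?_) le_rfl
  rw [Function.update_idem]
  congr 1
  funext k
  simp [h, Matrix.vecMul, dotProduct]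

/-- `A := A + s xᵀ` for the matrix variable `j`. -/
def Program.rankOne (d : ℕ) (j : Fin 3) (s x : Fin 64) : Program :=
  .loop (fun i => if h : i < d then
    .axpy (.inr (j, ⟨i, h⟩) : Blk d) (.inr (j, ⟨i, h⟩)) (.inl s) i (.inl x) else .skip) d

theorem computes_rankOne (j : Fin 3) (s x : Fin 64) :
    Computes (Program.rankOne d j s x)
      (fun m : Mem d => setMat m j (mat m j + Matrix.vecMulVec (m (.inl s)) (m (.inl x)))) (d * (d *
        2)) := by
  refine Computes.loop_rows j (f := fun m => mat m j + Matrix.vecMulVec (m (.inl s)) (m (.inl x)))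
    (fun i => ?_) fun m i i' z hi => ?_
  · rw [dif_pos i.2]
    exact (computes_axpy (by simp) _ i _).congr (fun m => rfl) le_rfl
  · funext k
    simp [mat, Matrix.vecMulVec_apply, Function.update_of_ne, hi.symm]

end Ops

/-! ### Rank-one updates of inverse matrices -/

/-- Sherman–Morrison. The denominator is nonzero because, by the matrix determinant lemma, it is the
quotient of the two determinants. -/
theorem inv_add_vecMulVec {n : Type*} [Fintype n] [DecidableEq n] {X : Matrix n n ℝ} {u v : n → ℝ}
    (hX : IsUnit X.det) (h : IsUnit (X + Matrix.vecMulVec u v).det) :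
    X⁻¹ + Matrix.vecMulVec ((-1 / (1 + v ⬝ᵥ (X⁻¹ *ᵥ u))) • (X⁻¹ *ᵥ u)) (v ᵥ* X⁻¹)
      = (X + Matrix.vecMulVec u v)⁻¹ := by
  rw [det_add_vecMulVec hX] at h
  have hc : 1 + v ⬝ᵥ (X⁻¹ *ᵥ u) ≠ 0 := (isUnit_of_mul_isUnit_right h).ne_zero
  symm
  apply Matrix.inv_eq_right_inv
  set c := v ⬝ᵥ (X⁻¹ *ᵥ u) with hcdef
  rw [Matrix.add_mul, Matrix.mul_add, Matrix.mul_add, Matrix.mul_nonsing_inv _ hX,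
    Matrix.vecMulVec_mul, Matrix.mul_vecMulVec, Matrix.vecMulVec_mul_vecMulVec, Matrix.mulVec_smul,
    Matrix.mulVec_mulVec, Matrix.mul_nonsing_inv _ hX, Matrix.one_mulVec, dotProduct_smul,
    ← hcdef, Matrix.smul_vecMulVec]
  ext i j
  simp only [Matrix.add_apply, Matrix.smul_apply, Matrix.vecMulVec_apply, smul_eq_mul,
    Pi.smul_apply,
    Matrix.one_apply]
  field_simp
  ring

/-- Rows below `n` of the matrix `M` added to a positive multiple of the identity give a
nonsingular matrix if `M` is positive semidefinite. -/
theorem isUnit_det_partial {d : ℕ} {M : Matrix (Fin d) (Fin d) ℝ} (hM : M.PosSemidef) {a : ℝ}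
    (ha : 0 < a) (n : ℕ) :
    IsUnit (a • (1 : Matrix (Fin d) (Fin d) ℝ)
      + Matrix.of fun (i : Fin d) j => if (i : ℕ) < n then M i j else 0).det := by
  rw [isUnit_iff_ne_zero]
  intro h
  obtain ⟨x, hx0, hx⟩ := Matrix.exists_mulVec_eq_zero_iff.2 h
  have e : ∀ i : Fin d, a * x i + (if (i : ℕ) < n then (M *ᵥ x) i else 0) = 0 := by
    intro i
    have := congrFun hx i
    rw [Matrix.add_mulVec, Matrix.smul_mulVec, Matrix.one_mulVec] at this
    simp only [Pi.add_apply, Pi.smul_apply, smul_eq_mul, Matrix.mulVec, dotProduct,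
      Matrix.of_apply, Pi.zero_apply] at this
    refine Eq.trans ?_ this
    congr 1
    split_ifs
    · rfl
    · simp only [zero_mul, Finset.sum_const_zero]
  have h1 := hM.dotProduct_mulVec_nonneg x
  rw [star_trivial] at h1
  -- A kernel vector vanishes in the rows from `n` on, so truncating the rows of `M` does not affect
  -- this product; positivity of `M` then contradicts `x ≠ 0`.
  have h2 : x ⬝ᵥ (M *ᵥ x) = -(a * (x ⬝ᵥ x)) := by
    simp only [dotProduct, Finset.mul_sum, ← Finset.sum_neg_distrib]
    refine Finset.sum_congr rfl fun i _ => ?_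
    have := e i
    split_ifs at this with hi
    · linear_combination x i * this
    · have : x i = 0 := by simpa [ha.ne'] using this
      simp [this]
  have h3 : 0 < x ⬝ᵥ x := by
    have := Matrix.dotProduct_star_self_pos_iff.2 hx0
    rwa [star_trivial] at this
  nlinarith

/-! ### Operations on named variables -/

section Named

variable {d : ℕ} [NeZero d]

/-- The program transforms the vector variables according to the relation `R`. -/
def Realizes (P : Program) (c : ℕ) (R : Mem d → Mem d → Prop) : Prop :=
  ∃ F, Computes P F c ∧ ∀ m, R m (F m)

/-- Scalar operation. -/
def Program.sop (d : ℕ) (op : ArithOp) (k a b : Fin 64) : Program :=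
  .entry op (.inl k : Blk d) 0 (.inl a) 0 (.inl b) 0

theorem computes_sop (op : ArithOp) (k a b : Fin 64) : Computes (Program.sop d op k a b)
    (fun m : Mem d => setEntry m (.inl k) 0 (op.eval (m (.inl a) 0) (m (.inl b) 0))) 1 := by
  simpa [Program.sop] using computes_entry op (.inl k) (0 : Fin d) (.inl a) (0 : Fin d) (.inl b) (0
    : Fin d)

/-- Scalar constant. -/
def Program.sconst (d : ℕ) (k : Fin 64) (q : ℝ) : Program :=
  .entryConst (.inl k : Blk d) 0 q

theorem computes_sconst (k : Fin 64) (q : ℝ) : Computes (Program.sconst d k q)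
    (fun m : Mem d => setEntry m (.inl k) 0 q) 1 := by
  simpa [Program.sconst] using computes_entryConst (.inl k) (0 : Fin d) q

/-- Inner product. -/
def Program.sdot (d : ℕ) (k a b : Fin 64) : Program :=
  .dot (.inl k : Blk d) 0 (.inl a) (.inl b)

theorem computes_sdot (k a b : Fin 64) : Computes (Program.sdot d k a b)
    (fun m : Mem d => setEntry m (.inl k) 0 (m (.inl a) ⬝ᵥ m (.inl b))) (2 * d + 3) := by
  simpa [Program.sdot] using computes_dot (.inl k) (0 : Fin d) (.inl a) (.inl b)

/-- Multiplication of a vector by a scalar. -/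
def Program.vscl (d : ℕ) (k s a : Fin 64) : Program := .vscale (.inl k : Blk d) (.inl s) 0 (.inl a)

theorem computes_vscl {k s : Fin 64} (h : s ≠ k) (a : Fin 64) : Computes (Program.vscl d k s a)
    (fun m : Mem d => Function.update m (.inl k) (m (.inl s) 0 • m (.inl a))) d := by
  simpa [Program.vscl] using computes_vscale (b := .inl k) (s := .inl s) (by simpa using h) (0 : Fin
    d) (.inl a)

/-- Addition of a multiple of a vector. -/
def Program.vadd (d : ℕ) (k a s b : Fin 64) : Program :=
  .axpy (.inl k : Blk d) (.inl a) (.inl s) 0 (.inl b)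

theorem computes_vadd {k s : Fin 64} (h : s ≠ k) (a b : Fin 64) : Computes (Program.vadd d k a s b)
    (fun m : Mem d => Function.update m (.inl k) (m (.inl a) + m (.inl s) 0 • m (.inl b)))
      (d * 2) := by
  simpa [Program.vadd] using computes_axpy (b := .inl k) (s := .inl s) (by simpa using h) (.inl a)
    (0 : Fin d)
    (.inl b)

/-- Copy a matrix. -/
def Program.mcopy (d : ℕ) (j j' : Fin 3) : Program :=
  .loop (fun i => if h : i < d then .vcopy (.inr (j, ⟨i, h⟩) : Blk d) (.inr (j', ⟨i, h⟩))
    else .skip) d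

omit [NeZero d] in
theorem computes_mcopy {j j' : Fin 3} (h : j' ≠ j) : Computes (Program.mcopy d j j')
    (fun m : Mem d => setMat m j (mat m j')) (d * (d * 2)) := by
  refine Computes.loop_rows j (f := fun m => mat m j') (fun i => ?_) fun m i i' x hi => ?_
  · rw [dif_pos i.2]
    exact computes_vcopy _ _
  · simp [mat, Function.update_of_ne, h]

/-- Multiple of the identity matrix. -/
def Program.mdiag (d : ℕ) (j : Fin 3) (s : Fin 64) : Program :=
  .loop (fun i => if h : i < d then .seq (.vzero (.inr (j, ⟨i, h⟩) : Blk d))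
    (.entry .plus (.inr (j, ⟨i, h⟩) : Blk d) i (.inr (j, ⟨i, h⟩)) i (.inl s) 0)
    else .skip) d

theorem computes_mdiag (j : Fin 3) (s : Fin 64) : Computes (Program.mdiag d j s)
    (fun m : Mem d => setMat m j (m (.inl s) 0 • 1)) (d * (d + 1)) := by
  refine Computes.loop_rows j (f := fun m => m (.inl s) 0 • 1) (fun i => ?_) fun m i i' x hi => ?_
  · rw [dif_pos i.2]
    refine ((computes_vzero (.inr (j, i))).seq (by
      simpa using computes_entry .plus (.inr (j, i)) i (.inr (j, i)) i (.inl s) (0 : Fin d))).congr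
        (fun m => ?_) le_rfl
    unfold setEntry
    rw [Function.update_idem]
    congr 1
    funext k
    by_cases hk : k = i
    · subst hk; simp [ArithOp.eval]
    · simp [hk, Ne.symm hk]
  · simp

/-- Update the inverse in the matrix variable `j` after the addition of a rank-one matrix. -/
def Program.rankOneInv (d : ℕ) (j : Fin 3) (a b : Fin 64) : Program :=
  .seq (.matvec d 40 j a) <| .seq (.vecmat d 41 j b) <| .seq (.sdot d 42 b 40) <|
  .seq (.sconst d 43 1) <| .seq (.sop d .plus 42 43 42) <| .seq (.sconst d 43 (-1)) <|
  .seq (.sop d .divide 42 43 42) <| .seq (.vscl d 40 42 40) <| .rankOne d j 40 41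

/-- One Sherman–Morrison update uses two products and an outer product, hence order `d²`. Variables
`40` to `43` are scratch space, whence the conditions on `a` and `b`. -/
theorem realizes_rankOneInv (j : Fin 3) {a b : Fin 64} (ha : a < 40) (hb : b < 40) :
    Realizes (d := d) (Program.rankOneInv d j a b) (20 * d ^ 2) fun m m' =>
      (∀ X : Matrix (Fin d) (Fin d) ℝ, mat m j = X⁻¹ → IsUnit X.det →
        IsUnit (X + Matrix.vecMulVec (m (.inl a)) (m (.inl b))).det →
        mat m' j = (X + Matrix.vecMulVec (m (.inl a)) (m (.inl b)))⁻¹) ∧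
      (∀ j', j' ≠ j → mat m' j' = mat m j') ∧
      ∀ k, (k < 40 ∨ 43 < k) → m' (.inl k) = m (.inl k) := by
  have ha' : a ≠ 40 ∧ a ≠ 41 := by omega
  have hb' : b ≠ 40 ∧ b ≠ 41 := by omega
  refine ⟨_, ((computes_matvec ha'.1 j).seq <| (computes_vecmat hb'.2 j).seq <|
    (computes_sdot 42 b 40).seq <| (computes_sconst 43 1).seq <| (computes_sop .plus 42 43
      42).seq <|
    (computes_sconst 43 (-1)).seq <| (computes_sop .divide 42 43 42).seq <|
    (computes_vscl (by decide) 40).seq <| computes_rankOne j 40 41).congr (fun m => rfl) ?_,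
      fun m => ⟨fun X hX h1 h2 => ?_, fun j' hj => ?_, fun k hk => ?_⟩⟩
  · have : 1 ≤ d := NeZero.one_le
    nlinarith
  · rw [← inv_add_vecMulVec h1 h2, ← hX]
    simp [ArithOp.eval, hb']
  · simp [hj]
  · have hk' : k ≠ 40 ∧ k ≠ 41 ∧ k ≠ 42 ∧ k ≠ 43 := by omega
    simp [hk']

end Named

/-! ### The quasi-Newton update as a program -/

section Update

variable {d : ℕ} [NeZero d]

omit [NeZero d] in
theorem Realizes.seq {P Q : Program} {c c' : ℕ} {R S : Mem d → Mem d → Prop} (hP : Realizes P c R)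
    (hQ : Realizes Q c' S) : Realizes (.seq P Q) (c + c') fun m m'' => ∃ m', R m m' ∧ S m' m'' := by
  obtain ⟨F, hF, hR⟩ := hP
  obtain ⟨F', hF', hS⟩ := hQ
  exact ⟨_, hF.seq hF', fun m => ⟨F m, hR m, hS _⟩⟩

omit [NeZero d] in
theorem Realizes.mono {P : Program} {c c' : ℕ} {R S : Mem d → Mem d → Prop} (hP : Realizes P c R)
    (h : ∀ m m', R m m' → S m m') (hc : c ≤ c') : Realizes P c' S := by
  obtain ⟨F, hF, hR⟩ := hP
  exact ⟨F, hF.congr (fun _ => rfl) hc, fun m => h _ _ (hR m)⟩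

omit [NeZero d] in
theorem Computes.realizes {P : Program} {F : Mem d → Mem d} {c : ℕ} (h : Computes P F c) :
    Realizes P c fun m m' => m' = F m := ⟨F, h, fun _ => rfl⟩

omit [NeZero d] in
theorem Realizes.loop {P : ℕ → Program} {c n : ℕ} {R : ℕ → Mem d → Mem d → Prop}
    (h : ∀ i < n, Realizes (P i) c (R i)) {I : ℕ → Mem d → Mem d → Prop} (h0 : ∀ m, I 0 m m)
    (hI : ∀ i < n, ∀ m m' m'', I i m m' → R i m' m'' → I (i + 1) m m'') :
    Realizes (Program.loop P n) (n * c) (I n) := by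
  induction n with
  | zero => exact (Computes.skip.realizes).mono (fun m m' h => by rw [h]; exact h0 m) (by simp)
  | succ n ih =>
    exact ((ih (fun i hi => h i (by omega)) fun i hi => hI i (by omega)).seq (h n (by omega))).mono
      (fun m m'' ⟨m', h1, h2⟩ => hI n (by omega) _ _ _ h1 h2) (by rw [Nat.succ_mul])

/-- The coefficient of the identity in the regularized Gram matrix with landmark `v`. -/
def lamOf (d : ℕ) (B η : ℝ) (v : Fin d → ℝ) : ℝ :=
  2 * η * d / (1 - v ⬝ᵥ v) + (d + η * B ^ 2)

/-- One step of the recomputation of the inverse of the regularized Gram matrix. -/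
def Program.reinitRow (d j : ℕ) : Program :=
  if h : j < d then .seq (.seq (.vzero (.inl 38 : Blk d)) <|
    .seq (.entryConst (.inl 38 : Blk d) j 1) <| .vcopy (.inl 39 : Blk d) (.inr (0, ⟨j, h⟩))) <|
    .rankOneInv d 1 38 39 else .skip

/-- The inverse of the regularized Gram matrix is recomputed for the current landmark. -/
def Program.reinit (d : ℕ) (B η : ℝ) : Program :=
  .seq (.seq (.sdot d 50 2 2) <| .seq (.sconst d 51 1) <| .seq (.sop d .minus 50 51 50) <|
    .seq (.sconst d 52 (2 * η * d)) <| .seq (.sop d .divide 50 52 50) <|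
    .seq (.sconst d 51 (d + η * B ^ 2)) <| .seq (.sop d .plus 44 50 51) <| .seq (.sconst d 50 1) <|
    .seq (.sop d .divide 44 50 44) <| .mdiag d 1 44)
  (.loop (Program.reinitRow d) d)

theorem realizes_reinitRow (j : Fin d) : Realizes (d := d) (Program.reinitRow d j) (30 * d ^ 2)
    fun m m' => (∀ X : Matrix (Fin d) (Fin d) ℝ, mat m 1 = X⁻¹ → IsUnit X.det →
      IsUnit (X + Matrix.vecMulVec (Pi.single j 1) (mat m 0 j)).det →
      mat m' 1 = (X + Matrix.vecMulVec (Pi.single j 1) (mat m 0 j))⁻¹) ∧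
      mat m' 0 = mat m 0 ∧ ∀ k < 38, m' (.inl k) = m (.inl k) := by
  unfold Program.reinitRow
  rw [dif_pos j.2]
  refine (((computes_vzero (.inl 38)).seq <| (computes_entryConst (.inl 38) j 1).seq <|
    computes_vcopy (.inl 39) (.inr (0, j))).realizes.seq
      (realizes_rankOneInv 1 (a := 38) (b := 39) (by decide) (by decide))).mono ?_ ?_
  · rintro m m'' ⟨m', rfl, h1, h2, h3⟩
    refine ⟨fun X hX hu hu' => ?_, ?_, fun k hk => ?_⟩
    · have := h1 X (by simpa using hX) hu
      simp only [setEntry, update_inl, Function.update_self, Function.update_idem, reduceCtorEq,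
        not_false_eq_true, Function.update_of_ne, ne_eq] at this
      exact this hu'
    · rw [h2 0 (by decide)]; simp
    · rw [h3 k (by omega)]
      have : k ≠ 38 ∧ k ≠ 39 := by omega
      simp [this]
  · have : 1 ≤ d := NeZero.one_le
    nlinarith

/-- The inverse is built by inserting the rows of the Gram matrix one at a time as rank-one changes
to a multiple of the identity. The intermediate matrices are not symmetric, but `isUnit_det_partial`
makes every update legitimate without pivoting. -/
theorem realizes_reinit (B η : ℝ) : Realizes (d := d) (Program.reinit d B η) (60 * d ^ 3) fun m
    m' =>
    ((mat m 0).PosSemidef → 0 < lamOf d B η (m (.inl 2)) →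
      mat m' 1 = (lamOf d B η (m (.inl 2)) • (1 : Matrix (Fin d) (Fin d) ℝ) + mat m 0)⁻¹) ∧
      mat m' 0 = mat m 0 ∧ ∀ k < 38, m' (.inl k) = m (.inl k) := by
  have hd : 1 ≤ d := NeZero.one_le
  have hloop := Realizes.loop (d := d) (P := Program.reinitRow d) (n := d) (c := 30 * d ^ 2)
    (R := fun j m m' => ∃ h : j < d, (∀ X : Matrix (Fin d) (Fin d) ℝ, mat m 1 = X⁻¹ → IsUnit X.det →
      IsUnit (X + Matrix.vecMulVec (Pi.single (⟨j, h⟩ : Fin d) 1) (mat m 0 ⟨j, h⟩)).det →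
      mat m' 1 = (X + Matrix.vecMulVec (Pi.single (⟨j, h⟩ : Fin d) 1) (mat m 0 ⟨j, h⟩))⁻¹) ∧
      mat m' 0 = mat m 0 ∧ ∀ k < 38, m' (.inl k) = m (.inl k))
    (fun j hj => (realizes_reinitRow (d := d) (Fin.mk j hj)).mono (fun m m' h => Exists.intro hj h)
      le_rfl)
    (I := fun n m m' => (∀ a : ℝ, 0 < a → (mat m 0).PosSemidef → mat m 1 = (a • 1)⁻¹ →
      mat m' 1 = (a • (1 : Matrix (Fin d) (Fin d) ℝ)
        + Matrix.of fun (i : Fin d) j => if (i : ℕ) < n then mat m 0 i j else 0)⁻¹) ∧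
      mat m' 0 = mat m 0 ∧ ∀ k < 38, m' (.inl k) = m (.inl k))
    (by
      intro m
      refine ⟨fun a _ _ h => ?_, rfl, fun _ _ => rfl⟩
      rw [h]; congr 1; ext i j; simp)
    (by
      rintro j hj m m' m'' ⟨h1, h2, h3⟩ ⟨_, k1, k2, k3⟩
      refine ⟨fun a ha hM h => ?_, k2.trans h2, fun k hk => (k3 k hk).trans (h3 k hk)⟩
      have e : (a • (1 : Matrix (Fin d) (Fin d) ℝ)
          + Matrix.of fun (i : Fin d) j' => if (i : ℕ) < j then mat m 0 i j' else 0)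
          + Matrix.vecMulVec (Pi.single ⟨j, hj⟩ 1) (mat m' 0 ⟨j, hj⟩)
          = a • (1 : Matrix (Fin d) (Fin d) ℝ)
          + Matrix.of fun (i : Fin d) j' => if (i : ℕ) < j + 1 then mat m 0 i j' else 0 := by
        rw [add_assoc]
        congr 1
        ext i j'
        simp only [Matrix.add_apply, Matrix.of_apply, Matrix.vecMulVec_apply, h2, Pi.single_apply]
        by_cases hi : i = ⟨j, hj⟩
        · subst hi; simp
        · have : (i : ℕ) ≠ j := fun h => hi (Fin.ext h)
          simp only [hi, if_false, zero_mul, add_zero]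
          congr 1
          simp only [eq_iff_iff]
          omega
      have := k1 _ (h1 a ha hM h) (isUnit_det_partial hM ha j)
      rw [e] at this
      exact this (isUnit_det_partial hM ha (j + 1)))
  refine (((computes_sdot (d := d) 50 2 2).seq <| (computes_sconst 51 1).seq <|
    (computes_sop .minus 50 51 50).seq <| (computes_sconst 52 (2 * η * d)).seq <|
    (computes_sop .divide 50 52 50).seq <| (computes_sconst 51 (d + η * B ^ 2)).seq <|
    (computes_sop .plus 44 50 51).seq <| (computes_sconst 50 1).seq <|
    (computes_sop .divide 44 50 44).seq <| computes_mdiag 1 44).realizes.seq hloop).mono ?_ ?_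
  · rintro m m'' ⟨m', rfl, h1, h2, h3⟩
    refine ⟨fun hM hl => ?_, ?_, fun k hk => ?_⟩
    · rw [h1 (lamOf d B η (m (.inl 2))) hl (by simpa using hM) ?_]
      · congr 2; ext i j; simp
      · have e : (lamOf d B η (m (.inl 2)) • (1 : Matrix (Fin d) (Fin d) ℝ))⁻¹
            = (lamOf d B η (m (.inl 2)))⁻¹ • 1 := Matrix.inv_eq_right_inv (by
              simp [smul_smul, hl.ne'])
        rw [e]
        simp [ArithOp.eval, lamOf]
    · rw [h2]; simp
    · rw [h3 k hk]
      have : k ≠ 44 ∧ k ≠ 50 ∧ k ≠ 51 ∧ k ≠ 52 := by omega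
      simp [this]
  · have : d ≤ d ^ 3 := Nat.le_self_pow (by norm_num) d
    have : d ^ 2 ≤ d ^ 3 := Nat.pow_le_pow_right hd (by norm_num)
    have : 1 ≤ d ^ 3 := Nat.one_le_pow _ _ hd
    ring_nf
    omega

/-- Absorb the vector in variable `4` into the Gram matrix, its inverse and the linear term. -/
def Program.absorb (d : ℕ) (β : ℝ) : Program :=
  .seq (.seq (.sconst d 50 β) <| .seq (.vscl d 37 50 4) <| .seq (.rankOne d 0 37 4) <|
    .seq (.sdot d 51 4 1) <| .seq (.sconst d 50 (-β)) <| .seq (.sop d .times 51 50 51) <|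
    .seq (.sconst d 50 1) <| .seq (.sop d .plus 51 50 51) <| .vadd d 3 3 51 4)
  (.rankOneInv d 1 37 4)

/-- The gradient of the new quadratic is `β ⟨g, x - w⟩ g`; its constant part joins `g`, which
produces the coefficient `1 - β ⟨g, w⟩`. -/
theorem realizes_absorb (β : ℝ) : Realizes (d := d) (Program.absorb d β) (40 * d ^ 2) fun m m' =>
    mat m' 0 = mat m 0 + β • Matrix.vecMulVec (m (.inl 4)) (m (.inl 4)) ∧
    (∀ X : Matrix (Fin d) (Fin d) ℝ, mat m 1 = X⁻¹ → IsUnit X.det →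
      IsUnit (X + β • Matrix.vecMulVec (m (.inl 4)) (m (.inl 4))).det →
      mat m' 1 = (X + β • Matrix.vecMulVec (m (.inl 4)) (m (.inl 4)))⁻¹) ∧
    m' (.inl 3) = m (.inl 3) + (1 - β * (m (.inl 4) ⬝ᵥ m (.inl 1))) • m (.inl 4) ∧
    ∀ k < 37, k ≠ 3 → m' (.inl k) = m (.inl k) := by
  refine (((computes_sconst (d := d) 50 β).seq <| (computes_vscl (by decide) 4).seq <|
    (computes_rankOne 0 37 4).seq <| (computes_sdot 51 4 1).seq <| (computes_sconst 50 (-β)).seq <|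
    (computes_sop .times 51 50 51).seq <| (computes_sconst 50 1).seq <|
    (computes_sop .plus 51 50 51).seq <| computes_vadd (k := 3) (s := 51) (by decide) 3
      4).realizes.seq
    (realizes_rankOneInv 1 (a := 37) (b := 4) (by decide) (by decide))).mono ?_ ?_
  · rintro m m'' ⟨m', rfl, h1, h2, h3⟩
    refine ⟨?_, fun X hX hu hu' => ?_, ?_, fun k hk hk3 => ?_⟩
    · rw [h2 0 (by decide)]; simp [Matrix.smul_vecMulVec]
    · have := h1 X (by simpa using hX) hu
      simp only [setEntry_inl, update_inl, setMat_inl] at this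
      rw [← Matrix.smul_vecMulVec] at hu' ⊢
      simpa using this (by simpa using hu')
    · rw [h3 3 (by decide)]; simp [ArithOp.eval, sub_eq_add_neg]
    · rw [h3 k (by omega)]
      have : k ≠ 37 ∧ k ≠ 50 ∧ k ≠ 51 := by omega
      simp [this, hk3]
  · have : 1 ≤ d := NeZero.one_le
    nlinarith

end Update

/-! ### Computation of the truncated Newton step -/

section Newton

variable {d : ℕ} [NeZero d]

/-- Gradient of the potential at the current iterate, in variable `55`. -/
def Program.gradient (d : ℕ) (B η : ℝ) : Program :=
  .seq (.seq (.sdot d 50 1 1) <| .seq (.sconst d 51 1) <| .seq (.sop d .minus 50 51 50) <|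
    .seq (.sconst d 52 (2 * η * d)) (.sop d .divide 53 52 50))
  (.seq (.sconst d 54 (d + η * B ^ 2)) <| .seq (.sop d .plus 54 53 54) <| .seq (.matvec d 55 0 1) <|
    .seq (.vadd d 55 55 54 1) (.vadd d 55 55 51 3))

theorem realizes_gradient (B η : ℝ) : Realizes (d := d) (Program.gradient d B η) (30 * d ^ 2)
    fun m m' => m' (.inl 50) 0 = 1 - m (.inl 1) ⬝ᵥ m (.inl 1) ∧ m' (.inl 51) 0 = 1 ∧
      m' (.inl 52) 0 = 2 * η * d ∧
      m' (.inl 53) 0 = 2 * η * d / (1 - m (.inl 1) ⬝ᵥ m (.inl 1)) ∧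
      m' (.inl 55) = mat m 0 *ᵥ m (.inl 1) + lamOf d B η (m (.inl 1)) • m (.inl 1) + m (.inl 3) ∧
      (∀ j, mat m' j = mat m j) ∧ ∀ k < 50, m' (.inl k) = m (.inl k) := by
  refine (((computes_sdot (d := d) 50 1 1).seq <| (computes_sconst 51 1).seq <|
    (computes_sop .minus 50 51 50).seq <| (computes_sconst 52 (2 * η * d)).seq <|
    computes_sop .divide 53 52 50).realizes.seq
    ((computes_sconst 54 (d + η * B ^ 2)).seq <| (computes_sop .plus 54 53 54).seq <|
    (computes_matvec (y := 55) (x := 1) (by decide) 0).seq <|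
    (computes_vadd (k := 55) (s := 54) (by decide) 55 1).seq <|
    computes_vadd (k := 55) (s := 51) (by decide) 55 3).realizes).mono ?_ ?_
  · rintro m m'' ⟨m', rfl, rfl⟩
    refine ⟨?_, ?_, ?_, ?_, ?_, fun j => ?_, fun k hk => ?_⟩
    · simp [ArithOp.eval]
    · simp
    · simp
    · simp [ArithOp.eval]
    · simp [ArithOp.eval, lamOf]
    · simp
    · have : k ≠ 50 ∧ k ≠ 51 ∧ k ≠ 52 ∧ k ≠ 53 ∧ k ≠ 54 ∧ k ≠ 55 := by omega
      simp [this]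
  · have : 1 ≤ d := NeZero.one_le
    nlinarith

/-- Inverse of the approximate Hessian, in the matrix variable `2`. -/
def Program.hessInv (d : ℕ) (η : ℝ) : Program :=
  .seq (.seq (.mcopy d 2 1) <| .seq (.sconst d 58 (4 * η * d)) <| .seq (.sop d .divide 58 58 50) <|
    .seq (.sop d .divide 58 58 50) (.vscl d 36 58 1)) (.rankOneInv d 2 36 1)

theorem realizes_hessInv (η : ℝ) : Realizes (d := d) (Program.hessInv d η) (30 * d ^ 2)
    fun m m' => (∀ X : Matrix (Fin d) (Fin d) ℝ, mat m 1 = X⁻¹ → IsUnit X.det →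
      IsUnit (X + (4 * η * d / m (.inl 50) 0 ^ 2) • Matrix.vecMulVec (m (.inl 1)) (m (.inl 1))).det
        →
      mat m' 2 = (X + (4 * η * d / m (.inl 50) 0 ^ 2) •
        Matrix.vecMulVec (m (.inl 1)) (m (.inl 1)))⁻¹) ∧
      mat m' 0 = mat m 0 ∧ mat m' 1 = mat m 1 ∧
      ∀ k, (k < 36 ∨ (43 < k ∧ k ≠ 58)) → m' (.inl k) = m (.inl k) := by
  refine (((computes_mcopy (d := d) (j := 2) (j' := 1) (by decide)).seq <|
    (computes_sconst 58 (4 * η * d)).seq <| (computes_sop .divide 58 58 50).seq <|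
    (computes_sop .divide 58 58 50).seq <|
    computes_vscl (k := 36) (s := 58) (by decide) 1).realizes.seq
    (realizes_rankOneInv 2 (a := 36) (b := 1) (by decide) (by decide))).mono ?_ ?_
  · rintro m m'' ⟨m', rfl, h1, h2, h3⟩
    refine ⟨fun X hX hu hu' => ?_, ?_, ?_, fun k hk => ?_⟩
    · have := h1 X (by simpa using hX) hu
      rw [← Matrix.smul_vecMulVec, sq, ← div_div] at hu' ⊢
      simpa [ArithOp.eval] using this (by simpa [ArithOp.eval] using hu')
    · rw [h2 0 (by decide)]; simp
    · rw [h2 1 (by decide)]; simp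
    · have : k ≠ 36 ∧ k ≠ 58 := by omega
      rw [h3 k (by omega)]
      simp [this]
  · have : 1 ≤ d := NeZero.one_le
    nlinarith

/-- Taylor approximation of the Newton direction, in variable `62`. -/
def Program.taylor (d n : ℕ) : Program :=
  .seq (.seq (.sdot d 59 2 2) <| .seq (.sop d .minus 59 51 59) <| .seq (.sop d .divide 60 52 59) <|
    .seq (.sop d .minus 60 60 53) <| .seq (.matvec d 61 2 55)
      (.vcopy (.inl 62 : Blk d) (.inl 61)))
  (.loop (fun _ => .seq (.matvec d 63 2 61) <| .seq (.vscl d 61 60 63) (.vadd d 62 62 51 61)) n)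

/-- Each term comes from its predecessor by one multiplication with `H` and one by `γ`. Powers of
`H` are never formed, so every term costs order `d²`. -/
theorem realizes_taylor (n : ℕ) : Realizes (d := d) (Program.taylor d n) ((n + 1) * (20 * d ^ 2))
    fun m m' => (m (.inl 51) 0 = 1 → m' (.inl 62) = ∑ k ∈ Finset.range (n + 1),
        (m (.inl 52) 0 / (1 - m (.inl 2) ⬝ᵥ m (.inl 2)) - m (.inl 53) 0) ^ k •
          (mat m 2 ^ (k + 1) *ᵥ m (.inl 55))) ∧
      (∀ j, mat m' j = mat m j) ∧ ∀ k < 59, m' (.inl k) = m (.inl k) := by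
  have hloop := Realizes.loop (d := d) (n := n)
    (P := fun _ => .seq (.matvec d 63 2 61) <| .seq (.vscl d 61 60 63) (.vadd d 62 62 51 61))
    (fun _ _ => ((computes_matvec (y := 63) (x := 61) (by decide) 2).seq <|
      (computes_vscl (k := 61) (s := 60) (by decide) 63).seq <|
      computes_vadd (k := 62) (s := 51) (by decide) 62 61).realizes)
    (I := fun n m m' => (m (.inl 51) 0 = 1 →
        m' (.inl 61) = m (.inl 60) 0 ^ n • (mat m 2 ^ n *ᵥ m (.inl 61)) ∧
        m' (.inl 62) = m (.inl 62) + ∑ k ∈ Finset.range n,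
          m (.inl 60) 0 ^ (k + 1) • (mat m 2 ^ (k + 1) *ᵥ m (.inl 61))) ∧
      (∀ j, mat m' j = mat m j) ∧ ∀ k < 61, m' (.inl k) = m (.inl k))
    (fun m => ⟨fun _ => by simp, fun _ => rfl, fun _ _ => rfl⟩)
    (by
      rintro i hi m m' m'' ⟨h1, h2, h3⟩ rfl
      have e : m (.inl 51) 0 = 1 → m (.inl 60) 0 • (mat m 2 *ᵥ m' (.inl 61))
          = m (.inl 60) 0 ^ (i + 1) • (mat m 2 ^ (i + 1) *ᵥ m (.inl 61)) := fun h => by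
        rw [(h1 h).1, Matrix.mulVec_smul, Matrix.mulVec_mulVec, ← pow_succ', smul_smul, ← pow_succ']
      have e60 := h3 60 (by decide)
      have e51 := h3 51 (by decide)
      refine ⟨fun h => ⟨?_, ?_⟩, fun j => ?_, fun k hk => ?_⟩
      · rw [← e h]; simp [h2, e60]
      · rw [Finset.sum_range_succ, ← add_assoc, ← (h1 h).2, ← e h]
        simp [h2, e60, e51, h]
      · simp [h2]
      · have : k ≠ 61 ∧ k ≠ 62 ∧ k ≠ 63 := by omega
        simp [this, h3 k hk])
  refine (((computes_sdot (d := d) 59 2 2).seq <| (computes_sop .minus 59 51 59).seq <|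
    (computes_sop .divide 60 52 59).seq <| (computes_sop .minus 60 60 53).seq <|
    (computes_matvec (y := 61) (x := 55) (by decide) 2).seq <|
    computes_vcopy (.inl 62) (.inl 61)).realizes.seq hloop).mono ?_ ?_
  · rintro m m'' ⟨m', rfl, h1, h2, h3⟩
    refine ⟨fun h => ?_, fun j => ?_, fun k hk => ?_⟩
    · rw [(h1 (by simpa using h)).2, Finset.sum_range_succ']
      simp only [ArithOp.eval, update_inl, setEntry_inl, mat_update_inl, mat_setEntry_inl,
        Function.update_self, if_true, pow_zero, one_smul, zero_add, pow_one]
      simp only [Fin.reduceEq, if_false, Function.update_self, h, Matrix.mulVec_mulVec, ← pow_succ]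
      rw [add_comm]
    · rw [h2]; simp
    · have : k ≠ 59 ∧ k ≠ 60 ∧ k ≠ 61 ∧ k ≠ 62 := by omega
      rw [h3 k (by omega)]
      simp [this]
  · have : 1 ≤ d := NeZero.one_le
    have h : d * (2 * d + 3) + (d + d * 2) ≤ 20 * d ^ 2 := by nlinarith
    have h' : 2 * d + 3 + (1 + (1 + (1 + (d * (2 * d + 3) + d * 2)))) ≤ 20 * d ^ 2 := by nlinarith
    have := Nat.mul_le_mul_left n h
    rw [add_mul, one_mul]
    omega

/-- Update of the iterate and of the Gram matrix, and the quantities for the landmark test in the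
variables `50` and `52`. -/
def Program.newton (d : ℕ) (B η β : ℝ) (n : ℕ) : Program :=
  .seq (.absorb d β) <| .seq (.gradient d B η) <| .seq (.hessInv d η) <| .seq (.taylor d n) <|
  .seq (.seq (.sconst d 59 (-1)) (.vadd d 1 1 59 62))
  (.seq (.sdot d 50 1 1) <| .seq (.sdot d 51 2 2) <| .seq (.sop d .minus 50 50 51) <|
    .seq (.sop d .times 50 50 50) <| .seq (.sconst d 52 1) <| .seq (.sop d .minus 52 52 51) <|
    .seq (.sconst d 51 (1 / 4)) <| .seq (.sop d .times 52 51 52) (.sop d .times 52 52 52))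

/-- Vector variables `1` to `4` hold iterate, landmark, linear term and received subgradient;
matrices `0` to `2` hold the Gram matrix, the inverse with landmark, and `H`. The auxiliary `X`,
`Y`, `Z` are the successive matrices whose inverses are maintained. The landmark test is prepared in
squared form, which avoids an absolute value. -/
theorem realizes_newton (B η β : ℝ) (n : ℕ) : Realizes (d := d) (Program.newton d B η β n)
    ((n + 8) * (20 * d ^ 2)) fun m m' =>
    mat m' 0 = mat m 0 + β • Matrix.vecMulVec (m (.inl 4)) (m (.inl 4)) ∧
    m' (.inl 3) = m (.inl 3) + (1 - β * (m (.inl 4) ⬝ᵥ m (.inl 1))) • m (.inl 4) ∧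
    (∀ X Y Z : Matrix (Fin d) (Fin d) ℝ, mat m 1 = X⁻¹ → IsUnit X.det →
      Y = X + β • Matrix.vecMulVec (m (.inl 4)) (m (.inl 4)) → IsUnit Y.det →
      Z = Y + (4 * η * d / (1 - m (.inl 1) ⬝ᵥ m (.inl 1)) ^ 2) •
        Matrix.vecMulVec (m (.inl 1)) (m (.inl 1)) → IsUnit Z.det →
      mat m' 1 = Y⁻¹ ∧
      m' (.inl 1) = m (.inl 1) - ∑ k ∈ Finset.range (n + 1),
        (2 * η * d / (1 - m (.inl 2) ⬝ᵥ m (.inl 2))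
            - 2 * η * d / (1 - m (.inl 1) ⬝ᵥ m (.inl 1))) ^ k • (Z⁻¹ ^ (k + 1) *ᵥ
          (mat m' 0 *ᵥ m (.inl 1) + lamOf d B η (m (.inl 1)) • m (.inl 1) + m' (.inl 3)))) ∧
    m' (.inl 50) 0 = (m' (.inl 1) ⬝ᵥ m' (.inl 1) - m (.inl 2) ⬝ᵥ m (.inl 2)) ^ 2 ∧
    m' (.inl 52) 0 = (1 / 4 * (1 - m (.inl 2) ⬝ᵥ m (.inl 2))) ^ 2 ∧
    ∀ k < 36, k ≠ 1 → k ≠ 3 → m' (.inl k) = m (.inl k) := by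
  refine ((realizes_absorb (d := d) β).seq <| (realizes_gradient B η).seq <|
    (realizes_hessInv η).seq <| (realizes_taylor n).seq <|
    ((computes_sconst 59 (-1)).seq <|
      computes_vadd (k := 1) (s := 59) (by decide) 1 62).realizes.seq <|
    ((computes_sdot 50 1 1).seq <| (computes_sdot 51 2 2).seq <| (computes_sop .minus 50 50
      51).seq <|
    (computes_sop .times 50 50 50).seq <| (computes_sconst 52 1).seq <|
    (computes_sop .minus 52 52 51).seq <| (computes_sconst 51 (1 / 4)).seq <|
    (computes_sop .times 52 51 52).seq <| computes_sop .times 52 52 52).realizes).mono ?_ ?_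
  · rintro m m' ⟨m1, ⟨a1, a2, a3, a4⟩, m2, ⟨b1, b2, b3, b4, b5, b6, b7⟩, m3, ⟨c1, c2, c3, c4⟩, m4,
      ⟨d1, d2, d3⟩, m5, rfl, rfl⟩
    have key : ∀ k : Fin 64, k < 36 → k ≠ 3 → m4 (.inl k) = m (.inl k) := fun k hk hk3 => by
      rw [d3 k (by omega), c4 k (by omega), b7 k (by omega), a4 k (by omega) hk3]
    have e2 := key 2 (by decide) (by decide)
    have e1 := key 1 (by decide) (by decide)
    have e3 : m4 (.inl 3) = m1 (.inl 3) := by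
      rw [d3 3 (by decide), c4 3 (by decide), b7 3 (by decide)]
    have hm0 : mat m4 0 = mat m1 0 := by rw [d2, c2, b6]
    have hm1 : mat m4 1 = mat m1 1 := by rw [d2, c3, b6]
    have f1 : m1 (.inl 1) = m (.inl 1) := a4 1 (by decide) (by decide)
    have f2 : m3 (.inl 2) = m (.inl 2) := by rw [← e2, d3 2 (by decide)]
    have g1 : m2 (.inl 1) = m (.inl 1) := by rw [b7 1 (by decide), f1]
    refine ⟨?_, ?_, fun X Y Z hX hu hY hYu hZ hZu => ⟨?_, ?_⟩, ?_, ?_, fun k hk hk1 hk3 => ?_⟩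
    · simp [hm0, a1]
    · simp [e3, a3]
    · simp only [mat_setEntry_inl, mat_update_inl, hm1]
      rw [hY]; exact a2 X hX hu (hY ▸ hYu)
    · have h1 : mat m2 1 = Y⁻¹ := by rw [b6, hY]; exact a2 X hX hu (hY ▸ hYu)
      have h2 : mat m3 2 = Z⁻¹ := by
        have := c1 Y h1 hYu
        rw [b1, g1, f1, ← hZ] at this
        exact this hZu
      have h3 := d1 (by rw [c4 51 (by decide), b2])
      rw [c4 52 (by decide), b3, f2, c4 53 (by decide), b4, f1, h2, c4 55 (by decide), b5, f1] at h3
      simp only [setEntry_inl, update_inl, mat_setEntry_inl, mat_update_inl, e1, e3, hm0, h3]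
      simp [sub_eq_add_neg]
    · simp [ArithOp.eval, e2, sq]
    · simp [ArithOp.eval, e2, sq]
    · have : k ≠ 50 ∧ k ≠ 51 ∧ k ≠ 52 ∧ k ≠ 59 := by omega
      simp [this, hk1, key k hk hk3]
  · have : 1 ≤ d := NeZero.one_le
    have h' : 1 + d * 2 + (2 * d + 3 + (2 * d + 3 + (1 + (1 + (1 + (1 + (1 + (1 + 1)))))))) ≤ 40 * d
      ^ 2 := by
      nlinarith
    have e : (n + 8) * (20 * d ^ 2) = (n + 1) * (20 * d ^ 2) + 140 * d ^ 2 := by ring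
    omega

end Newton

/-! ### Correctness of one quasi-Newton update -/

section Run

variable {d : ℕ}

theorem dotProduct_ofLp (x y : Vec d) : x.ofLp ⬝ᵥ y.ofLp = inner ℝ x y := by
  rw [EuclideanSpace.inner_eq_star_dotProduct, star_trivial, dotProduct_comm]

theorem dotProduct_ofLp_self (x : Vec d) : x.ofLp ⬝ᵥ x.ofLp = ‖x‖ ^ 2 := by
  rw [dotProduct_ofLp, real_inner_self_eq_norm_sq]

theorem lamOf_ofLp (B η : ℝ) (x : Vec d) :
    lamOf d B η x.ofLp = 2 * η * d / (1 - ‖x‖ ^ 2) + (d + η * B ^ 2) := by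
  rw [lamOf, dotProduct_ofLp_self]

/-- The linear term of the gradient of the potential. -/
def linTerm (β : ℝ) (g w : ℕ → Vec d) (t : ℕ) : Vec d :=
  ∑ s ∈ Finset.range t, (1 - β * inner ℝ (g s) (w s)) • g s

/-- The weighted Gram matrix of the subgradients. -/
def gram (β : ℝ) (g : ℕ → Vec d) (t : ℕ) : Matrix (Fin d) (Fin d) ℝ :=
  β • ∑ s ∈ Finset.range t, outer (g s)

theorem gram_succ (β : ℝ) (g : ℕ → Vec d) (t : ℕ) :
    gram β g (t + 1) = gram β g t + β • Matrix.vecMulVec (g t).ofLp (g t).ofLp := by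
  rw [gram, gram, Finset.sum_range_succ, smul_add, outer]

theorem posSemidef_gram {β : ℝ} (hβ : 0 ≤ β) (g : ℕ → Vec d) (t : ℕ) : (gram β g t).PosSemidef :=
  (Matrix.posSemidef_sum _ fun s _ => posSemidef_outer (g s)).smul hβ

/-- The whole history enters the gradient only through a matrix and a vector, so earlier iterates
and subgradients need not be stored. -/
theorem potGrad_eq (B η β : ℝ) (g w : ℕ → Vec d) (t : ℕ) (x : Vec d) :
    (potGrad B η β g w t x).ofLp = gram β g t *ᵥ x.ofLp + lamOf d B η x.ofLp • x.ofLp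
      + (linTerm β g w t).ofLp := by
  have h : potGrad B η β g w t x = Matrix.toEuclideanLin (gram β g t) x
      + (2 * η * d / (1 - ‖x‖ ^ 2) + (d + η * B ^ 2)) • x + linTerm β g w t := by
    have e : Matrix.toEuclideanLin (gram β g t) x
        = β • ∑ s ∈ Finset.range t, (inner ℝ (g s) x : ℝ) • g s := by
      simp only [gram, map_smul, map_sum, LinearMap.smul_apply, LinearMap.sum_apply,
        toEuclideanLin_outer]
    rw [e, mul_comm η (B ^ 2)]
    unfold potGrad linTerm
    simp only [inner_sub_right, sub_smul, Finset.sum_sub_distrib, smul_sub, add_smul, one_smul,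
      mul_smul, ← Finset.smul_sum]
    abel
  rw [h, lamOf_ofLp, WithLp.ofLp_add, WithLp.ofLp_add, Matrix.toLpLin_apply, WithLp.ofLp_smul]

theorem taylorH_apply (B η β : ℝ) (m : ℕ) (g : ℕ → Vec d) (t : ℕ) (v x y : Vec d) :
    (Matrix.toEuclideanLin (taylorH B η β m g t v x) y).ofLp = ∑ k ∈ Finset.range (m + 1),
      (2 * η * d / (1 - ‖v‖ ^ 2) - 2 * η * d / (1 - ‖x‖ ^ 2)) ^ k
        • (matH B η β g t v x ^ (k + 1) *ᵥ y.ofLp) := by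
  rw [Matrix.toLpLin_apply, taylorH, Matrix.sum_mulVec]
  simp only [Matrix.smul_mulVec]

/-- The memory holds the data of the quasi-Newton algorithm before round `t`. -/
structure Holds (B η β : ℝ) (g w v : ℕ → Vec d) (t : ℕ) (m : Mem d) : Prop where
  iterate : m (.inl 1) = (w t).ofLp
  landmark : m (.inl 2) = (v t).ofLp
  lin : m (.inl 3) = (linTerm β g w t).ofLp
  gram : mat m 0 = gram β g t
  inv : mat m 1 = (regMat (lamOf d B η (v t).ofLp) β g t)⁻¹

variable [NeZero d]

/-- The quasi-Newton update. -/
def Program.update (d : ℕ) (B η β : ℝ) (n : ℕ) : Program :=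
  .seq (.newton d B η β n) (.ite (Blk.addr (.inl 50 : Blk d)) (Blk.addr (.inl 52 : Blk d)) .skip
    (.seq (.vcopy (.inl 2 : Blk d) (.inl 1)) (.reinit d B η)))

omit [NeZero d] in
theorem Realizes.exec {P : Program} {c : ℕ} {R : Mem d → Mem d → Prop} (h : Realizes P c R)
    (grad : ℕ → Vec d → Vec d) (o : Vec d → Option (Vec d)) (σ : State d) :
    R (mem σ.reg) (mem (P.exec grad o σ).reg) ∧ (P.exec grad o σ).ops ≤ σ.ops + c := by
  obtain ⟨F, hF, hR⟩ := h
  rw [hF.mem_exec]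
  exact ⟨hR _, hF.ops_le _ _ _⟩

omit [NeZero d] in
theorem Realizes.isPure {P : Program} {c : ℕ} {R : Mem d → Mem d → Prop} (h : Realizes P c R) :
    P.IsPure := by
  obtain ⟨F, hF, -⟩ := h
  exact hF.isPure

theorem isPure_reinit (B η : ℝ) : (Program.reinit d B η).IsPure := (realizes_reinit B η).isPure

theorem isPure_update (B η β : ℝ) (n : ℕ) : (Program.update d B η β n).IsPure :=
  ⟨(realizes_newton B η β n).isPure, trivial, (computes_vcopy (.inl 2 : Blk d) (.inl 1)).isPure,
    isPure_reinit B η⟩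

/-- Here `w (t + 1)` and `v (t + 1)` are by hypothesis the resulting register contents; the content
is that they obey the algorithm. Membership of the new iterate in the ball is required only to
restore the memory invariant, so it may be supplied afterwards by the analysis of the recursion just
proved. -/
theorem exec_update {B η β : ℝ} {g w v : ℕ → Vec d} {t n : ℕ} (hη : 0 < η) (hβ : 0 ≤ β)
    {grad : ℕ → Vec d → Vec d} {o : Vec d → Option (Vec d)} {σ σ' : State d}
    (hσ : σ' = (Program.update d B η β n).exec grad o σ)
    (h : Holds B η β g w v t (mem σ.reg)) (hg : mem σ.reg (.inl 4) = (g t).ofLp)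
    (hw : ‖w t‖ < 1) (hv : ‖v t‖ < 1) (hw' : mem σ'.reg (.inl 1) = (w (t + 1)).ofLp)
    (hv' : mem σ'.reg (.inl 2) = (v (t + 1)).ofLp) :
    w (t + 1) = w t - Matrix.toEuclideanLin (taylorH B η β n g t (v t) (w t))
        (gradient (potential B η β g w (t + 1)) (w t)) ∧
    (|‖w (t + 1)‖ ^ 2 - ‖v t‖ ^ 2| ≤ 1 / 4 * (1 - ‖v t‖ ^ 2) → v (t + 1) = v t) ∧
    (¬ |‖w (t + 1)‖ ^ 2 - ‖v t‖ ^ 2| ≤ 1 / 4 * (1 - ‖v t‖ ^ 2) → v (t + 1) = w (t + 1)) ∧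
    (‖w (t + 1)‖ < 1 → Holds B η β g w v (t + 1) (mem σ'.reg)) ∧
    (mem σ'.reg : Mem d) (.inl 0) = mem σ.reg (.inl 0) ∧
    σ'.ops ≤ σ.ops + (n + 8) * (20 * d ^ 2) + 1 +
      (open Classical in if |‖w (t + 1)‖ ^ 2 - ‖v t‖ ^ 2| ≤ 1 / 4 * (1 - ‖v t‖ ^ 2) then 0
        else 62 * d ^ 3) := by
  have hd : 1 ≤ d := NeZero.one_le
  obtain ⟨hN, hops⟩ := (realizes_newton (d := d) B η β n).exec grad o σ
  set σN := (Program.newton d B η β n).exec grad o σ with hσN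
  obtain ⟨n0, n3, nX, n50, n52, nk⟩ := hN
  have hlam : 0 < lamOf d B η (v t).ofLp := by rw [lamOf_ofLp]; exact landmark_coeff_pos hd hη hv
  have hXu : IsUnit (regMat (lamOf d B η (v t).ofLp) β g t).det :=
    (posDef_regMat hlam hβ g t).det_pos.ne'.isUnit
  have hYu : IsUnit (regMat (lamOf d B η (v t).ofLp) β g (t + 1)).det :=
    (posDef_regMat hlam hβ g (t + 1)).det_pos.ne'.isUnit
  have hYX : regMat (lamOf d B η (v t).ofLp) β g (t + 1)
      = regMat (lamOf d B η (v t).ofLp) β g t + β • Matrix.vecMulVec (g t).ofLp (g t).ofLp := by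
    have := gram_succ β g t
    unfold gram at this
    rw [regMat, regMat, this, add_assoc]
  have hZ : hessMat B η β g t (v t) (w t) = regMat (lamOf d B η (v t).ofLp) β g (t + 1)
      + (4 * η * d / (1 - ‖w t‖ ^ 2) ^ 2) • Matrix.vecMulVec (w t).ofLp (w t).ofLp := by
    rw [hessMat, lamOf_ofLp, outer]
  rw [h.iterate, h.landmark, hg, dotProduct_ofLp_self, dotProduct_ofLp_self] at nX
  obtain ⟨hA, hW⟩ := nX _ _ _ h.inv hXu hYX hYu hZ
    (posDef_hessMat hd hη hβ t hv).det_pos.ne'.isUnit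
  have hgram : mat (mem σN.reg) 0 = gram β g (t + 1) := by rw [n0, h.gram, hg, gram_succ]
  have hlin : mem σN.reg (.inl 3) = (linTerm β g w (t + 1)).ofLp := by
    rw [n3, h.lin, hg, h.iterate, dotProduct_ofLp, linTerm, linTerm, Finset.sum_range_succ,
      WithLp.ofLp_add, WithLp.ofLp_smul]
  have hk2 : mem σN.reg (.inl 2) = (v t).ofLp := by
    rw [nk 2 (by decide) (by decide) (by decide), h.landmark]
  have hk0 := nk 0 (by decide) (by decide) (by decide)
  have hcell : ∀ k : Fin 64, σN.reg (Blk.addr (.inl k : Blk d)) = (mem σN.reg : Mem d) (.inl k) 0 :=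
    fun k => by
    simp [mem]
  rw [Program.update, Program.exec, ← hσN, Program.exec, hcell, hcell] at hσ
  -- the iterate is not changed after the Newton step
  obtain ⟨⟨r1, r0, rk⟩, rops⟩ := ((computes_vcopy (.inl 2 : Blk d) (.inl 1)).realizes.seq
    (realizes_reinit (d := d) B η)).mono (S := fun m m'' =>
      ((mat m 0).PosSemidef → 0 < lamOf d B η (m (.inl 1)) →
      mat m'' 1 = (lamOf d B η (m (.inl 1)) • (1 : Matrix (Fin d) (Fin d) ℝ) + mat m 0)⁻¹) ∧
      mat m'' 0 = mat m 0 ∧ ∀ k < 38, m'' (.inl k) = if k = 2 then m (.inl 1) else m (.inl k))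
      (by
        rintro m m'' ⟨m', rfl, h1, h2, h3⟩
        refine ⟨fun hM hl => ?_, ?_, fun k hk => ?_⟩
        · simpa using h1 (by simpa using hM) (by simpa using hl)
        · simpa using h2
        · rw [h3 k hk, update_inl]) le_rfl |>.exec grad o { σN with ops := σN.ops + 1 }
  have hw1 : mem σN.reg (.inl 1) = (w (t + 1)).ofLp := by
    rw [← hw', hσ]
    split_ifs
    · rfl
    · exact (rk 1 (by decide)).symm
  have hstep : w (t + 1) = w t - Matrix.toEuclideanLin (taylorH B η β n g t (v t) (w t))
        (gradient (potential B η β g w (t + 1)) (w t)) := by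
    rw [(hasGradientAt_potential hw (t + 1)).gradient]
    apply WithLp.ofLp_injective
    rw [← hw1, hW, WithLp.ofLp_sub, taylorH_apply, potGrad_eq, matH_eq hd hη hβ t hv, hgram, hlin]
  have hv2 : 0 ≤ 1 / 4 * (1 - ‖v t‖ ^ 2) := by
    have := one_sub_norm_sq_pos hv
    positivity
  -- Comparing squares is equivalent to the landmark test because its right-hand side is
  -- nonnegative.
  have htest : (mem σN.reg : Mem d) (.inl 50) 0 ≤ (mem σN.reg : Mem d) (.inl 52) 0 ↔
      |‖w (t + 1)‖ ^ 2 - ‖v t‖ ^ 2| ≤ 1 / 4 * (1 - ‖v t‖ ^ 2) := by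
    rw [n50, n52, hw1, h.landmark, dotProduct_ofLp_self, dotProduct_ofLp_self, sq_le_sq,
      abs_of_nonneg hv2]
  refine ⟨hstep, fun hc => ?_, fun hc => ?_, fun hw1' => ?_, ?_, ?_⟩
  · rw [if_pos (htest.2 hc)] at hσ
    apply WithLp.ofLp_injective
    rw [← hv', hσ]
    exact hk2
  · rw [if_neg (htest.not.2 hc)] at hσ
    apply WithLp.ofLp_injective
    rw [← hv', ← hw1, hσ]
    exact rk 2 (by decide)
  · refine ⟨hw', hv', ?_, ?_, ?_⟩
    · rw [hσ, ← hlin]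
      split_ifs
      · rfl
      · exact rk 3 (by decide)
    · rw [hσ, ← hgram]
      split_ifs
      · rfl
      · exact r0
    · rw [← hv', hσ]
      split_ifs
      · rw [← hk2] at hA
        exact hA
      · have e : mem ((Program.seq (.vcopy (.inl 2 : Blk d) (.inl 1)) (.reinit d B η)).exec grad o
            { σN with ops := σN.ops + 1 }).reg (.inl 2) = (w (t + 1)).ofLp := by
          rw [← hw1]; exact rk 2 (by decide)
        rw [e]
        refine (r1 (by rw [hgram]; exact posSemidef_gram hβ g _) ?_).trans ?_
        · rw [hw1, lamOf_ofLp]; exact landmark_coeff_pos hd hη hw1'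
        · rw [hgram, hw1]; rfl
  · rw [← hk0, hσ]
    split_ifs
    · rfl
    · exact rk 0 (by decide)
  · have : d ≤ d ^ 3 := Nat.le_self_pow (by norm_num) d
    by_cases hc : |‖w (t + 1)‖ ^ 2 - ‖v t‖ ^ 2| ≤ 1 / 4 * (1 - ‖v t‖ ^ 2)
    · rw [if_pos hc]
      rw [if_pos (htest.2 hc)] at hσ
      have : σ'.ops = σN.ops + 1 := by rw [hσ]; rfl
      omega
    · rw [if_neg hc]
      rw [if_neg (htest.not.2 hc)] at hσ
      rw [← hσ] at rops
      simp only at rops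
      omega

end Run

/-! ### The complete program and its invariants -/

section Driver

variable {d : ℕ}

/-- The program plays a point and stores the subgradient to be passed on according to `round`, with
at most `c` operations and `k` calls of the oracle. -/
def IsFront (F : Program) (round : Vec d → Vec d → Vec d → Vec d → Prop)
    (grad : ℕ → Vec d → Vec d) (o : Vec d → Option (Vec d)) (c k : ℕ) : Prop :=
  ∀ σ : State d, ‖WithLp.toLp 2 (mem σ.reg (.inl 1) : Fin d → ℝ)‖ < 1 → ∃ u : Vec d,
    round (WithLp.toLp 2 (mem σ.reg (.inl 1))) u (grad σ.rounds u)
      (WithLp.toLp 2 (mem (F.exec grad o σ).reg (.inl 4))) ∧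
    (F.exec grad o σ).played = Function.update σ.played σ.rounds u ∧
    (F.exec grad o σ).rounds = σ.rounds + 1 ∧
    (mem (F.exec grad o σ).reg : Mem d) (.inl 0) = mem σ.reg (.inl 0) + u.ofLp ∧
    (∀ k : Fin 64, (k = 1 ∨ k = 2 ∨ k = 3) →
      (mem (F.exec grad o σ).reg : Mem d) (.inl k) = mem σ.reg (.inl k)) ∧
    (∀ j, mat (mem (F.exec grad o σ).reg : Mem d) j = mat (mem σ.reg) j) ∧
    (F.exec grad o σ).ops ≤ σ.ops + c ∧ (F.exec grad o σ).calls ≤ σ.calls + k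

variable [NeZero d]

/-- The rounds of the algorithm. -/
def Program.rounds (d : ℕ) (B η β : ℝ) (n : ℕ) (F : Program) (T : ℕ) : Program :=
  .seq (.reinit d B η) (.loop (fun _ => .seq F (.update d B η β n)) T)

/-- The algorithm: its rounds followed by the computation of the average. -/
def Program.main (d : ℕ) (B η β : ℝ) (n : ℕ) (F : Program) (T : ℕ) : Program :=
  .seq (.rounds d B η β n F T) (.seq (.sconst d 50 (T : ℝ)⁻¹) (.vscl d 0 50 0))

/-- All sequences are read off from the execution. Correctness of a round needs the iterate in the
ball, and the quasi-Newton analysis provides this from correctness of the previous rounds, so both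
are proved in one induction. The number `J` in the operation count is the number of recomputed
inverses. -/
theorem final_main {B η β δ : ℝ} {C : Set (Vec d)} {round : Vec d → Vec d → Vec d → Vec d → Prop}
    {F : Program} {grad : ℕ → Vec d → Vec d} {o : Vec d → Option (Vec d)} {c k n T : ℕ}
    (hr : IsSurrogate C B δ round) (hF : IsFront F round grad o c k)
    (hgrad : ∀ t, ∀ x ∈ C, ‖grad t x‖ ≤ 1) (hη : 11 ≤ η) (hB : 0 < B) (hβ : 0 < β) (hβ1 : β ≤ 1)
    (hn : 4 ≤ n) {P : Program} (hP : P = Program.main d B η β n F T) :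
    (P.final grad o).rounds = T ∧
    (∃ w v g : ℕ → Vec d, IsOQNS B η β (1 / 4) n T g w v ∧
      ∀ t < T, round (w t) ((P.final grad o).played t) (grad t ((P.final grad o).played t)) (g t)) ∧
    P.output grad o = avgIterate T (P.final grad o).played ∧
    (P.final grad o).calls ≤ T * k ∧
    ∃ J : ℕ, (J : ℝ) ^ 2 ≤ 30 * (T * Real.log (1 + T) / β) ∧
      (P.final grad o).ops ≤ 60 * d ^ 3 + T * (c + (n + 8) * (20 * d ^ 2) + 1) + J * (62 * d ^ 3)
        + (1 + d) := by
  have hd : 1 ≤ d := NeZero.one_le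
  have hη0 : 0 < η := by linarith
  set st : ℕ → State d := fun t => (Program.rounds d B η β n F t).exec grad o (State.init d) with
    hst
  set fr : ℕ → State d := fun t => F.exec grad o (st t) with hfr
  have hst_succ : ∀ t, st (t + 1) = (Program.update d B η β n).exec grad o (fr t) := fun t => rfl
  set w : ℕ → Vec d := fun t => WithLp.toLp 2 (mem (st t).reg (.inl 1)) with hw
  set v : ℕ → Vec d := fun t => WithLp.toLp 2 (mem (st t).reg (.inl 2)) with hv
  set g : ℕ → Vec d := fun t => WithLp.toLp 2 (mem (fr t).reg (.inl 4)) with hg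
  obtain ⟨⟨i1, i0, ik⟩, iops⟩ := (realizes_reinit (d := d) B η).exec grad o (State.init d)
  have hpure := (isPure_reinit (d := d) B η).exec_eq grad o (State.init d)
  have hinit : ∀ b : Blk d, (mem (State.init d).reg : Mem d) b = 0 := fun b => by
    funext i; simp [mem, State.init]
  have hw0 : w 0 = 0 := by
    apply WithLp.ofLp_injective
    exact (ik 1 (by decide)).trans (hinit _)
  have hv0 : v 0 = 0 := by
    apply WithLp.ofLp_injective
    exact (ik 2 (by decide)).trans (hinit _)
  have key : ∀ t ≤ T, IsOQNS B η β (1 / 4) n t g w v ∧ Holds B η β g w v t (mem (st t).reg) ∧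
      (∀ s < t, ‖g s‖ ≤ B) ∧
      (∀ s < t, round (w s) ((st t).played s) (grad s ((st t).played s)) (g s)) ∧
      (st t).rounds = t ∧
      (mem (st t).reg : Mem d) (.inl 0) = (∑ s ∈ Finset.range t, (st t).played s).ofLp ∧
      (st t).calls ≤ t * k ∧
      (st t).ops ≤ 60 * d ^ 3 + t * (c + (n + 8) * (20 * d ^ 2) + 1)
        + (landmarkMoves (1 / 4) w v t).card * (62 * d ^ 3) := by
    intro t
    induction t with
    | zero =>
      intro _
      refine ⟨⟨hw0, hv0, by simp, by simp, by simp⟩, ⟨rfl, rfl, ?_, ?_, ?_⟩, by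
        simp, by simp, ?_, ?_,
        ?_, ?_⟩
      · refine ((ik 3 (by decide)).trans (hinit _)).trans ?_
        simp [linTerm]
      · refine i0.trans ?_
        funext i
        rw [show mat (mem (State.init d).reg : Mem d) 0 i = 0 from hinit _]
        simp [gram]; rfl
      · have e0 : mat (mem (State.init d).reg : Mem d) 0 = 0 := by
          funext i
          exact hinit _
        rw [e0, hinit] at i1
        have e1 : (0 : Fin d → ℝ) = (0 : Vec d).ofLp := rfl
        have hpos : 0 < lamOf d B η (0 : Vec d).ofLp := by
          rw [lamOf_ofLp]; exact landmark_coeff_pos hd hη0 (by simp)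
        rw [hv0]
        refine (i1 Matrix.PosSemidef.zero hpos).trans ?_
        rw [e1]
        simp [regMat]
      · exact hpure.2.1
      · refine ((ik 0 (by decide)).trans (hinit _)).trans ?_
        simp
      · exact hpure.2.2.le.trans (by simp [State.init])
      · have : (State.init d).ops = 0 := rfl
        have : (st 0).ops ≤ (State.init d).ops + 60 * d ^ 3 := iops
        omega
    | succ t ih =>
      intro ht
      obtain ⟨h1, h2, h3, h4, h5, h6, h7, h8⟩ := ih (by omega)
      -- The horizon in `IsOQNS` is the current `t`, which makes the analysis available in the
      -- middle of the run.
      have hI := h1.iterInv hd hη hB hβ.le hn h3 t le_rfl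
      obtain ⟨u, f1, f2, f3, f4, f5, f6, f7, f8⟩ := hF (st t) hI.norm_w
      have hu := hr.mem _ _ _ _ f1
      have hgt : ‖g t‖ ≤ B := hr.norm_le _ _ _ _ f1 (hgrad _ _ hu)
      have hpu := (isPure_update (d := d) B η β n).exec_eq grad o (fr t)
      rw [← hst_succ] at hpu
      have hHolds : Holds B η β g w v t (mem (fr t).reg) :=
        ⟨(f5 1 (by simp)).trans h2.iterate, (f5 2 (by simp)).trans h2.landmark,
          (f5 3 (by simp)).trans h2.lin, (f6 0).trans h2.gram, (f6 1).trans h2.inv⟩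
      obtain ⟨e1, e2, e3, e4, e5, e6⟩ := exec_update hη0 hβ.le (hst_succ t) hHolds rfl hI.norm_w
        hI.norm_v rfl rfl
      have hO : IsOQNS B η β (1 / 4) n (t + 1) g w v := by
        refine ⟨hw0, hv0, fun s hs => ?_, fun s hs => ?_, fun s hs => ?_⟩
        · rcases Nat.lt_succ_iff_lt_or_eq.1 hs with hs | rfl
          exacts [h1.step_w s hs, e1]
        · rcases Nat.lt_succ_iff_lt_or_eq.1 hs with hs | rfl
          exacts [h1.keep_v s hs, e2]
        · rcases Nat.lt_succ_iff_lt_or_eq.1 hs with hs | rfl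
          exacts [h1.move_v s hs, e3]
      have hgs : ∀ s < t + 1, ‖g s‖ ≤ B := fun s hs => by
        rcases Nat.lt_succ_iff_lt_or_eq.1 hs with hs | rfl
        exacts [h3 s hs, hgt]
      -- The recursion has just been extended by one step, so the analysis now places the new
      -- iterate in the ball, as the memory invariant `e4` needs.
      have hI' := hO.iterInv hd hη hB hβ.le hn hgs (t + 1) le_rfl
      have hpl : (st (t + 1)).played = Function.update (st t).played t u := by
        rw [hpu.1, hfr, f2, h5]
      have hps : ∀ s < t, (st (t + 1)).played s = (st t).played s := fun s hs => by
        rw [hpl, Function.update_of_ne hs.ne]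
      have hpt : (st (t + 1)).played t = u := by rw [hpl, Function.update_self]
      refine ⟨hO, e4 hI'.norm_w, hgs, fun s hs => ?_, ?_, ?_, ?_, ?_⟩
      · rcases Nat.lt_succ_iff_lt_or_eq.1 hs with hs | rfl
        · rw [hps s hs]; exact h4 s hs
        · rw [hpt]; rw [h5] at f1; exact f1
      · rw [hpu.2.1, hfr, f3, h5]
      · rw [e5, hfr, f4, h6, Finset.sum_range_succ, hpt,
          Finset.sum_congr rfl fun s hs => hps s (Finset.mem_range.1 hs), WithLp.ofLp_add]
      · rw [hpu.2.2, Nat.succ_mul]; exact f8.trans (by omega)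
      · have hc := landmarkMoves_succ (1 / 4) w v t
        have e7 : (fr t).ops ≤ (st t).ops + c := f7
        have e8 : (t + 1) * (c + (n + 8) * (20 * d ^ 2) + 1)
            = t * (c + (n + 8) * (20 * d ^ 2) + 1) + (c + (n + 8) * (20 * d ^ 2) + 1) := by ring
        have e9 : ∀ i, ((landmarkMoves (1 / 4) w v t).card + i) * (62 * d ^ 3)
            = (landmarkMoves (1 / 4) w v t).card * (62 * d ^ 3) + i * (62 * d ^ 3) := fun i =>
          Nat.add_mul _ _ _
        rw [hc, e8, e9]
        split_ifs at e6 ⊢ <;> omega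
  obtain ⟨h1, h2, h3, h4, h5, h6, h7, h8⟩ := key T le_rfl
  have hfin : P.final grad o = (Program.seq (.sconst d 50 (T : ℝ)⁻¹) (.vscl d 0 50 0)).exec grad o
    (st T) := by rw [hP]; rfl
  have hsc := (computes_sconst (d := d) 50 (T : ℝ)⁻¹).seq
    (computes_vscl (k := 0) (s := 50) (by decide) 0)
  obtain ⟨p1, p2, p3⟩ := hsc.isPure.exec_eq grad o (st T)
  have p4 := hsc.mem_exec grad o (st T)
  have p5 := hsc.ops_le grad o (st T)
  rw [← hfin] at p1 p2 p3 p4 p5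
  refine ⟨p2.trans h5, ⟨w, v, g, h1, fun t ht => ?_⟩, ?_, p3.le.trans h7, _,
    h1.card_landmarkMoves_le hd hη hB hβ hβ1 hn h3, ?_⟩
  · rw [p1]; exact h4 t ht
  · rw [p1]
    have : P.output grad o = WithLp.toLp 2 (mem (P.final grad o).reg (.inl 0)) := by
      unfold Program.output
      rw [← readVec_addr]
      simp [Blk.addr, Blk.idx]
    rw [this, p4]
    apply WithLp.ofLp_injective
    simp [h6, avgIterate]
  · omega

end Driver

/-! ### Programs that call the oracle -/

section Asks

variable {d : ℕ}

/-- The program transforms the vector variables according to the relation `R`, with at most `c`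
operations and `k` calls of the oracle `o`, and plays no point. -/
def Asks (o : Vec d → Option (Vec d)) (P : Program) (c k : ℕ) (R : Mem d → Mem d → Prop) : Prop :=
  ∀ grad (σ : State d), R (mem σ.reg) (mem (P.exec grad o σ).reg) ∧
    (P.exec grad o σ).played = σ.played ∧ (P.exec grad o σ).rounds = σ.rounds ∧
    (P.exec grad o σ).calls ≤ σ.calls + k ∧ (P.exec grad o σ).ops ≤ σ.ops + c

variable {o : Vec d → Option (Vec d)} {P Q : Program} {c c' k k' : ℕ} {R S : Mem d → Mem d → Prop}

theorem Realizes.asks (h : Realizes P c R) (o : Vec d → Option (Vec d)) : Asks o P c 0 R :=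
  fun grad σ => by
    obtain ⟨h1, h2⟩ := h.exec grad o σ
    obtain ⟨h3, h4, h5⟩ := h.isPure.exec_eq grad o σ
    exact ⟨h1, h3, h4, h5.le, h2⟩

theorem Asks.seq (hP : Asks o P c k R) (hQ : Asks o Q c' k' S) :
    Asks o (.seq P Q) (c + c') (k + k') fun m m'' => ∃ m', R m m' ∧ S m' m'' := fun grad σ => by
  obtain ⟨a1, a2, a3, a4, a5⟩ := hP grad σ
  obtain ⟨b1, b2, b3, b4, b5⟩ := hQ grad (P.exec grad o σ)
  exact ⟨⟨_, a1, b1⟩, b2.trans a2, b3.trans a3, b4.trans (by omega), b5.trans (by omega)⟩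

theorem Asks.mono (hP : Asks o P c k R) (h : ∀ m m', R m m' → S m m') (hc : c ≤ c') (hk : k ≤ k') :
    Asks o P c' k' S := fun grad σ => by
  obtain ⟨a1, a2, a3, a4, a5⟩ := hP grad σ
  exact ⟨h _ _ a1, a2, a3, a4.trans (by omega), a5.trans (by omega)⟩

theorem Asks.loop {P : ℕ → Program} {c n k : ℕ} {R : Mem d → Mem d → Prop}
    (h : ∀ i < n, Asks o (P i) c k R) {I : ℕ → Mem d → Mem d → Prop} (h0 : ∀ m, I 0 m m)
    (hI : ∀ i < n, ∀ m m' m'', I i m m' → R m' m'' → I (i + 1) m m'') :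
    Asks o (Program.loop P n) (n * c) (n * k) (I n) := by
  induction n with
  | zero =>
    exact ((Computes.skip.realizes).asks o).mono (fun m m' h => by rw [h]; exact h0 m) (by simp)
      (by simp)
  | succ n ih =>
    exact ((ih (fun i hi => h i (by omega)) fun i hi => hI i (by omega)).seq (h n (by omega))).mono
      (fun m m'' ⟨m', h1, h2⟩ => hI n (by omega) _ _ _ h1 h2) (by rw [Nat.succ_mul])
        (by rw [Nat.succ_mul])

theorem hid_add_one (d : ℕ) (n : ℕ) : hid d n + 1 = (n + 1) * (d + 1) := by
  unfold hid; ring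

/-- Query the oracle at the variable `a`, with the answer in the variable `n + 1`. -/
def Program.query (d : ℕ) (a : Fin 64) (n : ℕ) : Program :=
  .call (Blk.addr (.inl a : Blk d)) (hid d n)

/-- The spare register after block `n` immediately precedes block `n + 1`; thus the membership flag
falls into the former and a returned vector exactly fills a vector variable. -/
theorem exec_query (a b : Fin 64) {n : ℕ} (hb : (b : ℕ) = n + 1) (grad : ℕ → Vec d → Vec d)
    (o : Vec d → Option (Vec d)) (σ : State d) :
    ((Program.query d a n).exec grad o σ).reg = (match o (WithLp.toLp 2 (mem σ.reg (.inl a))) with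
      | none => Function.update σ.reg (hid d n) 1
      | some x => writeVec (Function.update σ.reg (hid d n) 0) (Blk.addr (.inl b : Blk d)) x) := by
  have : hid d n + 1 = Blk.addr (.inl b : Blk d) := by
    rw [hid_add_one, ← hb]; rfl
  rw [← this]
  rfl

/-- Query the oracle and discard the membership flag. -/
def Program.queryDiscard (d : ℕ) (a : Fin 64) (n : ℕ) : Program :=
  .seq (.query d a n) (.const (hid d n) 0)

/-- An affirmative answer writes no vector, so the previous contents of the target act as a default.
Preloading it with the queried point covers both answers without branching. -/
theorem asks_queryDiscard (o : Vec d → Option (Vec d)) (a b : Fin 64) {n : ℕ} (hb : (b : ℕ) = n + 1)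
    :
    Asks o (Program.queryDiscard d a n) (d + 1) 1 fun m m' =>
      m' = Function.update m (.inl b)
        ((o (WithLp.toLp 2 (m (.inl a)))).getD (WithLp.toLp 2 (m (.inl b)))).ofLp := by
  intro grad σ
  refine ⟨?_, rfl, rfl, le_rfl, le_rfl⟩
  change mem (Function.update ((Program.query d a n).exec grad o σ).reg (hid d n) 0) = _
  rw [mem_update_hid, exec_query a b hb]
  cases o (WithLp.toLp 2 (mem σ.reg (.inl a))) with
  | none => simp [mem_update_hid]
  | some x => simp only [mem_writeVec, mem_update_hid, Option.getD_some]

/-- Query the oracle and branch on the answer. -/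
def Program.queryBranch (d : ℕ) (a : Fin 64) (n : ℕ) (yes no : Program) : Program :=
  -- The test is whether the flag is at most `0`, which holds when a vector was returned; hence `no`
  -- is the first branch.
  .seq (.query d a n) (.seq (.const (hid d 0) 0) (.ite (hid d n) (hid d 0) no yes))

theorem Asks.queryBranch (hP : Asks o P c k R) (hQ : Asks o Q c k S) (a b : Fin 64) {n : ℕ}
    (hb : (b : ℕ) = n + 1) (hn : n ≠ 0) :
    Asks o (Program.queryBranch d a n P Q) (c + d + 2) (k + 1) fun m m' =>
      (o (WithLp.toLp 2 (m (.inl a))) = none → R m m') ∧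
      ∀ x, o (WithLp.toLp 2 (m (.inl a))) = some x →
        S (Function.update m (.inl b) x.ofLp) m' := by
  intro grad σ
  have hne : hid d n ≠ hid d 0 := fun h => hn (hid_injective h)
  set σ1 : State d := { (Program.query d a n).exec grad o σ with
    reg := Function.update ((Program.query d a n).exec grad o σ).reg (hid d 0) 0
    ops := ((Program.query d a n).exec grad o σ).ops + 1 + 1 } with hσ1
  have e1 : σ1.played = σ.played := rfl
  have e2 : σ1.rounds = σ.rounds := rfl
  have e3 : σ1.calls = σ.calls + 1 := rfl
  have e4 : σ1.ops = σ.ops + d + 2 := rfl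
  have e5 : (Program.queryBranch d a n P Q).exec grad o σ
      = if Function.update ((Program.query d a n).exec grad o σ).reg (hid d 0) 0 (hid d n)
        ≤ Function.update ((Program.query d a n).exec grad o σ).reg (hid d 0) 0 (hid d 0)
        then Q.exec grad o σ1 else P.exec grad o σ1 := rfl
  rw [Function.update_self, Function.update_of_ne hne, exec_query a b hb] at e5
  have e6 : (mem σ1.reg : Mem d) = mem ((Program.query d a n).exec grad o σ).reg := mem_update_hid _
    _ _
  rw [exec_query a b hb] at e6
  cases ho : o (WithLp.toLp 2 (mem σ.reg (.inl a))) with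
  | none =>
    rw [ho] at e5 e6
    simp only [Function.update_self, not_le.2 one_pos, if_false] at e5
    simp only [mem_update_hid] at e6
    rw [e5]
    obtain ⟨a1, a2, a3, a4, a5⟩ := hP grad σ1
    rw [e6] at a1
    exact ⟨⟨fun _ => a1, fun _ h => by simp [ho] at h⟩, a2.trans e1, a3.trans e2, by
      omega, by omega⟩
  | some x =>
    rw [ho] at e5 e6
    simp only [writeVec_hid, Function.update_self, le_refl, if_true] at e5
    simp only [mem_writeVec, mem_update_hid] at e6
    rw [e5]
    obtain ⟨a1, a2, a3, a4, a5⟩ := hQ grad σ1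
    rw [e6] at a1
    refine ⟨⟨fun h => by simp [ho] at h, fun y hy => ?_⟩, a2.trans e1, a3.trans e2, by
      omega, by omega⟩
    rwa [← Option.some.inj (ho.symm.trans hy)]

/-- A front end: determine the point in variable `6`, play it, and process the subgradient. -/
def Program.front (d : ℕ) (Q P : Program) : Program :=
  .seq Q (.seq (.play (Blk.addr (.inl 6 : Blk d)) (Blk.addr (.inl 5 : Blk d))) P)

theorem isFront_front {round : Vec d → Vec d → Vec d → Vec d → Prop}
    (hQ : Asks o Q c k R) (hP : Realizes P c' S) (grad : ℕ → Vec d → Vec d)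
    (h : ∀ m m1 m3 (ζ : Vec d), ‖WithLp.toLp 2 (m (.inl 1))‖ < 1 → R m m1 →
      S (Function.update m1 (.inl 5) ζ.ofLp) m3 →
      round (WithLp.toLp 2 (m (.inl 1))) (WithLp.toLp 2 (m1 (.inl 6))) ζ (WithLp.toLp 2 (m3 (.inl
        4))) ∧
      m3 (.inl 0) = m (.inl 0) + m1 (.inl 6) ∧
      (∀ k : Fin 64, (k = 1 ∨ k = 2 ∨ k = 3) → m3 (.inl k) = m (.inl k)) ∧
      ∀ j, mat m3 j = mat m j) :
    IsFront (Program.front d Q P) round grad o (c + d + c') k := by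
  intro σ hw
  obtain ⟨a1, a2, a3, a4, a5⟩ := hQ grad σ
  set σ1 := Q.exec grad o σ with hσ1
  set u : Vec d := WithLp.toLp 2 (mem σ1.reg (.inl 6)) with hu
  set σ2 : State d := ⟨writeVec σ1.reg (Blk.addr (.inl 5 : Blk d)) (grad σ1.rounds u),
    Function.update σ1.played σ1.rounds u, σ1.rounds + 1, σ1.calls, σ1.ops + d⟩ with hσ2
  have e : (Program.front d Q P).exec grad o σ = P.exec grad o σ2 := rfl
  obtain ⟨b1, b2⟩ := hP.exec grad o σ2
  obtain ⟨b3, b4, b5⟩ := hP.isPure.exec_eq grad o σ2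
  rw [← e] at b1 b2 b3 b4 b5
  simp only [hσ2] at b1 b2 b3 b4 b5
  rw [mem_writeVec] at b1
  obtain ⟨c1, c2, c3, c4⟩ := h _ _ _ _ hw a1 b1
  refine ⟨u, ?_, ?_, ?_, c2, c3, c4, by omega, by omega⟩
  · rw [a3] at c1; exact c1
  · rw [b3, a2, a3]
  · rw [b4, a3]

end Asks

theorem Computes.ite {d : ℕ} [NeZero d] {P Q : Program} {F G : Mem d → Mem d} {c : ℕ} (a b : Fin 64)
    (hP : Computes P F c) (hQ : Computes Q G c) :
    Computes (.ite (Blk.addr (.inl a : Blk d)) (Blk.addr (.inl b : Blk d)) P Q)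
      (fun m => (open Classical in if m (.inl a) 0 ≤ m (.inl b) 0 then F m else G m)) (c + 1) := by
  refine ⟨⟨hP.isPure, hQ.isPure⟩, fun grad o σ => ?_, fun grad o σ => ?_⟩
  · have hcell : ∀ k : Fin 64, (mem σ.reg : Mem d) (.inl k) 0 = σ.reg (Blk.addr (.inl k : Blk d)) :=
      fun k => by simp [mem]
    rw [Program.exec, hcell, hcell]
    split_ifs
    · rw [hP.mem_exec]
    · rw [hQ.mem_exec]
  · rw [Program.exec]
    split_ifs
    · have := hP.ops_le grad o { σ with ops := σ.ops + 1 }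
      simp only at this
      omega
    · have := hQ.ops_le grad o { σ with ops := σ.ops + 1 }
      simp only at this
      omega

/-! ### The reductions as programs -/

section Fronts

variable {d : ℕ} [NeZero d]

/-- Post-processing for the unit ball. -/
def Program.ballPost (d : ℕ) : Program :=
  .seq (.vcopy (.inl 4 : Blk d) (.inl 5)) (.seq (.sconst d 50 1) (.vadd d 0 0 50 6))

/-- The reduction is trivial for the unit ball. -/
def Program.ballFront (d : ℕ) : Program :=
  .front d (.vcopy (.inl 6 : Blk d) (.inl 1)) (.ballPost d)

omit [NeZero d] in
-- The iterate is in the interior, so it is its own projection, `0` is a subgradient of the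
-- distance, and `ζ` is passed on unchanged.
theorem projRound_ball {w : Vec d} (hw : ‖w‖ < 1) (ζ : Vec d) :
    ProjRound (Metric.closedBall 0 1) w w ζ ζ := by
  have hmem : w ∈ Metric.closedBall (0 : Vec d) 1 := by simpa using hw.le
  refine ⟨0, fun y _ => ?_, hmem, fun z _ => by simp, by simp⟩
  rw [setDist_eq_zero (fun x => norm_nonneg x) norm_zero hmem]
  simpa using setDist_nonneg (fun x => norm_nonneg x) _ y

theorem isFront_ballFront (grad : ℕ → Vec d → Vec d) (o : Vec d → Option (Vec d)) :
    IsFront (Program.ballFront d) (ProjRound (Metric.closedBall 0 1)) grad o (9 * d) 0 := by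
  have hd : 1 ≤ d := NeZero.one_le
  have := isFront_front (round := ProjRound (Metric.closedBall 0 1))
    ((computes_vcopy (.inl 6 : Blk d) (.inl 1)).realizes.asks o)
    ((computes_vcopy (.inl 4 : Blk d) (.inl 5)).seq <| (computes_sconst 50 1).seq <|
      computes_vadd (k := 0) (s := 50) (by decide) 0 6).realizes grad (by
    rintro m m1 m3 ζ hw rfl rfl
    refine ⟨?_, ?_, fun k hk => ?_, fun j => ?_⟩
    · simpa using projRound_ball hw ζ
    · simp
    · have : k ≠ 0 ∧ k ≠ 4 ∧ k ≠ 5 ∧ k ≠ 6 ∧ k ≠ 50 := by omega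
      simp [this]
    · simp)
  intro σ hσ
  obtain ⟨u, h⟩ := this σ hσ
  exact ⟨u, h.1, h.2.1, h.2.2.1, h.2.2.2.1, h.2.2.2.2.1, h.2.2.2.2.2.1,
    h.2.2.2.2.2.2.1.trans (by omega), h.2.2.2.2.2.2.2⟩

/-- Post-processing for Euclidean projections. -/
def Program.projPost (d : ℕ) : Program :=
  .seq (.seq (.sconst d 50 1) <| .seq (.vadd d 0 0 50 6) <| .seq (.sconst d 51 (-1)) <|
    .seq (.vadd d 7 1 51 6) <| .seq (.sdot d 50 5 7) <| .seq (.sdot d 53 7 7) (.sconst d 52 0)) <|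
  .seq (.ite (Blk.addr (.inl 52 : Blk d)) (Blk.addr (.inl 50 : Blk d)) (.sconst d 50 0)
    (.sop d .divide 50 50 53)) <|
  .seq (.sop d .times 50 51 50) (.vadd d 4 5 50 7)

/-- The machine has no square roots: the correction along the unit normal is written with the
unnormalized vector `w - u` and division by its squared length. If `w = u`, the sign test fails and
the division is skipped. -/
theorem realizes_projPost : Realizes (d := d) (Program.projPost d) (30 * d) fun m m' =>
    m' (.inl 4) = m (.inl 5) - (
      if m (.inl 5) ⬝ᵥ (m (.inl 1) - m (.inl 6)) < 0 then
        m (.inl 5) ⬝ᵥ (m (.inl 1) - m (.inl 6)) /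
          ((m (.inl 1) - m (.inl 6)) ⬝ᵥ (m (.inl 1) - m (.inl 6))) else 0)
        • (m (.inl 1) - m (.inl 6)) ∧
    m' (.inl 0) = m (.inl 0) + m (.inl 6) ∧
    (∀ k : Fin 64, (k = 1 ∨ k = 2 ∨ k = 3) → m' (.inl k) = m (.inl k)) ∧
    ∀ j, mat m' j = mat m j := by
  have h1 := ((computes_sconst (d := d) 50 1).seq <|
    (computes_vadd (k := 0) (s := 50) (by decide) 0 6).seq <|
    (computes_sconst 51 (-1)).seq <| (computes_vadd (k := 7) (s := 51) (by decide) 1 6).seq <|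
    (computes_sdot 50 5 7).seq <| (computes_sdot 53 7 7).seq <| computes_sconst 52 0).realizes.mono
    (S := fun m m1 => m1 (.inl 7) = m (.inl 1) - m (.inl 6) ∧
      m1 (.inl 50) 0 = m (.inl 5) ⬝ᵥ (m (.inl 1) - m (.inl 6)) ∧
      m1 (.inl 53) 0 = (m (.inl 1) - m (.inl 6)) ⬝ᵥ (m (.inl 1) - m (.inl 6)) ∧
      m1 (.inl 51) 0 = -1 ∧ m1 (.inl 52) 0 = 0 ∧ m1 (.inl 0) = m (.inl 0) + m (.inl 6) ∧
      (∀ k : Fin 64, k ≠ 0 → k < 7 → m1 (.inl k) = m (.inl k)) ∧ ∀ j, mat m1 j = mat m j)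
    (by
      rintro m m1 rfl
      refine ⟨?_, ?_, ?_, ?_, ?_, ?_, fun k hk hk' => ?_, fun j => ?_⟩
      · simp [← sub_eq_add_neg]
      · simp [← sub_eq_add_neg, -dotProduct_sub]
      · simp [← sub_eq_add_neg, -dotProduct_sub, -sub_dotProduct]
      · simp
      · simp
      · simp
      · have : k ≠ 7 ∧ k ≠ 50 ∧ k ≠ 51 ∧ k ≠ 52 ∧ k ≠ 53 := by omega
        simp [this, hk]
      · simp) le_rfl
  refine (h1.seq <|
    (Computes.ite 52 50 (computes_sconst 50 0) (computes_sop .divide 50 50 53)).realizes.seq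
    ((computes_sop .times 50 51 50).seq
      (computes_vadd (k := 4) (s := 50) (by decide) 5 7)).realizes).mono ?_ ?_
  · rintro m m'' ⟨m1, ⟨h7, h50, h53, h51, h52, h0, hk, hj⟩, m2, rfl, rfl⟩
    have h5 := hk 5 (by decide) (by decide)
    simp only [h50, h52]
    refine ⟨?_, ?_, fun k hk' => ?_, fun j => ?_⟩
    · split_ifs with h h' h'
      · exact absurd h (not_le.2 h')
      · simp [ArithOp.eval, h5]
      · simp [ArithOp.eval, h5, h51, h53, h7, ← sub_eq_add_neg, -dotProduct_sub, -sub_dotProduct]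
      · exact absurd (not_lt.1 h') h
    · split_ifs <;> simp [h0]
    · have : k ≠ 0 ∧ k ≠ 4 ∧ k ≠ 50 := by omega
      split_ifs <;> simp [this, hk k this.1 (by omega)]
    · split_ifs <;> simp [hj]
  · have : 1 ≤ d := NeZero.one_le
    omega

/-- The Euclidean projection computed by the oracle. -/
def Program.projQuery (d : ℕ) : Program :=
  .seq (.vcopy (.inl 6 : Blk d) (.inl 1)) (.queryDiscard d 1 5)

/-- The reduction based on Euclidean projections. -/
def Program.projFront (d : ℕ) : Program := .front d (.projQuery d) (.projPost d)

omit [NeZero d] in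
-- The unit vector from `u` towards `w` supports the distance function, by the obtuse-angle
-- characterization of the projection. For `w = u` the convention `0⁻¹ = 0` makes this vector `0`,
-- again a subgradient.
theorem projRound_of_projection {C : Set (Vec d)} (hC : Convex ℝ C) {w u : Vec d} (hu : u ∈ C)
    (h : ∀ z ∈ C, ‖u - w‖ ≤ ‖z - w‖) (ζ : Vec d) :
    ProjRound C w u ζ (ζ - (if (inner ℝ ζ (w - u) : ℝ) < 0 then
      (inner ℝ ζ (w - u) : ℝ) / inner ℝ (w - u) (w - u) else 0) • (w - u)) := by
  have : Nonempty C := ⟨⟨u, hu⟩⟩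
  refine ⟨‖w - u‖⁻¹ • (w - u), fun y _ => ?_, hu, h, ?_⟩
  · have hobt : ∀ x ∈ C, (inner ℝ (w - u) (x - u) : ℝ) ≤ 0 := by
      refine (norm_eq_iInf_iff_real_inner_le_zero hC hu).1 (le_antisymm (le_ciInf fun x => ?_)
        (ciInf_le ⟨0, by rintro _ ⟨x, rfl⟩; exact norm_nonneg _⟩ (⟨u, hu⟩ : C)))
      rw [norm_sub_rev, norm_sub_rev w]
      exact h x x.2
    have hw : setDist (fun x => ‖x‖) C w ≤ ‖w - u‖ :=
      setDist_le (fun x => norm_nonneg x) hu w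
    unfold setDist at hw ⊢
    refine le_ciInf fun x => ?_
    rcases eq_or_ne (w - u) 0 with h0 | h0
    · have := norm_nonneg (y - x)
      rw [h0, norm_zero] at hw
      rw [h0]
      simp only [smul_zero, inner_zero_left]
      linarith
    · have hp : 0 < ‖w - u‖ := norm_pos_iff.2 h0
      have h1 : (inner ℝ (‖w - u‖⁻¹ • (w - u)) (y - x) : ℝ) ≤ ‖y - x‖ := by
        refine (real_inner_le_norm _ _).trans_eq ?_
        rw [norm_smul, norm_inv, norm_norm, inv_mul_cancel₀ hp.ne', one_mul]
      have h2 : (inner ℝ (‖w - u‖⁻¹ • (w - u)) (x - u) : ℝ) ≤ 0 := by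
        rw [inner_smul_left]
        exact mul_nonpos_of_nonneg_of_nonpos (by simp) (hobt x x.2)
      have h3 : (inner ℝ (‖w - u‖⁻¹ • (w - u)) (w - u) : ℝ) = ‖w - u‖ := by
        rw [inner_smul_left, real_inner_self_eq_norm_sq, conj_trivial]
        field_simp
      have h4 : (inner ℝ (‖w - u‖⁻¹ • (w - u)) (y - w) : ℝ)
          = inner ℝ (‖w - u‖⁻¹ • (w - u)) (y - x) + inner ℝ (‖w - u‖⁻¹ • (w - u)) (x - u)
            - inner ℝ (‖w - u‖⁻¹ • (w - u)) (w - u) := by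
        rw [← inner_add_right, ← inner_sub_right]
        congr 1
        abel
      linarith
  · congr 1
    rcases eq_or_ne (w - u) 0 with h0 | h0
    · simp [h0]
    · have hp : 0 < ‖w - u‖ := norm_pos_iff.2 h0
      rw [inner_smul_right, smul_smul, real_inner_self_eq_norm_sq]
      congr 1
      have : ‖w - u‖⁻¹ * inner ℝ ζ (w - u) < 0 ↔ (inner ℝ ζ (w - u) : ℝ) < 0 := by
        rw [mul_neg_iff]
        simp [hp, not_lt.2 hp.le]
      simp only [this]
      split_ifs
      · field_simp
      · simp

omit [NeZero d] in
theorem getD_projOracle {C : Set (Vec d)} {o : Vec d → Option (Vec d)} (ho : IsProjOracle C o)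
    (w : Vec d) : (o w).getD w ∈ C ∧ ∀ z ∈ C, ‖(o w).getD w - w‖ ≤ ‖z - w‖ := by
  cases h : o w with
  | none => exact ⟨(ho w).1 h, fun z _ => by simp⟩
  | some y => exact (ho w).2 y h

theorem isFront_projFront {C : Set (Vec d)} (hC : Convex ℝ C) (grad : ℕ → Vec d → Vec d)
    {o : Vec d → Option (Vec d)} (ho : IsProjOracle C o) :
    IsFront (Program.projFront d) (ProjRound C) grad o (d * 2 + (d + 1) + d + 30 * d) (0 + 1) := by
  refine isFront_front (((computes_vcopy (.inl 6 : Blk d) (.inl 1)).realizes.asks o).seq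
    (asks_queryDiscard o 1 6 rfl)) realizes_projPost grad ?_
  rintro m m1 m3 ζ hw ⟨m0, rfl, rfl⟩ ⟨h1, h2, h3, h4⟩
  simp only [update_inl, mat_update_inl] at h1 h2 h3 h4 ⊢
  simp only [Fin.reduceEq, if_false, if_true] at h1 h2 h3 h4 ⊢
  obtain ⟨g1, g2⟩ := getD_projOracle ho (WithLp.toLp 2 (m (.inl 1)))
  set u := (o (WithLp.toLp 2 (m (.inl 1)))).getD (WithLp.toLp 2 (m (.inl 1))) with hu
  refine ⟨?_, h2, fun k hk => ?_, h4⟩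
  · have := projRound_of_projection hC g1 g2 ζ
    rw [← dotProduct_ofLp, ← dotProduct_ofLp] at this
    have e : (WithLp.toLp 2 (m3 (.inl 4)) : Vec d) = _ := congrArg (WithLp.toLp 2) h1
    rw [e]
    convert this using 1
    apply WithLp.ofLp_injective
    simp only [WithLp.ofLp_sub, WithLp.ofLp_smul]
    by_cases hh : ζ.ofLp ⬝ᵥ (m (.inl 1) - u.ofLp) < 0 <;> simp only [hh, if_true, if_false]
  · have : k ≠ 5 ∧ k ≠ 6 := by omega
    rw [h3 k hk]
    simp [this]

end Fronts

/-! ### The reduction based on the gauge -/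

section Gauge

variable {d : ℕ}

/-- State of a bisection for the gauge of `w`: the point `w / hi` belongs to `C`, and `s` separates
`w / lo` from `C`. -/
structure Bracket (C : Set (Vec d)) (w : Vec d) (gap lo hi : ℝ) (s : Vec d) : Prop where
  one_le : 1 ≤ lo
  le : lo ≤ hi
  sub_eq : hi - lo = gap
  mem : hi⁻¹ • w ∈ C
  sep : ∀ z ∈ C, (inner ℝ s z : ℝ) < inner ℝ s (lo⁻¹ • w)

/-- The inner ball guarantees that `w / √d` belongs to `C`, and the separator from the first query
serves at the lower endpoint `1`. -/
theorem Bracket.init {C : Set (Vec d)} (hd : 1 ≤ d) (hC : IsSymmetricBody C) {w s : Vec d}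
    (hw : ‖w‖ < 1) (hs : ∀ z ∈ C, (inner ℝ s z : ℝ) < inner ℝ s w) :
    Bracket C w (√d - 1) 1 (√d) s := by
  have h1 : 1 ≤ √(d : ℝ) := Real.one_le_sqrt.2 (by exact_mod_cast hd)
  refine ⟨le_rfl, h1, rfl, hC.inner_ball ?_, by simpa using hs⟩
  rw [mem_closedBall_zero_iff, norm_smul, norm_inv, Real.norm_eq_abs, abs_of_nonneg (by positivity),
    one_div]
  exact mul_le_of_le_one_right (by positivity) hw.le

theorem Bracket.left {C : Set (Vec d)} {w s s' : Vec d} {gap lo hi : ℝ} (h : Bracket C w gap lo hi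
    s)
    (hs : ∀ z ∈ C, (inner ℝ s' z : ℝ) < inner ℝ s' ((1 / 2 * (lo + hi))⁻¹ • w)) :
    Bracket C w (gap / 2) (1 / 2 * (lo + hi)) hi s' :=
  ⟨by linarith [h.one_le, h.le], by linarith [h.le], by rw [← h.sub_eq]; ring, h.mem, hs⟩

theorem Bracket.right {C : Set (Vec d)} {w s : Vec d} {gap lo hi : ℝ} (h : Bracket C w gap lo hi s)
    (hs : (1 / 2 * (lo + hi))⁻¹ • w ∈ C) :
    Bracket C w (gap / 2) lo (1 / 2 * (lo + hi)) s :=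
  ⟨h.one_le, by linarith [h.le], by rw [← h.sub_eq]; ring, hs, h.sep⟩

/-- The data of a round of the reduction based on the gauge, without the subgradients. -/
def GaugeData (C : Set (Vec d)) (δ : ℝ) (w u ν : Vec d) : Prop :=
  ∃ γ : ℝ, IsSubgradient Set.univ (setDist (gauge C) C) δ w ν ∧ |γ - inner ℝ ν w| ≤ δ ∧
    u = (if 1 ≤ γ then γ⁻¹ • w else w) ∧ u ∈ C

theorem gaugeData_of_mem {C : Set (Vec d)} {δ : ℝ} (hδ : 0 ≤ δ) {w : Vec d} (hw : w ∈ C) :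
    GaugeData C δ w w 0 := by
  refine ⟨0, fun y _ => ?_, by simpa using hδ, by simp, hw⟩
  rw [setDist_eq_zero (fun x => gauge_nonneg x) gauge_zero hw]
  have := setDist_nonneg (fun x => gauge_nonneg (s := C) x) C y
  simp only [inner_zero_left]
  linarith

theorem inner_le_gauge {C : Set (Vec d)} (hd : 1 ≤ d) (hC : IsSymmetricBody C) {ν : Vec d}
    (hν : ∀ z ∈ C, (inner ℝ ν z : ℝ) ≤ 1) (y : Vec d) : (inner ℝ ν y : ℝ) ≤ gauge C y := by
  refine le_csInf ((absorbent_of_isSymmetricBody hd hC).gauge_set_nonempty) ?_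
  rintro r ⟨hr, z, hz, rfl⟩
  simp only [inner_smul_right]
  nlinarith [hν z hz]

/-- Scale the separator at `w / lo` so that `⟨ν, w⟩ = lo`; then `⟨ν, z⟩ ≤ 1` on `C`, and therefore
`S y ≥ ⟨ν, y⟩ - 1`. The point `w / hi` shows `S w ≤ hi - 1`. The error in the subgradient inequality
is thus at most `hi - lo`, which also bounds the error of `γ = hi`; this choice of `γ` keeps the
played point in `C`. -/
theorem Bracket.gaugeData {C : Set (Vec d)} (hd : 1 ≤ d) (hC : IsSymmetricBody C) {w s : Vec d}
    {gap lo hi δ : ℝ} (h : Bracket C w gap lo hi s) (hδ : gap ≤ δ) :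
    GaugeData C δ w (hi⁻¹ • w) ((lo / inner ℝ s w) • s) := by
  have h0 := h.sep 0 (zero_mem_of_isSymmetricBody hC)
  have hlo : 0 < lo := by linarith [h.one_le]
  have hhi : 1 ≤ hi := h.one_le.trans h.le
  have hne : Nonempty C := ⟨⟨_, h.mem⟩⟩
  rw [inner_zero_right, inner_smul_right] at h0
  have hsw : 0 < (inner ℝ s w : ℝ) := by
    rw [inv_mul_eq_div] at h0
    exact (div_pos_iff_of_pos_right hlo).1 h0
  have hν : ∀ z ∈ C, (inner ℝ ((lo / inner ℝ s w) • s) z : ℝ) ≤ 1 := fun z hz => by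
    have := h.sep z hz
    rw [inner_smul_right, inv_mul_eq_div, lt_div_iff₀ hlo] at this
    rw [inner_smul_left, conj_trivial, div_mul_eq_mul_div, div_le_one hsw]
    linarith
  have hνw : (inner ℝ ((lo / inner ℝ s w) • s) w : ℝ) = lo := by
    rw [inner_smul_left, conj_trivial]
    field_simp
  have hgw : setDist (gauge C) C w ≤ hi - 1 := by
    refine (setDist_le (fun x => gauge_nonneg x) h.mem w).trans ?_
    have e : w - hi⁻¹ • w = (hi - 1) • (hi⁻¹ • w) := by
      rw [smul_smul, sub_mul, mul_inv_cancel₀ (by positivity), sub_smul, one_smul, one_mul]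
    rw [e, gauge_smul_of_nonneg (by linarith), smul_eq_mul]
    exact mul_le_of_le_one_right (by linarith) (gauge_le_one_of_mem h.mem)
  refine ⟨hi, fun y _ => ?_, ?_, by rw [if_pos hhi], h.mem⟩
  · have hy : (inner ℝ ((lo / inner ℝ s w) • s) y : ℝ) - 1 ≤ setDist (gauge C) C y := by
      refine le_ciInf fun x => ?_
      have h1 := inner_le_gauge hd hC hν (y - x)
      rw [inner_sub_right] at h1
      linarith [hν x x.2]
    rw [inner_sub_right, hνw]
    linarith [h.sub_eq]
  · rw [hνw, h.sub_eq, abs_of_nonneg (by linarith [h.sub_eq, h.le])]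
    exact hδ

theorem sqrt_sub_one_div_le (hd : 1 ≤ d) {T : ℕ} (hT : 1 ≤ T) :
    (√d - 1) / 2 ^ Nat.clog 2 (d * T) ≤ 1 / (T : ℝ) := by
  have h1 : ((d * T : ℕ) : ℝ) ≤ ((2 ^ Nat.clog 2 (d * T) : ℕ) : ℝ) := by
    exact_mod_cast Nat.le_pow_clog (by norm_num) _
  push_cast at h1
  have hd' : (1 : ℝ) ≤ d := by exact_mod_cast hd
  have hT' : (1 : ℝ) ≤ T := by exact_mod_cast hT
  have h2 : √(d : ℝ) ≤ d := Real.sqrt_le_left (by positivity) |>.2 (by nlinarith)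
  rw [div_le_div_iff₀ (by positivity) (by positivity)]
  nlinarith

variable [NeZero d]

/-- One step of the bisection. -/
def Program.bisectStep (d : ℕ) : Program :=
  .seq (.seq (.sop d .plus 11 8 9) <| .seq (.sconst d 50 (1 / 2)) <| .seq (.sop d .times 11 50
    11) <|
    .seq (.sconst d 50 1) <| .seq (.sop d .divide 50 50 11) (.vscl d 6 50 1))
  (.queryBranch d 6 9 (.vcopy (.inl 9 : Blk d) (.inl 11))
    (.seq (.vcopy (.inl 8 : Blk d) (.inl 11)) (.vcopy (.inl 7 : Blk d) (.inl 10))))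

/-- The midpoint becomes the upper endpoint if the oracle accepts it; otherwise it becomes the lower
endpoint and the returned vector replaces the separator. -/
theorem asks_bisectStep {C : Set (Vec d)} {o : Vec d → Option (Vec d)} (ho : IsSepOracle C o) :
    Asks o (Program.bisectStep d) (20 * d) 1 fun m m' =>
      (∀ gap, Bracket C (WithLp.toLp 2 (m (.inl 1))) gap (m (.inl 8) 0) (m (.inl 9) 0)
          (WithLp.toLp 2 (m (.inl 7))) →
        Bracket C (WithLp.toLp 2 (m (.inl 1))) (gap / 2) (m' (.inl 8) 0) (m' (.inl 9) 0)
          (WithLp.toLp 2 (m' (.inl 7)))) ∧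
      (∀ k < 6, m' (.inl k) = m (.inl k)) ∧ ∀ j, mat m' j = mat m j := by
  have hd : 1 ≤ d := NeZero.one_le
  refine ((((computes_sop (d := d) .plus 11 8 9).seq <| (computes_sconst 50 (1 / 2)).seq <|
    (computes_sop .times 11 50 11).seq <| (computes_sconst 50 1).seq <|
    (computes_sop .divide 50 50 11).seq <|
    computes_vscl (k := 6) (s := 50) (by decide) 1).realizes.mono
      (S := fun m m1 => m1 (.inl 11) 0 = 1 / 2 * (m (.inl 8) 0 + m (.inl 9) 0) ∧
        m1 (.inl 6) = (1 / 2 * (m (.inl 8) 0 + m (.inl 9) 0))⁻¹ • m (.inl 1) ∧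
        (∀ k : Fin 64, k < 10 → k ≠ 6 → m1 (.inl k) = m (.inl k)) ∧ ∀ j, mat m1 j = mat m j)
      (by
        rintro m m1 rfl
        refine ⟨?_, ?_, fun k hk hk' => ?_, fun j => ?_⟩
        · simp [ArithOp.eval]
        · simp [ArithOp.eval]
        · have : k ≠ 11 ∧ k ≠ 50 := by omega
          simp [this, hk']
        · simp) (c' := d + 5) (by omega)).asks o).seq
    (((computes_vcopy (.inl 9 : Blk d) (.inl 11)).realizes.mono (fun _ _ h => h)
      (c' := d * 4) (by omega)).asks o |>.queryBranch
      (((computes_vcopy (.inl 8 : Blk d) (.inl 11)).seq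
        (computes_vcopy (.inl 7 : Blk d) (.inl 10))).realizes.mono (fun _ _ h => h)
      (c' := d * 4) (by omega) |>.asks o) 6 10 (n := 9) rfl (by norm_num)) |>.mono ?_ (by omega)
      (by omega)
  rintro m m'' ⟨m1, ⟨h11, h6, hk, hj⟩, hyes, hno⟩
  rw [h6] at hyes hno
  cases h : o (WithLp.toLp 2 ((1 / 2 * (m (.inl 8) 0 + m (.inl 9) 0))⁻¹ • m (.inl 1))) with
  | none =>
    have e := hyes h
    rw [e]
    refine ⟨fun gap hb => ?_, fun k hk' => ?_, fun j => ?_⟩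
    · simp only [update_inl, Fin.reduceEq, if_false, if_true]
      rw [h11, hk 8 (by decide) (by decide), hk 7 (by decide) (by decide)]
      exact hb.right ((ho _).1 h)
    · have : k ≠ 9 := by omega
      simp [this, hk k (by omega) (by omega)]
    · simp [hj]
  | some x =>
    have e := hno x h
    rw [e]
    refine ⟨fun gap hb => ?_, fun k hk' => ?_, fun j => ?_⟩
    · simp only [update_inl, Fin.reduceEq, if_false, if_true]
      rw [h11, hk 9 (by decide) (by decide)]
      exact hb.left ((ho _).2 x h)
    · have : k ≠ 7 ∧ k ≠ 8 ∧ k ≠ 10 := by omega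
      simp [this, hk k (by omega) (by omega)]
    · simp [hj]

/-- Approximation of the gauge by bisection. -/
def Program.bisect (d L : ℕ) : Program :=
  .seq (.seq (.sconst d 8 1) <| .seq (.sconst d 9 (√d)) (.vcopy (.inl 7 : Blk d) (.inl 10))) <|
  .seq (.loop (fun _ => .bisectStep d) L) <|
  .seq (.sconst d 50 1) <| .seq (.sop d .divide 50 50 9) <| .seq (.vscl d 6 50 1) <|
  .seq (.sdot d 50 7 1) <| .seq (.sop d .divide 50 8 50) (.vscl d 12 50 7)

theorem asks_bisect {C : Set (Vec d)} (hC : IsSymmetricBody C) {o : Vec d → Option (Vec d)}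
    (ho : IsSepOracle C o) {T : ℕ} (hT : 1 ≤ T) :
    Asks o (Program.bisect d (Nat.clog 2 (d * T))) (Nat.clog 2 (d * T) * (20 * d) + 20 * d)
      (Nat.clog 2 (d * T)) fun m m' =>
      (‖WithLp.toLp 2 (m (.inl 1))‖ < 1 → (∀ z ∈ C, (inner ℝ (WithLp.toLp 2 (m (.inl 10))) z : ℝ)
          < inner ℝ (WithLp.toLp 2 (m (.inl 10))) (WithLp.toLp 2 (m (.inl 1)))) →
        GaugeData C (1 / T) (WithLp.toLp 2 (m (.inl 1))) (WithLp.toLp 2 (m' (.inl 6)))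
          (WithLp.toLp 2 (m' (.inl 12)))) ∧
      (∀ k < 6, m' (.inl k) = m (.inl k)) ∧ ∀ j, mat m' j = mat m j := by
  have hd : 1 ≤ d := NeZero.one_le
  have hloop := Asks.loop (n := Nat.clog 2 (d * T)) (P := fun _ => Program.bisectStep d)
    (fun _ _ => asks_bisectStep ho) (I := fun i m m' =>
      (∀ gap, Bracket C (WithLp.toLp 2 (m (.inl 1))) gap (m (.inl 8) 0) (m (.inl 9) 0)
          (WithLp.toLp 2 (m (.inl 7))) →
        Bracket C (WithLp.toLp 2 (m (.inl 1))) (gap / 2 ^ i) (m' (.inl 8) 0) (m' (.inl 9) 0)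
          (WithLp.toLp 2 (m' (.inl 7)))) ∧
      (∀ k < 6, m' (.inl k) = m (.inl k)) ∧ ∀ j, mat m' j = mat m j)
    (fun m => ⟨fun gap h => by simpa using h, fun _ _ => rfl, fun _ => rfl⟩)
    (by
      rintro i hi m m' m'' ⟨h1, h2, h3⟩ ⟨k1, k2, k3⟩
      refine ⟨fun gap h => ?_, fun k hk => (k2 k hk).trans (h2 k hk), fun j => (k3 j).trans (h3 j)⟩
      have e := h1 gap h
      rw [← h2 1 (by decide)] at e ⊢
      rw [pow_succ, ← div_div]
      exact k1 _ e)
  refine (((computes_sconst (d := d) 8 1).seq <| (computes_sconst 9 (√d)).seq <|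
    computes_vcopy (.inl 7 : Blk d) (.inl 10)).realizes.asks o).seq (hloop.seq
    (((computes_sconst 50 1).seq <| (computes_sop .divide 50 50 9).seq <|
      (computes_vscl (k := 6) (s := 50) (by decide) 1).seq <| (computes_sdot 50 7 1).seq <|
      (computes_sop .divide 50 8 50).seq <|
      computes_vscl (k := 12) (s := 50) (by decide) 7).realizes.asks o)) |>.mono ?_ (by omega)
      (by omega)
  rintro m m3 ⟨m1, rfl, m2, ⟨h1, h2, h3⟩, rfl⟩
  refine ⟨fun hw hs => ?_, fun k hk => ?_, fun j => ?_⟩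
  · have hb := h1 (√d - 1) (by simpa using Bracket.init hd hC hw hs)
    have e1 : m2 (.inl 1) = m (.inl 1) := by rw [h2 1 (by decide)]; simp
    have hg := hb.gaugeData hd hC (sqrt_sub_one_div_le hd hT)
    rw [← h2 1 (by decide)] at hg
    rw [← dotProduct_ofLp] at hg
    rw [← e1]
    convert hg using 1
    · simp [ArithOp.eval]
    · simp [ArithOp.eval]
  · have : k ≠ 6 ∧ k ≠ 7 ∧ k ≠ 8 ∧ k ≠ 9 ∧ k ≠ 12 ∧ k ≠ 50 := by omega
    simp [this, h2 k hk]
  · simp [h3]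

/-- Membership test, followed by the bisection for points outside the body. -/
def Program.gaugeQuery (d L : ℕ) : Program :=
  .queryBranch d 1 9 (.seq (.vcopy (.inl 6 : Blk d) (.inl 1)) (.vzero (.inl 12 : Blk d)))
    (.bisect d L)

/-- Post-processing for the gauge. -/
def Program.gaugePost (d : ℕ) : Program :=
  .seq (.seq (.sconst d 50 1) <| .seq (.vadd d 0 0 50 6) <| .seq (.sdot d 50 5 1) <|
    .seq (.sdot d 51 5 6) (.sconst d 52 0)) <|
  .seq (.ite (Blk.addr (.inl 52 : Blk d)) (Blk.addr (.inl 50 : Blk d)) (.sconst d 51 0) .skip) <|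
  .seq (.sconst d 50 (-1)) <| .seq (.sop d .times 50 50 51) (.vadd d 4 5 50 12)

theorem realizes_gaugePost : Realizes (d := d) (Program.gaugePost d) (30 * d) fun m m' =>
    m' (.inl 4) = m (.inl 5) - (
      if m (.inl 5) ⬝ᵥ m (.inl 1) < 0 then m (.inl 5) ⬝ᵥ m (.inl 6) else 0) • m (.inl 12) ∧
    m' (.inl 0) = m (.inl 0) + m (.inl 6) ∧
    (∀ k : Fin 64, (k = 1 ∨ k = 2 ∨ k = 3) → m' (.inl k) = m (.inl k)) ∧
    ∀ j, mat m' j = mat m j := by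
  have h1 := ((computes_sconst (d := d) 50 1).seq <|
    (computes_vadd (k := 0) (s := 50) (by decide) 0 6).seq <| (computes_sdot 50 5 1).seq <|
    (computes_sdot 51 5 6).seq <| computes_sconst 52 0).realizes.mono
    (S := fun m m1 => m1 (.inl 50) 0 = m (.inl 5) ⬝ᵥ m (.inl 1) ∧
      m1 (.inl 51) 0 = m (.inl 5) ⬝ᵥ m (.inl 6) ∧
      m1 (.inl 52) 0 = 0 ∧ m1 (.inl 0) = m (.inl 0) + m (.inl 6) ∧
      (∀ k : Fin 64, k ≠ 0 → k < 13 → m1 (.inl k) = m (.inl k)) ∧ ∀ j, mat m1 j = mat m j)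
    (by
      rintro m m1 rfl
      refine ⟨?_, ?_, ?_, ?_, fun k hk hk' => ?_, fun j => ?_⟩
      · simp
      · simp
      · simp
      · simp
      · have : k ≠ 50 ∧ k ≠ 51 ∧ k ≠ 52 := by omega
        simp [this, hk]
      · simp) le_rfl
  refine (h1.seq <| (Computes.ite 52 50 (computes_sconst 51 0)
    (Computes.skip.congr (fun _ => rfl) (Nat.zero_le 1))).realizes.seq
    ((computes_sconst 50 (-1)).seq <| (computes_sop .times 50 50 51).seq
      (computes_vadd (k := 4) (s := 50) (by decide) 5 12)).realizes).mono ?_ ?_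
  · rintro m m'' ⟨m1, ⟨h50, h51, h52, h0, hk, hj⟩, m2, rfl, rfl⟩
    have h5 := hk 5 (by decide) (by decide)
    have h12 := hk 12 (by decide) (by decide)
    simp only [h50, h52]
    refine ⟨?_, ?_, fun k hk' => ?_, fun j => ?_⟩
    · split_ifs with h h' h'
      · exact absurd h (not_le.2 h')
      · simp [ArithOp.eval, h5]
      · simp [ArithOp.eval, h5, h51, h12, ← sub_eq_add_neg]
      · exact absurd (not_lt.1 h') h
    · split_ifs <;> simp [h0]
    · have : k ≠ 0 ∧ k ≠ 4 ∧ k ≠ 50 ∧ k ≠ 51 := by omega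
      split_ifs <;> simp [this, hk k this.1 (by omega)]
    · split_ifs <;> simp [hj]
  · have : 1 ≤ d := NeZero.one_le
    omega

/-- The reduction based on the gauge, with the accuracy `1 / T`. -/
def Program.gaugeFront (d T : ℕ) : Program :=
  .front d (.gaugeQuery d (Nat.clog 2 (d * T))) (.gaugePost d)

/-- If the first query accepts `w`, it is played with `ν = 0`. Otherwise its answer starts the
bisection from a gap `√d - 1`, and `Nat.clog 2 (d * T)` halvings bring the gap below `1/T`. -/
theorem isFront_gaugeFront {C : Set (Vec d)} (hC : IsSymmetricBody C) (grad : ℕ → Vec d → Vec d)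
    {o : Vec d → Option (Vec d)} (ho : IsSepOracle C o) {T : ℕ} (hT : 1 ≤ T) :
    IsFront (Program.gaugeFront d T) (GaugeRound C (1 / T)) grad o
      (Nat.clog 2 (d * T) * (20 * d) + 20 * d + d + 2 + d + 30 * d) (Nat.clog 2 (d * T) + 1) := by
  have hd : 1 ≤ d := NeZero.one_le
  refine isFront_front (((((computes_vcopy (.inl 6 : Blk d) (.inl 1)).seq
    (computes_vzero (.inl 12))).realizes.asks o).mono (fun _ _ h => h) (by omega)
      (Nat.zero_le _)).queryBranch (asks_bisect hC ho hT) 1 10 (n := 9) rfl (by norm_num))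
      realizes_gaugePost grad ?_
  rintro m m1 m3 ζ hw ⟨hyes, hno⟩ ⟨h1, h2, h3, h4⟩
  simp only [update_inl, mat_update_inl] at h1 h2 h3 h4
  simp only [Fin.reduceEq, if_false, if_true] at h1 h2 h3 h4
  have key : GaugeData C (1 / T) (WithLp.toLp 2 (m (.inl 1))) (WithLp.toLp 2 (m1 (.inl 6)))
        (WithLp.toLp 2 (m1 (.inl 12))) ∧
      (∀ k < 5, m1 (.inl k) = m (.inl k)) ∧ ∀ j, mat m1 j = mat m j := by
    cases h : o (WithLp.toLp 2 (m (.inl 1))) with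
    | none =>
      rw [hyes h]
      refine ⟨?_, fun k hk => ?_, fun j => ?_⟩
      · simpa using gaugeData_of_mem (C := C) (δ := 1 / T) (by positivity) ((ho _).1 h)
      · have : k ≠ 6 ∧ k ≠ 12 := by omega
        simp [this]
      · simp
    | some x =>
      obtain ⟨k1, k2, k3⟩ := hno x h
      refine ⟨?_, fun k hk => ?_, fun j => ?_⟩
      · simpa using k1 (by simpa using hw) (by simpa using (ho _).2 x h)
      · have : k ≠ 10 := by omega
        rw [k2 k (by omega)]
        simp [this]
      · rw [k3]; simp
  obtain ⟨⟨γ, g1, g2, g3, g4⟩, k2, k3⟩ := key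
  refine ⟨⟨_, γ, g1, g2, g3, g4, ?_⟩, ?_, fun k hk => ?_, fun j => ?_⟩
  · have e : (WithLp.toLp 2 (m3 (.inl 4)) : Vec d) = _ := congrArg (WithLp.toLp 2) h1
    rw [e, k2 1 (by decide)]
    apply WithLp.ofLp_injective
    rw [← dotProduct_ofLp, ← dotProduct_ofLp]
    simp only [WithLp.ofLp_sub, WithLp.ofLp_smul]
  · rw [h2, k2 0 (by decide)]
  · have : k ≠ 5 := by omega
    rw [h3 k hk, if_neg this, k2 k (by omega)]
  · rw [h4, k3]

end Gauge

/-! ### Measurability of computations -/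

section Measurability

variable {d : ℕ} {Ω : Type*} {Ξ : Type*} [MeasurableSpace Ξ] {ξ : ℕ → Ω → Ξ}

theorem past_mono (ξ : ℕ → Ω → Ξ) {s t : ℕ} (h : s ≤ t) : past ξ s ≤ past ξ t :=
  iSup₂_le fun r hr => le_iSup₂_of_le r (hr.trans_le h) le_rfl

theorem measurable_past_sample (ξ : ℕ → Ω → Ξ) (t : ℕ) : Measurable[past ξ (t + 1)] (ξ t) :=
  (comap_measurable (ξ t)).mono (le_iSup₂_of_le t (Nat.lt_succ_self t) le_rfl) le_rfl

/-- After `n` rounds, the registers and the points played are determined by the past. -/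
structure Adapted (ξ : ℕ → Ω → Ξ) (n : ℕ) (σ : Ω → State d) : Prop where
  rounds : ∀ ω, (σ ω).rounds = n
  reg : ∀ r, Measurable[past ξ n] fun ω => (σ ω).reg r
  played : ∀ t < n, Measurable[past ξ t] fun ω => (σ ω).played t

theorem Program.exec_played (P : Program) (grad : ℕ → Vec d → Vec d) (o : Vec d → Option (Vec d))
    (σ : State d) : σ.rounds ≤ (P.exec grad o σ).rounds ∧
      ∀ t < σ.rounds, (P.exec grad o σ).played t = σ.played t := by
  induction P generalizing σ with
  | skip => exact ⟨le_rfl, fun _ _ => rfl⟩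
  | const => exact ⟨le_rfl, fun _ _ => rfl⟩
  | arith => exact ⟨le_rfl, fun _ _ => rfl⟩
  | call => exact ⟨le_rfl, fun _ _ => rfl⟩
  | ite a b p q ihp ihq =>
    simp only [Program.exec]
    split_ifs
    exacts [ihp { σ with ops := σ.ops + 1 }, ihq { σ with ops := σ.ops + 1 }]
  | seq p q ihp ihq =>
    obtain ⟨h1, h2⟩ := ihp σ
    obtain ⟨h3, h4⟩ := ihq (p.exec grad o σ)
    exact ⟨h1.trans h3, fun t ht => (h4 t (ht.trans_le h1)).trans (h2 t ht)⟩
  | play => exact ⟨Nat.le_succ _, fun t ht => Function.update_of_ne ht.ne _ _⟩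

/-- The program plays `k` rounds and preserves adaptedness. -/
def Preserves (ξ : ℕ → Ω → Ξ) (G : Vec d → Ξ → Vec d) (o : Vec d → Option (Vec d)) (P : Program)
    (k : ℕ) : Prop :=
  ∀ n (σ : Ω → State d), Adapted ξ n σ →
    Adapted ξ (n + k) fun ω => P.exec (fun t x => G x (ξ t ω)) o (σ ω)

variable {G : Vec d → Ξ → Vec d} {o : Vec d → Option (Vec d)} {P Q : Program} {k k' : ℕ}

theorem Preserves.seq (hP : Preserves ξ G o P k) (hQ : Preserves ξ G o Q k') :
    Preserves ξ G o (.seq P Q) (k + k') := fun n σ h => by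
  rw [← add_assoc]
  exact hQ _ _ (hP _ _ h)

theorem Preserves.skip : Preserves ξ G o .skip 0 := fun _ _ h => h

theorem Preserves.loop {P : ℕ → Program} (h : ∀ i, Preserves ξ G o (P i) k) (T : ℕ) :
    Preserves ξ G o (Program.loop P T) (T * k) := by
  induction T with
  | zero => rw [zero_mul]; exact Preserves.skip
  | succ T ih => rw [Nat.succ_mul]; exact ih.seq (h T)

theorem Adapted.congr {n : ℕ} {σ σ' : Ω → State d} (h : Adapted ξ n σ)
    (h1 : ∀ ω, (σ' ω).rounds = (σ ω).rounds) (h2 : ∀ ω, (σ' ω).played = (σ ω).played)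
    (h3 : ∀ r, Measurable[past ξ n] fun ω => (σ' ω).reg r) : Adapted ξ n σ' :=
  ⟨fun ω => (h1 ω).trans (h.rounds ω), h3, fun t ht => by simpa only [h2] using h.played t ht⟩

theorem measurable_update {m : MeasurableSpace Ω} {reg : Ω → ℕ → ℝ} {x : Ω → ℝ} {a : ℕ}
    (hreg : ∀ r, Measurable fun ω => reg ω r) (hx : Measurable x) (r : ℕ) :
    Measurable fun ω => Function.update (reg ω) a (x ω) r := by
  by_cases h : r = a
  · subst h; simpa only [Function.update_self] using hx
  · simpa only [Function.update_of_ne h] using hreg r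

theorem measurable_readVec {m : MeasurableSpace Ω} {reg : Ω → ℕ → ℝ} (a : ℕ)
    (hreg : ∀ r, Measurable fun ω => reg ω r) : Measurable fun ω => readVec d (reg ω) a :=
  (WithLp.measurable_toLp 2 (Fin d → ℝ)).comp (measurable_pi_iff.2 fun i => hreg (a + i))

theorem measurable_writeVec {m : MeasurableSpace Ω} {reg : Ω → ℕ → ℝ} {x : Ω → Vec d} (a : ℕ)
    (hreg : ∀ r, Measurable fun ω => reg ω r) (hx : Measurable x) (r : ℕ) :
    Measurable fun ω => writeVec (reg ω) a (x ω) r := by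
  unfold writeVec
  split_ifs with h
  · exact (measurable_pi_iff.1 ((WithLp.measurable_ofLp 2 (Fin d → ℝ)).comp hx)) _
  · exact hreg r

theorem measurable_arith {m : MeasurableSpace Ω} (op : ArithOp) {x y : Ω → ℝ} (hx : Measurable x)
    (hy : Measurable y) : Measurable fun ω => op.eval (x ω) (y ω) := by
  cases op
  exacts [hx.add hy, hx.sub hy, hx.mul hy, hx.div hy]

/-- Both branches play the same number of rounds, so the round counter stays deterministic. The
branching event is decided by the past at round `n`, and hence by every later past; points played
before `n` are unaffected. -/
theorem Preserves.ite (a b : ℕ) (hP : Preserves ξ G o P k) (hQ : Preserves ξ G o Q k) :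
    Preserves ξ G o (.ite a b P Q) k := fun n σ h => by
  have hσ : Adapted ξ n fun ω => { σ ω with ops := (σ ω).ops + 1 } :=
    h.congr (fun _ => rfl) (fun _ => rfl) h.reg
  have h1 := hP n _ hσ
  have h2 := hQ n _ hσ
  have hset : ∀ t, n ≤ t → MeasurableSet[past ξ t] {ω | (σ ω).reg a ≤ (σ ω).reg b} := fun t ht => by
    refine past_mono ξ ht _ ?_
    let := past ξ n
    exact measurableSet_le (h.reg a) (h.reg b)
  refine ⟨fun ω => ?_, fun r => ?_, fun t ht => ?_⟩
  · simp only [Program.exec]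
    split_ifs
    exacts [h1.rounds ω, h2.rounds ω]
  · simp only [Program.exec, apply_ite State.reg, ite_apply]
    exact Measurable.ite (hset _ (by omega)) (h1.reg r) (h2.reg r)
  · rcases lt_or_ge t n with htn | htn
    · have : (fun ω => ((Program.ite a b P Q).exec (fun t x => G x (ξ t ω)) o (σ ω)).played t)
          = fun ω => (σ ω).played t := by
        funext ω
        exact (Program.exec_played _ _ _ _).2 t (by rw [h.rounds]; exact htn)
      rw [this]
      exact h.played t htn
    · simp only [Program.exec, apply_ite State.played, ite_apply]
      exact Measurable.ite (hset t htn) (h1.played t ht) (h2.played t ht)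

theorem Program.IsPure.preserves (hP : P.IsPure) : Preserves ξ G o P 0 := by
  induction P with
  | skip => exact Preserves.skip
  | const r q =>
    exact fun n σ h => h.congr (fun _ => rfl) (fun _ => rfl) fun r' => measurable_update h.reg
      measurable_const r'
  | arith op r a b =>
    exact fun n σ h => h.congr (fun _ => rfl) (fun _ => rfl) fun r' => measurable_update h.reg
      (measurable_arith op (h.reg a) (h.reg b)) r'
  | ite a b p q ihp ihq => exact (ihp hP.1).ite a b (ihq hP.2)
  | seq p q ihp ihq => exact (ihp hP.1).seq (ihq hP.2)
  | play => exact hP.elim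
  | call => exact hP.elim

/-- The point is read before the sample of round `n` is revealed, whereas the registers receiving
the subgradient belong to the next past. This separation yields the exact adaptedness required by
independence. -/
theorem preserves_play (hG : Measurable fun q : Vec d × Ξ => G q.1 q.2) (a b : ℕ) :
    Preserves ξ G o (.play a b) 1 := fun n σ h => by
  have hread : Measurable[past ξ n] fun ω => readVec d (σ ω).reg a := by
    let := past ξ n
    exact measurable_readVec a h.reg
  have hle := past_mono ξ (Nat.le_succ n)
  refine ⟨fun ω => by simp [Program.exec, h.rounds], fun r => ?_, fun t ht => ?_⟩
  · have hg : Measurable[past ξ (n + 1)] fun ω => G (readVec d (σ ω).reg a) (ξ n ω) := by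
      let := past ξ (n + 1)
      exact hG.comp ((hread.mono hle le_rfl).prodMk (measurable_past_sample ξ n))
    simp only [Program.exec, h.rounds]
    let := past ξ (n + 1)
    exact measurable_writeVec b (fun r => (h.reg r).mono hle le_rfl) hg r
  · simp only [Program.exec, h.rounds]
    rcases Nat.lt_succ_iff_lt_or_eq.1 ht with ht | rfl
    · simpa only [Function.update_of_ne ht.ne] using h.played t ht
    · simpa only [Function.update_self] using hread

theorem preserves_call (ho : MeasurableSet {x | o x = none}) (ho' : Measurable fun x => (o x).getD
    0)
    (a b : ℕ) : Preserves ξ G o (.call a b) 0 := fun n σ h => by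
  refine h.congr (fun _ => rfl) (fun _ => rfl) fun r => ?_
  let := past ξ n
  have hread : Measurable fun ω => readVec d (σ ω).reg a := measurable_readVec a h.reg
  have e : (fun ω => ((Program.call a b).exec (fun t x => G x (ξ t ω)) o (σ ω)).reg r)
      = fun ω => if o (readVec d (σ ω).reg a) = none then Function.update (σ ω).reg b 1 r
        else writeVec (Function.update (σ ω).reg b 0) (b + 1)
          ((o (readVec d (σ ω).reg a)).getD 0) r := by
    funext ω
    simp only [Program.exec]
    cases o (readVec d (σ ω).reg a) <;> simp
  rw [e]
  exact Measurable.ite (hread ho) (measurable_update h.reg measurable_const r)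
    (measurable_writeVec (b + 1) (fun r => measurable_update h.reg measurable_const r)
      (ho'.comp hread) r)

/-- On `C` a projection oracle is free to answer `none` or to return the point itself, and this
choice need not be measurable. The completed answer is nevertheless the projection, a nonexpansive
map; discarding the flag erases the only nonmeasurable information. -/
theorem preserves_projQuery {C : Set (Vec d)} (hC : Convex ℝ C) (hoC : IsProjOracle C o) :
    Preserves ξ G o (.projQuery d) 0 := by
  have hcont : Continuous fun x => (o x).getD x := by
    refine LipschitzWith.continuous (K := 1) (LipschitzWith.of_dist_le_mul fun x y => ?_)
    have hobt : ∀ x, ∀ z ∈ C, (inner ℝ (x - (o x).getD x) (z - (o x).getD x) : ℝ) ≤ 0 := by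
      intro x
      obtain ⟨hx, hx'⟩ := getD_projOracle hoC x
      have : Nonempty C := ⟨⟨_, hx⟩⟩
      refine (norm_eq_iInf_iff_real_inner_le_zero hC hx).1 (le_antisymm (le_ciInf fun z => ?_)
        (ciInf_le ⟨0, by rintro _ ⟨x, rfl⟩; exact norm_nonneg _⟩ (⟨_, hx⟩ : C)))
      rw [norm_sub_rev, norm_sub_rev x]
      exact hx' z z.2
    set p := (o x).getD x with hp
    set q := (o y).getD y with hq
    have h1 := hobt x q (getD_projOracle hoC y).1
    have h2 := hobt y p (getD_projOracle hoC x).1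
    rw [← hp] at h1
    rw [← hq] at h2
    have h3 : ‖p - q‖ ^ 2 ≤ inner ℝ (x - y) (p - q) := by
      have e1 : (inner ℝ (x - p) (q - p) : ℝ) = -inner ℝ (x - p) (p - q) := by
        rw [← inner_neg_right, neg_sub]
      have e2 : (inner ℝ (x - y) (p - q) : ℝ) = inner ℝ (x - p) (p - q) - inner ℝ (y - q) (p - q)
          + inner ℝ (p - q) (p - q) := by
        rw [← inner_sub_left, ← inner_add_left]
        congr 1
        abel
      rw [e2, real_inner_self_eq_norm_sq]
      linarith
    have h4 := h3.trans (real_inner_le_norm _ _)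
    rw [NNReal.coe_one, one_mul, dist_eq_norm, dist_eq_norm]
    rcases (norm_nonneg (p - q)).eq_or_lt with h0 | h0
    · rw [← h0]; exact norm_nonneg _
    · nlinarith
  intro n σ h
  have h1 := (computes_vcopy (.inl 6 : Blk d) (.inl 1)).isPure.preserves (ξ := ξ) (G := G) (o := o)
    n σ h
  set σ1 := fun ω => (Program.vcopy (.inl 6 : Blk d) (.inl 1)).exec (fun t x => G x (ξ t ω)) o (σ ω)
    with hσ1
  refine h1.congr (fun _ => rfl) (fun _ => rfl) fun r => ?_
  have e : (fun ω => ((Program.projQuery d).exec (fun t x => G x (ξ t ω)) o (σ ω)).reg r)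
      = fun ω => writeVec (Function.update (σ1 ω).reg (hid d 5) 0) (Blk.addr (.inl 6 : Blk d))
        ((o (readVec d (σ1 ω).reg (Blk.addr (.inl 1 : Blk d)))).getD
          (readVec d (σ1 ω).reg (Blk.addr (.inl 1 : Blk d)))) r := by
    funext ω
    have e1 : ((Program.projQuery d).exec (fun t x => G x (ξ t ω)) o (σ ω)).reg
        = Function.update ((Program.query d 1 5).exec (fun t x => G x (ξ t ω)) o (σ1 ω)).reg
          (hid d 5) 0 := rfl
    have e2 : (mem (σ1 ω).reg : Mem d) (.inl 6) = mem (σ1 ω).reg (.inl 1) := by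
      simp only [hσ1]
      rw [(computes_vcopy (.inl 6 : Blk d) (.inl 1)).mem_exec]
      simp
    rw [e1, exec_query 1 6 rfl, readVec_addr]
    cases o (WithLp.toLp 2 (mem (σ1 ω).reg (.inl 1))) with
    | none =>
      simp only [Function.update_idem, Option.getD_none]
      -- On the answer `none`, the target already contains the queried point, so rewriting it there
      -- changes nothing.
      rw [← e2]
      unfold writeVec
      split_ifs with hr
      · have hne : r ≠ hid d 5 := by
          rintro rfl
          have := hr.1
          have h6 : Blk.addr (.inl 6 : Blk d) = 6 * (d + 1) := rfl
          unfold hid at this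
          omega
        rw [Function.update_of_ne hne]
        change _ = (σ1 ω).reg (Blk.addr (.inl 6 : Blk d) + (r - Blk.addr (.inl 6 : Blk d)))
        congr 1
        omega
      · rfl
    | some x =>
      simp only [Option.getD_some]
      by_cases hr : r = hid d 5
      · subst hr
        rw [Function.update_self, writeVec_hid, Function.update_self]
      · rw [Function.update_of_ne hr]
  rw [e]
  let := past ξ n
  have hread : Measurable fun ω => readVec d (σ1 ω).reg (Blk.addr (.inl 1 : Blk d)) :=
    measurable_readVec _ h1.reg
  exact measurable_writeVec _ (fun r => measurable_update h1.reg measurable_const r)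
    (hcont.measurable.comp hread) r

theorem preserves_front (hG : Measurable fun q : Vec d × Ξ => G q.1 q.2) (hQ : Preserves ξ G o Q 0)
    (hP : P.IsPure) : Preserves ξ G o (.front d Q P) 1 :=
  (hQ.seq ((preserves_play hG _ _).seq hP.preserves) :)

theorem preserves_queryBranch (ho : MeasurableSet {x | o x = none})
    (ho' : Measurable fun x => (o x).getD 0) (a : Fin 64) (n : ℕ) (hP : Preserves ξ G o P 0)
    (hQ : Preserves ξ G o Q 0) : Preserves ξ G o (.queryBranch d a n P Q) 0 :=
  ((preserves_call ho ho' _ _).seq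
    ((Program.IsPure.preserves (P := .const (hid d 0) 0) trivial).seq (hQ.ite _ _ hP)) :)

variable [NeZero d]

theorem preserves_bisect (ho : MeasurableSet {x | o x = none})
    (ho' : Measurable fun x => (o x).getD 0) (L : ℕ) : Preserves ξ G o (.bisect d L) 0 := by
  have h0 := ((computes_sop (d := d) .plus 11 8 9).seq <| (computes_sconst 50 (1 / 2)).seq <|
      (computes_sop .times 11 50 11).seq <| (computes_sconst 50 1).seq <|
      (computes_sop .divide 50 50 11).seq <|
      computes_vscl (k := 6) (s := 50) (by decide) 1).isPure.preserves (ξ := ξ) (G := G) (o := o)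
  have hstep : Preserves ξ G o (.bisectStep d) 0 :=
    h0.seq (preserves_queryBranch ho ho' 6 9
      (computes_vcopy (.inl 9 : Blk d) (.inl 11)).isPure.preserves
      ((computes_vcopy (.inl 8 : Blk d) (.inl 11)).seq
        (computes_vcopy (.inl 7 : Blk d) (.inl 10))).isPure.preserves)
  have h1 := ((computes_sconst (d := d) 8 1).seq <| (computes_sconst 9 (√d)).seq <|
    computes_vcopy (.inl 7 : Blk d) (.inl 10)).isPure.preserves (ξ := ξ) (G := G) (o := o)
  have h2 := ((computes_sconst (d := d) 50 1).seq <| (computes_sop .divide 50 50 9).seq <|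
      (computes_vscl (k := 6) (s := 50) (by decide) 1).seq <| (computes_sdot 50 7 1).seq <|
      (computes_sop .divide 50 8 50).seq <|
      computes_vscl (k := 12) (s := 50) (by decide) 7).isPure.preserves (ξ := ξ) (G := G) (o := o)
  exact h1.seq ((Preserves.loop (fun _ => hstep) L).seq h2)

theorem preserves_gaugeFront (hG : Measurable fun q : Vec d × Ξ => G q.1 q.2)
    (ho : MeasurableSet {x | o x = none}) (ho' : Measurable fun x => (o x).getD 0) (T : ℕ) :
    Preserves ξ G o (.gaugeFront d T) 1 :=
  preserves_front hG (preserves_queryBranch ho ho' _ _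
    ((computes_vcopy (.inl 6 : Blk d) (.inl 1)).seq (computes_vzero (.inl 12))).isPure.preserves
    (preserves_bisect ho ho' _)) (realizes_gaugePost (d := d)).isPure

theorem preserves_projFront {C : Set (Vec d)} (hC : Convex ℝ C) (hoC : IsProjOracle C o)
    (hG : Measurable fun q : Vec d × Ξ => G q.1 q.2) : Preserves ξ G o (.projFront d) 1 :=
  preserves_front hG (preserves_projQuery hC hoC) (realizes_projPost (d := d)).isPure

theorem preserves_ballFront (hG : Measurable fun q : Vec d × Ξ => G q.1 q.2) :
    Preserves ξ G o (.ballFront d) 1 :=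
  preserves_front hG (computes_vcopy (.inl 6 : Blk d) (.inl 1)).isPure.preserves
    ((computes_vcopy (.inl 4 : Blk d) (.inl 5)).seq <| (computes_sconst 50 1).seq <|
      computes_vadd (k := 0) (s := 50) (by decide) 0 6).isPure

theorem measurable_played_main {F : Program} (hF : Preserves ξ G o F 1) (B η β : ℝ) (n T t : ℕ)
    (ht : t < T) : Measurable[past ξ t] fun ω =>
      ((Program.main d B η β n F T).final (fun t x => G x (ξ t ω)) o).played t := by
  have h0 : Adapted ξ 0 fun _ : Ω => State.init d :=
    ⟨fun _ => rfl, fun _ => measurable_const, fun t ht => by omega⟩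
  have h1 : Preserves ξ G o (Program.main d B η β n F T) (0 + T * (1 + 0) + 0) :=
    (((isPure_reinit (d := d) B η).preserves.seq (Preserves.loop
      (fun _ => hF.seq (isPure_update (d := d) B η β n).preserves) T)).seq
      ((computes_sconst (d := d) 50 (T : ℝ)⁻¹).seq
        (computes_vscl (k := 0) (s := 50) (by decide) 0)).isPure.preserves :)
  exact (h1 0 _ h0).played t (by omega)

end Measurability

/-! ### Constants -/

section Constants

variable {α η ε : ℝ} {d : ℕ}

/-- The form in which `ε ≤ 1/d` is used in the cost estimate: it lets `d²` be paid for by `d/ε`, and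
with it the cubic cost of landmark changes. -/
theorem sq_le_div (hd : 1 ≤ d) (hε : 0 < ε) (hεd : ε ≤ 1 / d) : (d : ℝ) ^ 2 ≤ d / ε := by
  have hd' : (1 : ℝ) ≤ d := by exact_mod_cast hd
  rw [le_div_iff₀ (by positivity)] at hεd
  rw [le_div_iff₀ hε]
  nlinarith

theorem one_le_numRounds (α : ℝ) (d : ℕ) (ε : ℝ) : 1 ≤ numRounds α d ε := le_max_left _ _

theorem le_numRounds (α : ℝ) (d : ℕ) (ε : ℝ) :
    d / ε * Real.log (d / ε) / α ≤ numRounds α d ε := by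
  have e : d / ε * Real.log (d / ε) / α = d * Real.log (d / ε) / (α * ε) := by
    rw [mul_comm α ε, ← div_div]; congr 1; ring
  rw [e, numRounds, Nat.cast_max]
  exact (Nat.le_ceil _).trans (le_max_right _ _)

theorem numRounds_le (hα : 0 < α) (hx : 1 ≤ d / ε) :
    (numRounds α d ε : ℝ) ≤ 1 + d / ε * Real.log (d / ε) / α := by
  have e : d / ε * Real.log (d / ε) / α = d * Real.log (d / ε) / (α * ε) := by
    rw [mul_comm α ε, ← div_div]; congr 1; ring
  have h0 : 0 ≤ d / ε * Real.log (d / ε) / α := by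
    have := Real.log_nonneg hx
    positivity
  rw [e] at h0 ⊢
  rw [numRounds, Nat.cast_max, Nat.cast_one]
  exact max_le (by linarith) ((Nat.ceil_lt_add_one h0).le.trans (by linarith))

theorem half_le_log_one_add {x : ℝ} (hx : 1 ≤ x) : 1 / 2 ≤ Real.log (1 + x) := by
  have := Real.log_le_log (by norm_num : (0 : ℝ) < 2) (by linarith : 2 ≤ 1 + x)
  linarith [Real.log_two_gt_d9]

/-- A constant in the bound for the logarithm of the number of rounds. -/
def logConst (α : ℝ) : ℝ := Real.log (2 + 1 / α)

theorem logConst_nonneg (hα : 0 < α) : 0 ≤ logConst α :=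
  Real.log_nonneg (by have : 0 < 1 / α := by positivity
                      linarith)

theorem numRounds_le_mul (hα : 0 < α) (hx : 1 ≤ d / ε) :
    (numRounds α d ε : ℝ) ≤ (2 + 1 / α) * (d / ε * Real.log (1 + d / ε)) := by
  have h1 := numRounds_le hα hx
  have h2 := half_le_log_one_add hx
  have h3 : Real.log (d / ε) ≤ Real.log (1 + d / ε) := Real.log_le_log (by linarith) (by linarith)
  have h4 : d / ε * Real.log (d / ε) / α ≤ 1 / α * (d / ε * Real.log (1 + d / ε)) := by
    rw [one_div, inv_mul_eq_div]
    gcongr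
  nlinarith

theorem log_one_add_numRounds_le (hα : 0 < α) (hx : 1 ≤ d / ε) :
    Real.log (1 + numRounds α d ε) ≤ logConst α + 2 * Real.log (d / ε) := by
  set x := d / ε with hxd
  have hx0 : 0 < x := by linarith
  have h1 := numRounds_le hα hx
  have h2 : Real.log x ≤ x := (Real.log_le_sub_one_of_pos hx0).trans (by linarith)
  have h3 : x * Real.log x / α ≤ 1 / α * x ^ 2 := by
    rw [one_div, inv_mul_eq_div]
    gcongr
    nlinarith
  have h4 : (1 : ℝ) + numRounds α d ε ≤ (2 + 1 / α) * x ^ 2 := by nlinarith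
  have h5 := Real.log_le_log (by positivity) h4
  rwa [Real.log_mul (by positivity) (by positivity), Real.log_pow, Nat.cast_ofNat] at h5

theorem log_one_add_numRounds_le_mul (hα : 0 < α) (hx : 1 ≤ d / ε) :
    Real.log (1 + numRounds α d ε) ≤ (2 * logConst α + 2) * Real.log (1 + d / ε) := by
  have h1 := log_one_add_numRounds_le hα hx
  have h2 := half_le_log_one_add hx
  have h3 : Real.log (d / ε) ≤ Real.log (1 + d / ε) := Real.log_le_log (by linarith) (by linarith)
  nlinarith [logConst_nonneg hα]

/-- The constant of the excess risk bound. -/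
def riskConst (α η : ℝ) : ℝ :=
  α * ((η + 6 / betaOf α) * (2 * logConst α + 2) + 2 * (4 * η + 9))
    + 2 * ((η + 6 / betaOf α) + 4 * η + 9)

theorem riskConst_pos (hα : 0 < α) (hη : 11 ≤ η) : 0 < riskConst α η := by
  have := logConst_nonneg hα
  have := betaOf_pos hα
  unfold riskConst
  positivity

/-- If `log (d/ε) ≥ 1/2`, the logarithm dominates the constants and `T` dominates `(d/ε) log (d/ε) /
α`. Otherwise `d/ε < 2`, so `d` is itself at most `2ε`, and `log (1 + T) ≤ T` suffices. -/
theorem risk_bound_le (hα : 0 < α) (hη : 11 ≤ η) (hd : 1 ≤ d) (hε : 0 < ε) (hεd : ε ≤ 1 / d) :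
    d * ((η + 6 / betaOf α) * Real.log (1 + numRounds α d ε) + 4 * η + 9) / numRounds α d ε
      ≤ riskConst α η * ε := by
  have hd' : (1 : ℝ) ≤ d := by exact_mod_cast hd
  have hsq := sq_le_div hd hε hεd
  have hx : 1 ≤ d / ε := by nlinarith
  have hc := logConst_nonneg hα
  have hβ := betaOf_pos hα
  have hT1 : (1 : ℝ) ≤ numRounds α d ε := by exact_mod_cast one_le_numRounds α d ε
  have hlog := log_one_add_numRounds_le hα hx
  have hT := le_numRounds α d ε
  set x := d / ε with hxd
  set T : ℝ := (numRounds α d ε : ℝ) with hTdef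
  set a := η + 6 / betaOf α with ha
  have ha0 : 0 < a := by positivity
  have hdx : (d : ℝ) = x * ε := by rw [hxd]; field_simp
  rw [div_le_iff₀ (by positivity)]
  unfold riskConst
  rw [← ha]
  rcases le_or_gt (1 / 2) (Real.log x) with hl | hl
  · have h1 : a * Real.log (1 + T) + 4 * η + 9
        ≤ (a * (2 * logConst α + 2) + 2 * (4 * η + 9)) * Real.log x := by
      have : Real.log (1 + T) ≤ (2 * logConst α + 2) * Real.log x := by nlinarith
      nlinarith [mul_le_mul_of_nonneg_left this ha0.le]
    have h2 : x * Real.log x ≤ α * T := by rw [div_le_iff₀ hα] at hT; linarith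
    have h3 : 0 ≤ a * (2 * logConst α + 2) + 2 * (4 * η + 9) := by positivity
    have h4 : 0 ≤ 2 * (a + 4 * η + 9) * ε * T := by positivity
    calc (d : ℝ) * (a * Real.log (1 + T) + 4 * η + 9)
        ≤ d * ((a * (2 * logConst α + 2) + 2 * (4 * η + 9)) * Real.log x) := by gcongr
      _ = (a * (2 * logConst α + 2) + 2 * (4 * η + 9)) * ε * (x * Real.log x) := by rw [hdx]; ring
      _ ≤ (a * (2 * logConst α + 2) + 2 * (4 * η + 9)) * ε * (α * T) := by gcongr
      _ ≤ _ := by linarith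
  · have hx2 : x < 2 := by
      by_contra h
      have := Real.log_le_log (by norm_num : (0 : ℝ) < 2) (not_lt.1 h)
      linarith [Real.log_two_gt_d9]
    have h1 : Real.log (1 + T) ≤ T := by
      have := Real.log_le_sub_one_of_pos (by positivity : 0 < 1 + T)
      linarith
    have h2 : a * Real.log (1 + T) + 4 * η + 9 ≤ (a + 4 * η + 9) * T := by nlinarith
    have h3 : 0 ≤ α * (a * (2 * logConst α + 2) + 2 * (4 * η + 9)) * ε * T := by positivity
    calc (d : ℝ) * (a * Real.log (1 + T) + 4 * η + 9) ≤ d * ((a + 4 * η + 9) * T) := by gcongr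
      _ = x * ((a + 4 * η + 9) * ε * T) := by rw [hdx]; ring
      _ ≤ 2 * ((a + 4 * η + 9) * ε * T) := by gcongr
      _ ≤ _ := by linarith

theorem log_le_log_one_add_div (hd : 1 ≤ d) (hε : 0 < ε) (hεd : ε ≤ 1 / d) :
    Real.log d ≤ Real.log (1 + d / ε) := by
  have hd' : (1 : ℝ) ≤ d := by exact_mod_cast hd
  have := sq_le_div hd hε hεd
  exact Real.log_le_log (by positivity) (by nlinarith)

/-- The constant in the bound for the Taylor order. -/
def orderConst (α η : ℝ) : ℝ :=
  2 * (1 + Real.log (400 * (6 * η + 3) ^ 2)) + 4 + 3 * (2 * logConst α + 2)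

set_option maxHeartbeats 1000000 in
-- The quantity inside the logarithm is at most a constant times `d⁴ (1 + T)³`, and both `log d` and
-- `log (1 + T)` are controlled by `log (1 + d/ε)`.
theorem taylorOrder_le (hα : 0 < α) (hη : 11 ≤ η) (hd : 1 ≤ d) (hε : 0 < ε) (hεd : ε ≤ 1 / d)
    {B : ℝ} (hB : 1 ≤ B) (hBd : B ≤ 1 + √d) :
    (taylorOrder d B η (betaOf α) (1 / 4) (numRounds α d ε) : ℝ)
      ≤ orderConst α η * Real.log (1 + d / ε) := by
  have hd' : (1 : ℝ) ≤ d := by exact_mod_cast hd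
  have hsq := sq_le_div hd hε hεd
  have hx : 1 ≤ d / ε := by nlinarith
  have hβ := betaOf_pos hα
  have hβ8 := betaOf_le (α := α)
  have hT1 : (1 : ℝ) ≤ numRounds α d ε := by exact_mod_cast one_le_numRounds α d ε
  have hlog := log_one_add_numRounds_le_mul hα hx
  have hlogd := log_le_log_one_add_div hd hε hεd
  have hL := half_le_log_one_add hx
  unfold taylorOrder
  set T : ℝ := (numRounds α d ε : ℝ) with hT
  set L := Real.log (1 + d / ε) with hLdef
  set Y := 12 * (4 + 32 / η ^ 2) ^ 2
    * (2 * η * d + B ^ 2 * η + (B + 2 * betaOf α * B ^ 2) * T) ^ 2 * T / (1 - 1 / 4) with hY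
  have hY0 : 0 < Y := by
    rw [hY]
    positivity
  have h1 : 4 + 32 / η ^ 2 ≤ 5 := by
    have : 32 / η ^ 2 ≤ 1 := by
      rw [div_le_one (by positivity)]
      nlinarith
    linarith
  have hB2 : B ≤ 2 * d := by
    have : √(d : ℝ) ≤ d := Real.sqrt_le_left (by positivity) |>.2 (by nlinarith)
    linarith
  have hBsq : B ^ 2 ≤ 4 * d ^ 2 := by nlinarith
  have hdd : (d : ℝ) ≤ d ^ 2 := by nlinarith
  have h2 : 2 * η * d + B ^ 2 * η + (B + 2 * betaOf α * B ^ 2) * T ≤ (6 * η + 3) * d ^ 2 * T := by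
    have e1 : B + 2 * betaOf α * B ^ 2 ≤ 3 * d ^ 2 := by nlinarith
    have e2 : 2 * η * d + B ^ 2 * η ≤ 6 * η * d ^ 2 := by nlinarith
    have e3 : 6 * η * d ^ 2 ≤ 6 * η * d ^ 2 * T := le_mul_of_one_le_right (by positivity) hT1
    have e4 := mul_le_mul_of_nonneg_right e1 (by positivity : 0 ≤ T)
    linarith
  have hYle : Y ≤ 400 * (6 * η + 3) ^ 2 * (d ^ 4 * (1 + T) ^ 3) := by
    have h3 : 0 ≤ 2 * η * d + B ^ 2 * η + (B + 2 * betaOf α * B ^ 2) * T := by positivity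
    calc Y ≤ 12 * 5 ^ 2 * ((6 * η + 3) * d ^ 2 * T) ^ 2 * T / (1 - 1 / 4) := by
          rw [hY]; gcongr
      _ = 400 * (6 * η + 3) ^ 2 * (d ^ 4 * T ^ 3) := by ring
      _ ≤ _ := by gcongr; linarith
  have hlogY : Real.log Y ≤ Real.log (400 * (6 * η + 3) ^ 2) + (4 * L
      + 3 * ((2 * logConst α + 2) * L)) := by
    refine (Real.log_le_log hY0 hYle).trans ?_
    rw [Real.log_mul (by positivity) (by positivity : (d : ℝ) ^ 4 * (1 + T) ^ 3 ≠ 0),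
      Real.log_mul (by positivity : (d : ℝ) ^ 4 ≠ 0) (by positivity), Real.log_pow, Real.log_pow]
    push_cast
    linarith
  have h4 : -Real.logb (1 / 4) Y = Real.log Y / Real.log 4 := by
    rw [Real.logb, one_div, Real.log_inv, div_neg, neg_neg]
  have hlog4 : 1 ≤ Real.log 4 := by
    rw [show (4 : ℝ) = 2 ^ 2 by norm_num, Real.log_pow]
    push_cast
    linarith [Real.log_two_gt_d9]
  have hc : 0 ≤ Real.log (400 * (6 * η + 3) ^ 2) := Real.log_nonneg (by nlinarith)
  have hlc := logConst_nonneg hα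
  have h5 : -Real.logb (1 / 4) Y ≤ Real.log (400 * (6 * η + 3) ^ 2) + (4 * L
      + 3 * ((2 * logConst α + 2) * L)) := by
    rw [h4]
    refine (div_le_iff₀ (by linarith)).2 (hlogY.trans (le_mul_of_one_le_right ?_ hlog4))
    positivity
  have h6 : (0 : ℝ) ≤ Real.log (400 * (6 * η + 3) ^ 2) + (4 * L + 3 * ((2 * logConst α + 2) * L)) :=
    by
    positivity
  calc (⌈-Real.logb (1 / 4) Y⌉₊ : ℝ)
      ≤ ⌈Real.log (400 * (6 * η + 3) ^ 2) + (4 * L + 3 * ((2 * logConst α + 2) * L))⌉₊ := by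
        exact_mod_cast Nat.ceil_mono h5
    _ ≤ Real.log (400 * (6 * η + 3) ^ 2) + (4 * L + 3 * ((2 * logConst α + 2) * L)) + 1 :=
        (Nat.ceil_lt_add_one h6).le
    _ ≤ orderConst α η * L := by
        unfold orderConst
        nlinarith

theorem clog_le (hα : 0 < α) (hd : 1 ≤ d) (hε : 0 < ε) (hεd : ε ≤ 1 / d) :
    (Nat.clog 2 (d * numRounds α d ε) : ℝ) ≤ (4 * logConst α + 8) * Real.log (1 + d / ε) := by
  have hd' : (1 : ℝ) ≤ d := by exact_mod_cast hd
  have hsq := sq_le_div hd hε hεd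
  have hx : 1 ≤ d / ε := by nlinarith
  have hT1 : (1 : ℝ) ≤ numRounds α d ε := by exact_mod_cast one_le_numRounds α d ε
  have hlog := log_one_add_numRounds_le_mul hα hx
  have hlogd := log_le_log_one_add_div hd hε hεd
  have hL := half_le_log_one_add hx
  have h1 : (1 : ℝ) ≤ (d * numRounds α d ε : ℕ) := by
    push_cast
    nlinarith
  have h2 : Real.logb 2 (d * numRounds α d ε : ℕ) ≤ 2 * Real.log (d * numRounds α d ε : ℕ) := by
    rw [Real.logb, div_le_iff₀ (Real.log_pos (by norm_num))]
    have := Real.log_nonneg h1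
    nlinarith [Real.log_two_gt_d9]
  have h3 : Real.log (d * numRounds α d ε : ℕ) ≤ Real.log d + Real.log (1 + numRounds α d ε) := by
    rw [Nat.cast_mul, Real.log_mul (by positivity) (by positivity)]
    gcongr
    linarith
  have h4 := Real.natCeil_logb_natCast 2 (d * numRounds α d ε)
  rw [Nat.cast_ofNat] at h4
  rw [← h4]
  refine (Nat.ceil_lt_add_one (Real.logb_nonneg (by norm_num) h1)).le.trans ?_
  nlinarith

/-- A constant for the number of landmarks. -/
def moveConst (α : ℝ) : ℝ := 30 * ((2 + 1 / α) * (2 * logConst α + 2)) / betaOf α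

/-- The constant of the bound for the operations. -/
def costConst (α η : ℝ) : ℝ :=
  240 + (2 + 1 / α) * (20 * (4 * logConst α + 8) + 20 * orderConst α η + 442)
    + 124 * (1 + moveConst α) + 8

theorem moveConst_nonneg (hα : 0 < α) : 0 ≤ moveConst α := by
  have := logConst_nonneg hα
  have := betaOf_pos hα
  unfold moveConst
  positivity

set_option maxHeartbeats 1000000 in
-- One logarithm comes from the number of rounds and another from the Taylor order or the bisection.
-- The recomputations remain within the same bound because their number is of order `√T`, up to a
-- logarithm; additive constants are absorbed through `log (1 + d/ε) ≥ 1/2`.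
theorem ops_bound_le (hα : 0 < α) (hd : 1 ≤ d) (hε : 0 < ε) (hεd : ε ≤ 1 / d) {c n J q : ℕ}
    (hn : (n : ℝ) ≤ orderConst α η * Real.log (1 + d / ε))
    (hq : (q : ℝ) ≤ (4 * logConst α + 8) * Real.log (1 + d / ε)) (hc : c ≤ 20 * d * (q + 3))
    (hJ : (J : ℝ) ^ 2 ≤ 30 * (numRounds α d ε * Real.log (1 + numRounds α d ε) / betaOf α)) :
    ((60 * d ^ 3 + numRounds α d ε * (c + (n + 8) * (20 * d ^ 2) + 1) + J * (62 * d ^ 3) + (1 + d) :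
      ℕ)
      : ℝ) ≤ costConst α η * Real.log (1 + d / ε) ^ 2 * (d / ε * d ^ 2) := by
  have hd' : (1 : ℝ) ≤ d := by exact_mod_cast hd
  have hsq := sq_le_div hd hε hεd
  have hx : 1 ≤ d / ε := by nlinarith
  have hβ := betaOf_pos hα
  have hT := numRounds_le_mul hα hx
  have hlog := log_one_add_numRounds_le_mul hα hx
  have hL := half_le_log_one_add hx
  have hlc := logConst_nonneg hα
  have hmc := moveConst_nonneg hα
  have hT0 : (0 : ℝ) ≤ numRounds α d ε := Nat.cast_nonneg _
  have hc' : (c : ℝ) ≤ 20 * d * (q + 3) := by exact_mod_cast hc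
  push_cast
  set T : ℝ := (numRounds α d ε : ℝ) with hTd
  set L := Real.log (1 + d / ε) with hLd
  set x := d / ε with hxd
  have hdx : (d : ℝ) ≤ x := by nlinarith
  have hL2 : 1 ≤ 4 * L ^ 2 := by nlinarith
  have hdd : (d : ℝ) ≤ d ^ 2 := by nlinarith
  have hxd2 : 0 ≤ x * d ^ 2 := by positivity
  have b1 : 60 * (d : ℝ) ^ 3 ≤ 240 * L ^ 2 * (x * d ^ 2) := by
    have e1 : (d : ℝ) ^ 3 ≤ x * d ^ 2 := by rw [pow_succ']; gcongr
    nlinarith [mul_le_mul_of_nonneg_right hL2 hxd2]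
  have b2 : (1 : ℝ) + d ≤ 8 * L ^ 2 * (x * d ^ 2) := by
    have e1 : (1 : ℝ) + d ≤ 2 * (x * d ^ 2) := by nlinarith
    nlinarith [mul_le_mul_of_nonneg_right hL2 hxd2]
  have b3 : T * (c + (n + 8) * (20 * d ^ 2) + 1)
      ≤ (2 + 1 / α) * (20 * (4 * logConst α + 8) + 20 * orderConst α η + 442) * L ^ 2 * (x * d ^
        2) := by
    have e1 : (c : ℝ) + (n + 8) * (20 * d ^ 2) + 1 ≤ (20 * q + 20 * n + 221) * d ^ 2 := by
      have : (0 : ℝ) ≤ q := Nat.cast_nonneg _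
      have : 20 * (d : ℝ) * (q + 3) ≤ 20 * d ^ 2 * (q + 3) := by gcongr
      nlinarith
    have e2 : (20 * q + 20 * n + 221 : ℝ)
        ≤ (20 * (4 * logConst α + 8) + 20 * orderConst α η + 442) * L := by nlinarith
    calc T * (c + (n + 8) * (20 * d ^ 2) + 1)
        ≤ T * ((20 * q + 20 * n + 221) * d ^ 2) := by gcongr
      _ ≤ ((2 + 1 / α) * (x * L))
          * (((20 * (4 * logConst α + 8) + 20 * orderConst α η + 442) * L) * d ^ 2) := by gcongr
      _ = _ := by ring
  have b4 : (J : ℝ) * (62 * d ^ 3) ≤ 124 * (1 + moveConst α) * L ^ 2 * (x * d ^ 2) := by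
    have hlogT : 0 ≤ Real.log (1 + T) := Real.log_nonneg (by linarith)
    -- The decisive use of `ε ≤ 1/d`: the factor `d²` is bounded by `x = d/ε`, and `J²` contributes
    -- the other factor `x`.
    have e1 : (J * d : ℝ) ^ 2 ≤ moveConst α * (x * L) ^ 2 := by
      calc (J * d : ℝ) ^ 2 = J ^ 2 * d ^ 2 := by ring
        _ ≤ (30 * (T * Real.log (1 + T) / betaOf α)) * x := by gcongr
        _ ≤ (30 * (((2 + 1 / α) * (x * L)) * ((2 * logConst α + 2) * L) / betaOf α)) * x := by
          gcongr
        _ = _ := by unfold moveConst; ring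
    have e2 : (J * d : ℝ) ≤ (1 + moveConst α) * (x * L) := by
      refine le_of_sq_le_sq (e1.trans ?_) (by positivity)
      rw [mul_pow (1 + moveConst α)]
      gcongr
      nlinarith
    have e3 : (1 + moveConst α) * (x * L) ≤ 2 * (1 + moveConst α) * L ^ 2 * x := by
      have : 0 ≤ (1 + moveConst α) * x * L := by positivity
      nlinarith
    calc (J : ℝ) * (62 * d ^ 3) = 62 * (J * d) * d ^ 2 := by ring
      _ ≤ 62 * (2 * (1 + moveConst α) * L ^ 2 * x) * d ^ 2 := by
        exact mul_le_mul_of_nonneg_right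
          (mul_le_mul_of_nonneg_left (e2.trans e3) (by norm_num)) (by positivity)
      _ = _ := by ring
  unfold costConst
  linarith

theorem calls_bound_le (hα : 0 < α) (hx : 1 ≤ d / ε) {k q : ℕ}
    (hq : (q : ℝ) ≤ (4 * logConst α + 8) * Real.log (1 + d / ε)) (hk : k ≤ q + 1) :
    ((numRounds α d ε * k : ℕ) : ℝ)
      ≤ ((2 + 1 / α) * (4 * logConst α + 10)) * Real.log (1 + d / ε) ^ 2 * (d / ε) := by
  have hT := numRounds_le_mul hα hx
  have hL := half_le_log_one_add hx
  have hlc := logConst_nonneg hα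
  have hk' : (k : ℝ) ≤ q + 1 := by exact_mod_cast hk
  push_cast
  calc (numRounds α d ε : ℝ) * k
      ≤ ((2 + 1 / α) * (d / ε * Real.log (1 + d / ε)))
        * ((4 * logConst α + 10) * Real.log (1 + d / ε)) := by
        gcongr
        linarith
    _ = _ := by ring

end Constants

/-! ### The programs for stochastic optimization -/

section Assembly

variable {α η ε δ B : ℝ} {d c k q : ℕ} {C : Set (Vec d)}
  {round : Vec d → Vec d → Vec d → Vec d → Prop} {F : Program}

/-- The program for the rounds `F`, with the parameters of the stochastic setting. -/
def Program.stoch (d : ℕ) (B η α ε : ℝ) (F : Program) : Program :=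
  .main d B η (betaOf α) (taylorOrder d B η (betaOf α) (1 / 4) (numRounds α d ε)) F
    (numRounds α d ε)

/-- The constant of the cost bounds. -/
def workConst (α η : ℝ) : ℝ := costConst α η + (2 + 1 / α) * (4 * logConst α + 10)

theorem orderConst_nonneg (hα : 0 < α) (hη : 11 ≤ η) : 0 ≤ orderConst α η := by
  have := logConst_nonneg hα
  have : 0 ≤ Real.log (400 * (6 * η + 3) ^ 2) := Real.log_nonneg (by nlinarith)
  unfold orderConst
  positivity

theorem costConst_nonneg (hα : 0 < α) (hη : 11 ≤ η) : 0 ≤ costConst α η := by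
  have := logConst_nonneg hα
  have := moveConst_nonneg hα
  have := orderConst_nonneg hα hη
  unfold costConst
  positivity

theorem workConst_nonneg (hα : 0 < α) (hη : 11 ≤ η) : 0 ≤ workConst α η := by
  have := logConst_nonneg hα
  have := costConst_nonneg hα hη
  unfold workConst
  positivity

theorem one_le_div (hd : 1 ≤ d) (hε : 0 < ε) (hεd : ε ≤ 1 / d) : 1 ≤ d / ε := by
  have hd' : (1 : ℝ) ≤ d := by exact_mod_cast hd
  nlinarith [sq_le_div hd hε hεd]

theorem ExcessRiskLE.mono {Ω : Type*} {Ξ : Type*} [MeasurableSpace Ω] {μ : Measure Ω}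
    {f : Vec d → Ξ → ℝ} {ξ : ℕ → Ω → Ξ} {x : Ω → Vec d} {r r' : ℝ}
    (h : ExcessRiskLE μ C f ξ x r) (hr : r ≤ r') : ExcessRiskLE μ C f ξ x r' :=
  ⟨h.1, h.2.1, h.2.2.trans hr⟩

theorem IsStochRun.excessRiskLE_numRounds
    (hα : 0 < α) (hη : 11 ≤ η) (hd : 1 ≤ d) (hε : 0 < ε) (hεd : ε ≤ 1 / d) (hB : 1 ≤ B)
    (hBd : B ≤ 1 + √d) {Ω : Type*} {Ξ : Type*} [MeasurableSpace Ω]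
    [MeasurableSpace Ξ] {μ : Measure Ω} [IsProbabilityMeasure μ] {f : Vec d → Ξ → ℝ}
    {ξ : ℕ → Ω → Ξ} (h : IsStochExpConcave μ α C f ξ) (hr : IsSurrogate C B δ round) (hδ : 0 ≤ δ)
    (hδT : δ ≤ 1 / numRounds α d ε) {U ζ : ℕ → Ω → Vec d}
    (hU : IsStochRun round B η (betaOf α) (numRounds α d ε) C f ξ U ζ) :
    ExcessRiskLE μ C f ξ (fun ω => avgIterate (numRounds α d ε) fun t => U t ω)
      (riskConst α η * ε) :=
  (hU.excessRiskLE h hr hd hα hη hB hBd hδ hδT (one_le_numRounds α d ε)).mono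
    (risk_bound_le hα hη hd hε hεd)

theorem stoch_spec [NeZero d]
    (hα : 0 < α) (hη : 11 ≤ η) (hd : 1 ≤ d) (hε : 0 < ε) (hεd : ε ≤ 1 / d) (hB : 1 ≤ B)
    (hBd : B ≤ 1 + √d) (hr : IsSurrogate C B δ round) {grad : ℕ → Vec d → Vec d}
    {o : Vec d → Option (Vec d)} (hF : IsFront F round grad o c k)
    (hgrad : ∀ t, ∀ x ∈ C, ‖grad t x‖ ≤ 1)
    (hq : (q : ℝ) ≤ (4 * logConst α + 8) * Real.log (1 + d / ε)) (hc : c ≤ 20 * d * (q + 3)) :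
    (Program.stoch d B η α ε F).Implements round B η (betaOf α) (numRounds α d ε) grad o ∧
    ((Program.stoch d B η α ε F).final grad o).calls ≤ numRounds α d ε * k ∧
    (((Program.stoch d B η α ε F).final grad o).ops : ℝ) ≤
      costConst α η * Real.log (1 + d / ε) ^ 2 * (d / ε * d ^ 2) := by
  have hβ := betaOf_pos hα
  have hβ8 := betaOf_le (α := α)
  have hT := one_le_numRounds α d ε
  obtain ⟨h1, ⟨w, v, g, h2⟩, h3, h4, J, h5, h6⟩ := final_main hr hF hgrad hη (by linarith) hβ
    (by linarith) (four_le_taylorOrder hd hη (by linarith) hβ.le hT)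
    (rfl : Program.stoch d B η α ε F = _)
  refine ⟨⟨h1, ⟨w, v, g, h2⟩, h3⟩, h4, ?_⟩
  exact (Nat.cast_le.2 h6).trans (ops_bound_le hα hd hε hεd
    (taylorOrder_le hα hη hd hε hεd hB hBd) hq hc h5)

theorem cost_stoch_le [NeZero d]
    (hα : 0 < α) (hη : 11 ≤ η) (hd : 1 ≤ d) (hε : 0 < ε) (hεd : ε ≤ 1 / d) (hB : 1 ≤ B)
    (hBd : B ≤ 1 + √d) (hr : IsSurrogate C B δ round) {grad : ℕ → Vec d → Vec d}
    {o : Vec d → Option (Vec d)} (hF : IsFront F round grad o c k)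
    (hgrad : ∀ t, ∀ x ∈ C, ‖grad t x‖ ≤ 1)
    (hq : (q : ℝ) ≤ (4 * logConst α + 8) * Real.log (1 + d / ε)) (hc : c ≤ 20 * d * (q + 3))
    (hk : k ≤ q + 1) {τ : ℝ} (hτ : 0 ≤ τ) :
    (Program.stoch d B η α ε F).cost grad o τ ≤
      workConst α η * Real.log (1 + d / ε) ^ 2 * (d / ε * (d ^ 2 + τ)) := by
  obtain ⟨-, h1, h2⟩ := stoch_spec hα hη hd hε hεd hB hBd hr hF hgrad hq hc
  have hx := one_le_div hd hε hεd
  have h3 := (Nat.cast_le (α := ℝ).2 h1).trans (calls_bound_le hα hx hq hk)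
  have hlc := logConst_nonneg hα
  have hcc := costConst_nonneg hα hη
  have h4 := mul_le_mul_of_nonneg_left h3 hτ
  unfold Program.cost workConst
  have h5 : 0 ≤ costConst α η * Real.log (1 + d / ε) ^ 2 * (d / ε) * τ := by positivity
  have h6 : 0 ≤ (2 + 1 / α) * (4 * logConst α + 10) * Real.log (1 + d / ε) ^ 2 * (d / ε) * d ^ 2 :=
    by
    positivity
  linarith

theorem excessRiskLE_stoch [NeZero d]
    (hα : 0 < α) (hη : 11 ≤ η) (hd : 1 ≤ d) (hε : 0 < ε) (hεd : ε ≤ 1 / d) (hB : 1 ≤ B)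
    (hBd : B ≤ 1 + √d) {Ω : Type*} {Ξ : Type*} [MeasurableSpace Ω]
    [MeasurableSpace Ξ] {μ : Measure Ω} [IsProbabilityMeasure μ] {f : Vec d → Ξ → ℝ}
    {ξ : ℕ → Ω → Ξ} (h : IsStochExpConcave μ α C f ξ) (hr : IsSurrogate C B δ round) (hδ : 0 ≤ δ)
    (hδT : δ ≤ 1 / numRounds α d ε) {G : Vec d → Ξ → Vec d} {o : Vec d → Option (Vec d)}
    (hG : ∀ x ∈ C, ∀ z, IsLossSubgradient C (fun y => f y z) x (G x z))
    (hF : Preserves ξ G o F 1)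
    (hP : ∀ ω, (Program.stoch d B η α ε F).Implements round B η (betaOf α) (numRounds α d ε)
      (fun t x => G x (ξ t ω)) o) :
    ExcessRiskLE μ C f ξ
      (fun ω => (Program.stoch d B η α ε F).output (fun t x => G x (ξ t ω)) o)
      (riskConst α η * ε) := by
  have hU : IsStochRun round B η (betaOf α) (numRounds α d ε) C f ξ
      (fun t ω => ((Program.stoch d B η α ε F).final (fun t x => G x (ξ t ω)) o).played t)
      (fun t ω => G (((Program.stoch d B η α ε F).final (fun t x => G x (ξ t ω)) o).played t)
        (ξ t ω)) := by
    refine ⟨fun ω => (hP ω).2.1, fun t ht ω => hG _ ?_ _, fun t ht => ?_⟩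
    · obtain ⟨w, v, g, -, hround⟩ := (hP ω).2.1
      exact hr.mem _ _ _ _ (hround t ht)
    · exact measurable_played_main hF _ _ _ _ _ t ht
  have hrisk := IsStochRun.excessRiskLE_numRounds hα hη hd hε hεd hB hBd h hr hδ hδT hU
  have e : (fun ω => (Program.stoch d B η α ε F).output (fun t x => G x (ξ t ω)) o)
      = fun ω => avgIterate (numRounds α d ε) fun t =>
        ((Program.stoch d B η α ε F).final (fun t x => G x (ξ t ω)) o).played t :=
    funext fun ω => (hP ω).2.2
  rwa [e]

end Assembly

end ExpConcave

end

theorem mainTheorem3 :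
    ∃ p : ℕ, ∀ α : ℝ, 0 < α → ∀ η : ℝ, 11 ≤ η → ∃ K : ℝ, 0 < K ∧
      ∀ (d : ℕ) (ε : ℝ), 1 ≤ d → 0 < ε → ε ≤ 1 / d →
      -- iterates: case (a)
      (∀ (Ω : Type u) (Ξ : Type v) [MeasurableSpace Ω] [MeasurableSpace Ξ] (μ : Measure Ω)
          [IsProbabilityMeasure μ] (C : Set (Vec d)) (f : Vec d → Ξ → ℝ) (ξ : ℕ → Ω → Ξ),
        IsStochExpConcave μ α C f ξ → ∀ U ζ : ℕ → Ω → Vec d,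
        IsStochRun (ProjRound C) 1 η (betaOf α) (numRounds α d ε) C f ξ U ζ →
        ExcessRiskLE μ C f ξ (fun ω => avgIterate (numRounds α d ε) (fun t => U t ω)) (K * ε)) ∧
      -- iterates: case (b)
      (∀ (Ω : Type u) (Ξ : Type v) [MeasurableSpace Ω] [MeasurableSpace Ξ] (μ : Measure Ω)
          [IsProbabilityMeasure μ] (C : Set (Vec d)) (f : Vec d → Ξ → ℝ) (ξ : ℕ → Ω → Ξ),
        IsStochExpConcave μ α C f ξ → IsSymmetricBody C → ∀ U ζ : ℕ → Ω → Vec d,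
        ∀ δ : ℝ, 0 ≤ δ → δ ≤ 1 / numRounds α d ε →
        IsStochRun (GaugeRound C δ) (1 + Real.sqrt d) η (betaOf α) (numRounds α d ε)
          C f ξ U ζ →
        ExcessRiskLE μ C f ξ (fun ω => avgIterate (numRounds α d ε) (fun t => U t ω)) (K * ε)) ∧
      -- computational cost: case (a)
      (∃ P : Program,
        ∀ (Ω : Type u) (Ξ : Type v) [MeasurableSpace Ω] [MeasurableSpace Ξ] (μ : Measure Ω)
          [IsProbabilityMeasure μ] (C : Set (Vec d)) (f : Vec d → Ξ → ℝ) (ξ : ℕ → Ω → Ξ),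
        IsStochExpConcave μ α C f ξ →
        ∀ o : Vec d → Option (Vec d), IsProjOracle C o →
        ∀ G : Vec d → Ξ → Vec d,
        (∀ x ∈ C, ∀ z, IsLossSubgradient C (fun y => f y z) x (G x z)) →
        (∀ ω, P.Implements (ProjRound C) 1 η (betaOf α) (numRounds α d ε)
          (fun t x => G x (ξ t ω)) o) ∧
        (∀ ω, ∀ τ : ℝ, 0 ≤ τ → P.cost (fun t x => G x (ξ t ω)) o τ ≤
          K * Real.log (1 + d / ε) ^ p * (d / ε * (d ^ 2 + τ))) ∧
        (Measurable (fun q : Vec d × Ξ => G q.1 q.2) →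
          ExcessRiskLE μ C f ξ (fun ω => P.output (fun t x => G x (ξ t ω)) o) (K * ε))) ∧
      -- computational cost: case (b)
      (∃ P : Program,
        ∀ (Ω : Type u) (Ξ : Type v) [MeasurableSpace Ω] [MeasurableSpace Ξ] (μ : Measure Ω)
          [IsProbabilityMeasure μ] (C : Set (Vec d)) (f : Vec d → Ξ → ℝ) (ξ : ℕ → Ω → Ξ),
        IsStochExpConcave μ α C f ξ → IsSymmetricBody C →
        ∀ o : Vec d → Option (Vec d), IsSepOracle C o →
        ∀ G : Vec d → Ξ → Vec d,
        (∀ x ∈ C, ∀ z, IsLossSubgradient C (fun y => f y z) x (G x z)) →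
        (∀ ω, P.Implements (GaugeRound C (1 / numRounds α d ε)) (1 + Real.sqrt d) η (betaOf α)
          (numRounds α d ε) (fun t x => G x (ξ t ω)) o) ∧
        (∀ ω, ∀ τ : ℝ, 0 ≤ τ → P.cost (fun t x => G x (ξ t ω)) o τ ≤
          K * Real.log (1 + d / ε) ^ p * (d / ε * (d ^ 2 + τ))) ∧
        (Measurable (fun q : Vec d × Ξ => G q.1 q.2) →
          MeasurableSet {x | o x = none} → Measurable (fun x => (o x).getD 0) →
          ExcessRiskLE μ C f ξ (fun ω => P.output (fun t x => G x (ξ t ω)) o) (K * ε))) ∧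
      -- the unit ball, where no oracle for the feasible set is needed
      (∃ P : Program,
        ∀ (Ω : Type u) (Ξ : Type v) [MeasurableSpace Ω] [MeasurableSpace Ξ] (μ : Measure Ω)
          [IsProbabilityMeasure μ] (f : Vec d → Ξ → ℝ) (ξ : ℕ → Ω → Ξ),
        IsStochExpConcave μ α (Metric.closedBall 0 1) f ξ →
        ∀ (o : Vec d → Option (Vec d)) (G : Vec d → Ξ → Vec d),
        (∀ x ∈ Metric.closedBall (0 : Vec d) 1, ∀ z,
          IsLossSubgradient (Metric.closedBall 0 1) (fun y => f y z) x (G x z)) →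
        (∀ ω, P.Implements (ProjRound (Metric.closedBall 0 1)) 1 η (betaOf α) (numRounds α d ε)
          (fun t x => G x (ξ t ω)) o) ∧
        (∀ ω, (P.final (fun t x => G x (ξ t ω)) o).calls = 0 ∧
          ((P.final (fun t x => G x (ξ t ω)) o).ops : ℝ) ≤
            K * Real.log (1 + d / ε) ^ p * (d ^ 3 / ε)) ∧
        (Measurable (fun q : Vec d × Ξ => G q.1 q.2) →
          ExcessRiskLE μ (Metric.closedBall 0 1) f ξ
            (fun ω => P.output (fun t x => G x (ξ t ω)) o) (K * ε))) := by
  -- Two logarithms suffice, one for the number of rounds and one for the work in a round; the sum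
  -- of the constants serves risk and cost at once.
  refine ⟨2, fun α hα η hη => ⟨riskConst α η + workConst α η, ?_, fun d ε hd hε hεd => ?_⟩⟩
  · exact add_pos_of_pos_of_nonneg (riskConst_pos hα hη) (workConst_nonneg hα hη)
  have : NeZero d := ⟨by omega⟩
  have hd' : (1 : ℝ) ≤ d := by exact_mod_cast hd
  have hT : (1 : ℝ) ≤ numRounds α d ε := by exact_mod_cast one_le_numRounds α d ε
  have hL := half_le_log_one_add (one_le_div hd hε hεd)
  have hlc := logConst_nonneg hα
  have hB1 : (1 : ℝ) ≤ 1 + √d := by linarith [Real.sqrt_nonneg (d : ℝ)]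
  -- The bisection length is `0` for the projection and the ball, which need at most one query per
  -- round.
  have hq0 : ((0 : ℕ) : ℝ) ≤ (4 * logConst α + 8) * Real.log (1 + d / ε) := by
    rw [Nat.cast_zero]; positivity
  have hT0 : (0 : ℝ) ≤ 1 / numRounds α d ε := by positivity
  have hT1 : (1 : ℝ) / numRounds α d ε ≤ 1 := by rw [div_le_one (by positivity)]; exact hT
  have hrisk : riskConst α η * ε ≤ (riskConst α η + workConst α η) * ε := by
    nlinarith [workConst_nonneg hα hη]
  have hwork : ∀ x, 0 ≤ x → workConst α η * Real.log (1 + d / ε) ^ 2 * (d / ε * x)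
      ≤ (riskConst α η + workConst α η) * Real.log (1 + d / ε) ^ 2 * (d / ε * x) := fun x hx => by
    have := riskConst_pos hα hη
    gcongr
    linarith
  refine ⟨?_, ?_, ⟨.stoch d 1 η α ε (.projFront d), ?_⟩,
    ⟨.stoch d (1 + √d) η α ε (.gaugeFront d (numRounds α d ε)), ?_⟩,
    ⟨.stoch d 1 η α ε (.ballFront d), ?_⟩⟩
  · intro Ω Ξ _ _ μ _ C f ξ h U ζ hU
    exact (IsStochRun.excessRiskLE_numRounds hα hη hd hε hεd le_rfl hB1 h
      (isSurrogate_projRound h.subset_ball) le_rfl hT0 hU).mono hrisk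
  · intro Ω Ξ _ _ μ _ C f ξ h hC U ζ δ hδ hδT hU
    exact (IsStochRun.excessRiskLE_numRounds hα hη hd hε hεd hB1 le_rfl h
      (isSurrogate_gaugeRound hd h.convex hC hδ (hδT.trans hT1)) hδ hδT hU).mono hrisk
  · intro Ω Ξ _ _ μ _ C f ξ h o ho G hG
    have hr := isSurrogate_projRound h.subset_ball
    have hF := fun ω => isFront_projFront h.convex (fun t x => G x (ξ t ω)) ho
    have hgrad : ∀ ω t, ∀ x ∈ C, ‖G x (ξ t ω)‖ ≤ 1 := fun ω t x hx => (hG x hx _).2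
    have hc : d * 2 + (d + 1) + d + 30 * d ≤ 20 * d * (0 + 3) := by omega
    have himp := fun ω =>
      (stoch_spec hα hη hd hε hεd le_rfl hB1 hr (hF ω) (hgrad ω) hq0 hc).1
    refine ⟨himp, fun ω τ hτ => ?_, fun hm => ?_⟩
    · exact (cost_stoch_le hα hη hd hε hεd le_rfl hB1 hr (hF ω) (hgrad ω) hq0 hc le_rfl hτ).trans
        (hwork _ (by positivity))
    · exact (excessRiskLE_stoch hα hη hd hε hεd le_rfl hB1 h hr le_rfl hT0 hG
        (preserves_projFront h.convex ho hm) himp).mono hrisk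
  · intro Ω Ξ _ _ μ _ C f ξ h hC o ho G hG
    have hr := isSurrogate_gaugeRound hd h.convex hC hT0 hT1
    have hF := fun ω => isFront_gaugeFront hC (fun t x => G x (ξ t ω)) ho (one_le_numRounds α d ε)
    have hgrad : ∀ ω t, ∀ x ∈ C, ‖G x (ξ t ω)‖ ≤ 1 := fun ω t x hx => (hG x hx _).2
    have hq := clog_le hα hd hε hεd
    have hc : Nat.clog 2 (d * numRounds α d ε) * (20 * d) + 20 * d + d + 2 + d + 30 * d
        ≤ 20 * d * (Nat.clog 2 (d * numRounds α d ε) + 3) := by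
      rw [mul_add, mul_comm (20 * d)]
      omega
    have himp := fun ω =>
      (stoch_spec hα hη hd hε hεd hB1 le_rfl hr (hF ω) (hgrad ω) hq hc).1
    refine ⟨himp, fun ω τ hτ => ?_, fun hm ho1 ho2 => ?_⟩
    · exact (cost_stoch_le hα hη hd hε hεd hB1 le_rfl hr (hF ω) (hgrad ω) hq hc le_rfl hτ).trans
        (hwork _ (by positivity))
    · exact (excessRiskLE_stoch hα hη hd hε hεd hB1 le_rfl h hr hT0 le_rfl hG
        (preserves_gaugeFront hm ho1 ho2 _) himp).mono hrisk
  · intro Ω Ξ _ _ μ _ f ξ h o G hG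
    have hr := isSurrogate_projRound h.subset_ball
    have hF := fun ω => isFront_ballFront (fun t x => G x (ξ t ω)) o
    have hgrad : ∀ ω t, ∀ x ∈ Metric.closedBall (0 : Vec d) 1, ‖G x (ξ t ω)‖ ≤ 1 :=
      fun ω t x hx => (hG x hx _).2
    have hc : 9 * d ≤ 20 * d * (0 + 3) := by omega
    have hspec := fun ω => stoch_spec hα hη hd hε hεd le_rfl hB1 hr (hF ω) (hgrad ω) hq0 hc
    refine ⟨fun ω => (hspec ω).1, fun ω => ⟨Nat.le_zero.1 (hspec ω).2.1, ?_⟩, fun hm => ?_⟩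
    -- With oracle price `0`, the cost is the operation count alone, and `(d/ε) d²` is `d³/ε`.
    · have h1 := cost_stoch_le hα hη hd hε hεd le_rfl hB1 hr (hF ω) (hgrad ω) hq0 hc
        (Nat.zero_le _) le_rfl
      rw [Program.cost, zero_mul, add_zero] at h1
      refine (h1.trans (hwork _ (by positivity))).trans_eq ?_
      ring
    · exact (excessRiskLE_stoch hα hη hd hε hεd le_rfl hB1 h hr le_rfl hT0 hG
        (preserves_ballFront hm) fun ω => (hspec ω).1).mono hrisk
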